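/- Let $D$ be a diagram of an oriented generalized knot or link: a smooth immersion of finitely many oriented circles in the plane $\mathbb{R}^2$ whose only multiple points are finitely many transverse double points (the crossings), each crossing carrying a label from an arbitrary set of crossing types (for example real positive, real negative, virtual, flat, singular). Let $c(D)$ be the number of crossings of $D$, of whatever type. Smooth every crossing in the way that respects the orientation, i.e. join each of the two incoming strands to the outgoing strand of the other passage. The resulting closed curves are the Seifert circles of $D$, and $S(D)$ is their number. The Seifert graph $\Gamma(D)$ is the multigraph that has one vertex for each Seifert circle and one edge for each crossing, the edge of a crossing joining the Seifert circles that contain the two strands of the smoothed crossing. Then $\Gamma(D)$ is planar (it embeds topologically in $\mathbb{R}^2$) and bipartite (every cycle has even length, where a loop counts as a cycle of length $1$ and a pair of parallel edges as a cycle of length $2$; in particular $\Gamma(D)$ has no loops), and it is finite with $|E(\Gamma(D))| = c(D)$ and $|V(\Gamma(D))| = S(D)$. -/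

import Mathlib

open scoped ContDiff

/-- The Euclidean plane. -/
abbrev Plane : Type := EuclideanSpace ℝ (Fin 2)

/-! ### Planar and bipartite multigraphs -/

/-- A topological embedding of a multigraph in the plane: the vertices are distinct points, each
edge is an arc (for a loop: a simple closed curve) joining its ends, no arc passes through a vertex
in its interior, and the interiors of different arcs are disjoint. -/
structure PlaneDrawing {α β : Type*} (G : Graph α β) where
  /-- the position of a vertex -/
  point : α → Plane
  /-- the arc of an edge, parametrized by `[0, 1]` -/
  arc : β → ℝ → Plane
  point_injOn : Set.InjOn point G.vertexSet
  arc_continuousOn : ∀ e ∈ G.edgeSet, ContinuousOn (arc e) (Set.Icc 0 1)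
  arc_ends : ∀ e ∈ G.edgeSet, ∃ x y, G.IsLink e x y ∧ arc e 0 = point x ∧ arc e 1 = point y
  arc_injOn : ∀ e ∈ G.edgeSet, Set.InjOn (arc e) (Set.Ioo 0 1)
  arc_ne_point : ∀ e ∈ G.edgeSet, ∀ t ∈ Set.Ioo (0 : ℝ) 1, ∀ x ∈ G.vertexSet, arc e t ≠ point x
  arc_ne_arc : ∀ e ∈ G.edgeSet, ∀ f ∈ G.edgeSet, e ≠ f →
    ∀ s ∈ Set.Ioo (0 : ℝ) 1, ∀ t ∈ Set.Ioo (0 : ℝ) 1, arc e s ≠ arc f t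

/-- A multigraph is planar if it can be embedded in the plane. -/
def IsPlanarGraph {α β : Type*} (G : Graph α β) : Prop := Nonempty (PlaneDrawing G)

/-- A cycle of length `n` in a multigraph: `n ≥ 1` distinct vertices in cyclic order and `n`
distinct edges, the `i`-th one joining the `i`-th vertex to the next one. A loop is a cycle of
length `1`, and two parallel edges form a cycle of length `2`. -/
structure GraphCycle {α β : Type*} (G : Graph α β) (n : ℕ) where
  pos : 0 < n
  vertex : ZMod n → α
  edge : ZMod n → β
  vertex_injective : Function.Injective vertex
  edge_injective : Function.Injective edge
  isLink : ∀ i, G.IsLink (edge i) (vertex i) (vertex (i + 1))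

/-- A multigraph is bipartite if every cycle has even length (in particular, it has no loop). -/
def IsBipartiteGraph {α β : Type*} (G : Graph α β) : Prop :=
  ∀ n : ℕ, GraphCycle G n → Even n

/-! ### Diagrams

A family of `n` closed curves in the plane is given by `n` functions on `ℝ` of period `1`;
a parameter `(i, t)` stands for the point `t` modulo `1` of the `i`-th circle. -/

/-- Two parameters that stand for the same point of the disjoint union of the circles. -/
def SamePoint {n : ℕ} (a b : Fin n × ℝ) : Prop := a.1 = b.1 ∧ ∃ k : ℤ, b.2 = a.2 + k

/-- The points of the plane through which a family of closed curves passes more than once. -/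
def doublePoints {n : ℕ} (γ : Fin n → ℝ → Plane) : Set Plane :=
  {p | ∃ a b : Fin n × ℝ, ¬ SamePoint a b ∧ γ a.1 a.2 = p ∧ γ b.1 b.2 = p}

/-- An oriented generalized link diagram, with crossings of kinds taken from an arbitrary set `T`
(for instance positive, negative, virtual, flat, singular): a smooth immersion of finitely many
oriented circles in the plane whose only multiple points are finitely many transverse double
points, the crossings, each of them labelled by its kind. A knot diagram is the case of one
component. -/
structure GeneralizedLinkDiagram (T : Type*) where
  numComponents : ℕ
  curve : Fin numComponents → ℝ → Plane
  periodic : ∀ i, Function.Periodic (curve i) 1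
  contDiff : ∀ i, ContDiff ℝ ∞ (curve i)
  deriv_ne_zero : ∀ i t, deriv (curve i) t ≠ 0
  transverse : ∀ a b : Fin numComponents × ℝ, ¬ SamePoint a b →
    curve a.1 a.2 = curve b.1 b.2 →
    LinearIndependent ℝ ![deriv (curve a.1) a.2, deriv (curve b.1) b.2]
  no_triple : ∀ a b c : Fin numComponents × ℝ,
    curve a.1 a.2 = curve b.1 b.2 → curve a.1 a.2 = curve c.1 c.2 →
    SamePoint a b ∨ SamePoint a c ∨ SamePoint b c
  finite_doublePoints : (doublePoints curve).Finite
  kind : doublePoints curve → T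

lemma SamePoint.symm {n : ℕ} {a b : Fin n × ℝ} (h : SamePoint a b) : SamePoint b a := by
  obtain ⟨h1, k, hk⟩ := h
  exact ⟨h1.symm, -k, by rw [hk]; push_cast; ring⟩

lemma SamePoint.trans {n : ℕ} {a b c : Fin n × ℝ} (h : SamePoint a b) (h' : SamePoint b c) :
    SamePoint a c := by
  obtain ⟨h1, k, hk⟩ := h
  obtain ⟨h2, l, hl⟩ := h'
  exact ⟨h1.trans h2, k + l, by rw [hl, hk]; push_cast; ring⟩

namespace GeneralizedLinkDiagram

variable {T : Type*} (D : GeneralizedLinkDiagram T)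

/-- The crossings of the diagram, of whatever kind. -/
abbrev Crossing : Type := doublePoints D.curve

/-- `c(D)`, the number of crossings. -/
noncomputable def crossingNumber : ℕ := Nat.card D.Crossing

/-- A parameter at which the diagram does not pass through a crossing. -/
abbrev RegularParam : Type :=
  {r : Fin D.numComponents × ℝ // D.curve r.1 r.2 ∉ doublePoints D.curve}

/-- Moving forward from `r` along the diagram, one arrives at `a` before meeting a crossing. -/
def ArrivesAt (r : D.RegularParam) (a : Fin D.numComponents × ℝ) : Prop :=
  r.1.1 = a.1 ∧ r.1.2 < a.2 ∧ ∀ t ∈ Set.Ico r.1.2 a.2, D.curve a.1 t ∉ doublePoints D.curve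

/-- Moving forward from `a` along the diagram, one arrives at `r` before meeting a crossing
(other than the one at `a` itself, if there is one). -/
def DepartsFrom (r : D.RegularParam) (a : Fin D.numComponents × ℝ) : Prop :=
  r.1.1 = a.1 ∧ a.2 < r.1.2 ∧ ∀ t ∈ Set.Ioc a.2 r.1.2, D.curve a.1 t ∉ doublePoints D.curve

/-- The adjacencies in the diagram that is smoothed at all crossings, respecting the orientation:
one may move along the curves as long as no crossing is met, and where `a` and `b` are the two
passages through a crossing, the strand that arrives at `a` is joined to the one that departs
from `b`. -/
inductive SmoothedStep : D.RegularParam → D.RegularParam → Prop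
  | same (r s : D.RegularParam) (h : SamePoint r.1 s.1) : SmoothedStep r s
  | along (r s : D.RegularParam) (h : r.1.1 = s.1.1) (hle : r.1.2 ≤ s.1.2)
      (hreg : ∀ t ∈ Set.Icc r.1.2 s.1.2, D.curve r.1.1 t ∉ doublePoints D.curve) :
      SmoothedStep r s
  | turn (r s : D.RegularParam) (a b : Fin D.numComponents × ℝ) (hab : ¬ SamePoint a b)
      (hcross : D.curve a.1 a.2 = D.curve b.1 b.2)
      (hr : D.ArrivesAt r a) (hs : D.DepartsFrom s b) : SmoothedStep r s

/-- The Seifert circles: the components of the diagram smoothed at all crossings, that is, the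
classes of the equivalence relation generated by the steps above. -/
def SeifertCircle : Type := Quot D.SmoothedStep

/-- The Seifert circle that runs through a point of the diagram that is not a crossing. -/
def seifertCircle (r : D.RegularParam) : D.SeifertCircle := Quot.mk _ r

/-- `S(D)`, the number of Seifert circles. -/
noncomputable def numSeifertCircles : ℕ := Nat.card D.SeifertCircle

/-- The Seifert circles `x` and `y` run through the two strands of the smoothed crossing `e`:
one contains the strand that arrives along the first passage, the other the one that arrives along
the second passage. -/
def Joins (e : D.Crossing) (x y : D.SeifertCircle) : Prop :=
  ∃ (a b : Fin D.numComponents × ℝ) (r s : D.RegularParam), ¬ SamePoint a b ∧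
    D.curve a.1 a.2 = e ∧ D.curve b.1 b.2 = e ∧ D.ArrivesAt r a ∧ D.ArrivesAt s b ∧
    D.seifertCircle r = x ∧ D.seifertCircle s = y

variable {D}

lemma curve_add_int (i : Fin D.numComponents) (t : ℝ) (k : ℤ) :
    D.curve i (t + k) = D.curve i t := by
  have h := (D.periodic i).int_mul k t
  simpa using h

lemma seifertCircle_eq_of_arrivesAt {r r' : D.RegularParam} {a a' : Fin D.numComponents × ℝ}
    (h : D.ArrivesAt r a) (h' : D.ArrivesAt r' a') (haa : SamePoint a a') :
    D.seifertCircle r = D.seifertCircle r' := by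
  obtain ⟨⟨i, t⟩, hr⟩ := r
  obtain ⟨⟨i', t'⟩, hr'⟩ := r'
  obtain ⟨j, u⟩ := a
  obtain ⟨j', u'⟩ := a'
  obtain ⟨h1, h2, h3⟩ := h
  obtain ⟨h1', h2', h3'⟩ := h'
  obtain ⟨hj, k, hk⟩ := haa
  dsimp only at h1 h2 h3 h1' h2' h3' hj hk hr hr'
  subst h1 h1' hj hk
  have hreg : D.curve i (t + k) ∉ doublePoints D.curve := by rwa [curve_add_int]
  have e1 : D.seifertCircle ⟨(i, t), hr⟩ = D.seifertCircle ⟨(i, t + k), hreg⟩ :=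
    Quot.sound (.same _ _ ⟨rfl, k, rfl⟩)
  rw [e1]
  rcases le_total (t + k) t' with hle | hle
  · refine Quot.sound (.along _ _ rfl hle fun v hv => ?_)
    have hv' := h3 (v - k) ⟨by linarith [hv.1], by linarith [hv.2]⟩
    have := curve_add_int (D := D) i (v - k) k
    rw [sub_add_cancel] at this
    dsimp only
    rwa [this]
  · refine (Quot.sound (.along _ _ rfl hle fun v hv => ?_)).symm
    exact h3' v ⟨hv.1, by have := hv.2; dsimp only at this; linarith⟩

variable (D)

/-- The Seifert graph `Γ(D)`: its vertices are the Seifert circles, and every crossing is an edge,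
which joins the two Seifert circles that run through the smoothed crossing. (The definition does
not exclude that they coincide; the edge is then a loop.) -/
def seifertGraph : Graph D.SeifertCircle D.Crossing where
  vertexSet := Set.univ
  IsLink := D.Joins
  isLink_symm := fun _ _ => ⟨fun _ _ ⟨a, b, r, s, hab, ha, hb, hr, hs, hx, hy⟩ =>
    ⟨b, a, s, r, fun h => hab h.symm, hb, ha, hs, hr, hy, hx⟩⟩
  eq_or_eq_of_isLink_of_isLink := by
    rintro e x y v w ⟨a, b, r, s, hab, ha, hb, hr, hs, rfl, rfl⟩
      ⟨a', b', r', s', hab', ha', hb', hr', hs', rfl, rfl⟩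
    rcases D.no_triple a b a' (ha.trans hb.symm) (ha.trans ha'.symm) with h | h | h
    · exact absurd h hab
    · exact Or.inl (seifertCircle_eq_of_arrivesAt hr hr' h)
    · rcases D.no_triple a b b' (ha.trans hb.symm) (ha.trans hb'.symm) with h2 | h2 | h2
      · exact absurd h2 hab
      · exact Or.inr (seifertCircle_eq_of_arrivesAt hr hs' h2)
      · exact absurd (h.symm.trans h2) hab'
  left_mem_of_isLink := fun _ _ _ _ => Set.mem_univ _

end GeneralizedLinkDiagram

open Filter Topology Set

/-! Bipartiteness comes from the Alexander numbering. Off the diagram, the index of a point is the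
sum of the winding numbers of all components around it. It is a locally constant integer, and it is
larger by one on the left of the curve than on the right (`leftIndex_eq_rightIndex_add_one`). Two
strands that the oriented smoothing joins bound a common sector of the crossing and have it on the
same side, so the left index is constant along a Seifert circle (`leftIndex_eq_of_turn`,
`circleIndex`). The two strands that arrive at a crossing also bound a common sector, which lies to
the right of one and to the left of the other. So the two circles there have indices that differ by
one (`leftIndex_eq_add_one_of_arrivesAt`). The parity of the index is then a proper 2-colouring.

For planarity, the Seifert circles that meet crossings are first identified with the cycles of a
permutation of the finite set of passages (`Passage.sameCycle_of_circle_eq`). Each such circle, a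
closed path with corners, is thickened to a strip with coordinates x along the path and s in [-1, 1]
across it. At each corner the strip is shifted to the side to which the path turns, so that one
boundary line just reaches the crossing. For small width the strips are embedded and disjoint,
except that the two corners at a crossing touch in that point (`exists_strip_width`).

One point on the midline of each strip serves as the vertex. From it, segments that are straight in
the coordinates (x, s) run to the touching points; they meet only at their ends
(`halfArc_eq_halfArc`). The two segments that end in a crossing form its edge. Circles without
crossings are isolated vertices and are placed far away. Neither half of the argument uses the
Jordan curve theorem. -/

/-- The determinant of two plane vectors. -/
def cross (z w : ℂ) : ℝ := z.re * w.im - z.im * w.re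

/-- The determinant as a linear functional of its second argument. -/
noncomputable def crossL (z : ℂ) : ℂ →L[ℝ] ℝ := z.re • Complex.imCLM - z.im • Complex.reCLM

lemma crossL_apply (z w : ℂ) : crossL z w = cross z w := by simp [crossL, cross]

lemma continuous_cross : Continuous fun p : ℂ × ℂ => cross p.1 p.2 := by
  unfold cross
  fun_prop

lemma cross_swap (z w : ℂ) : cross w z = -cross z w := by unfold cross; ring

/-! ### Winding numbers and their jump across a curve -/

/-- The integrand is not jointly continuous where the denominator vanishes. So 1/w is written as
conj w / |w|², and the denominator is cut off below at (m/2)², where m is the distance from `z₀` to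
the curve segment. For |z - z₀| < m/2 this changes nothing. -/
lemma continuousAt_integral_div_sub {f f' : ℝ → ℂ} (hf : Continuous f) (hf' : Continuous f')
    {a b : ℝ} {z₀ : ℂ} (hz : ∀ x ∈ uIcc a b, f x ≠ z₀) :
    ContinuousAt (fun z => ∫ x in a..b, f' x / (f x - z)) z₀ := by
  obtain ⟨x₀, hx₀, hmin⟩ := isCompact_uIcc.exists_isMinOn (nonempty_uIcc (a := a) (b := b))
    (f := fun x => ‖f x - z₀‖) (by fun_prop)
  set m := ‖f x₀ - z₀‖ with hm
  have hmpos : 0 < m := norm_pos_iff.2 (sub_ne_zero.2 (hz x₀ hx₀))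
  let G : ℂ → ℝ → ℂ := fun z x =>
    f' x * (starRingEnd ℂ (f x - z) / ((max (‖f x - z‖ ^ 2) ((m / 2) ^ 2) : ℝ) : ℂ))
  have hG : Continuous (Function.uncurry G) := by
    refine Continuous.mul (by fun_prop) (Continuous.div ?_ ?_ ?_)
    · exact Complex.continuous_conj.comp (by fun_prop)
    · fun_prop
    · intro p
      have : 0 < max (‖f p.2 - p.1‖ ^ 2) ((m / 2) ^ 2) := lt_max_of_lt_right (by positivity)
      exact_mod_cast this.ne'
  have hcont := (intervalIntegral.continuous_parametric_intervalIntegral_of_continuous'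
    (μ := MeasureTheory.volume) hG a b).continuousAt (x := z₀)
  refine hcont.congr ?_
  filter_upwards [Metric.ball_mem_nhds z₀ (half_pos hmpos)] with z hzb
  refine intervalIntegral.integral_congr fun x hx => ?_
  have h1 : m ≤ ‖f x - z₀‖ := hmin hx
  have h2 : m / 2 ≤ ‖f x - z‖ := by
    have h3 : ‖z - z₀‖ < m / 2 := by simpa [dist_eq_norm] using hzb
    have h4 := norm_add_le (f x - z) (z - z₀)
    rw [sub_add_sub_cancel] at h4
    linarith
  have h5 : max (‖f x - z‖ ^ 2) ((m / 2) ^ 2) = ‖f x - z‖ ^ 2 :=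
    max_eq_left (by gcongr)
  have h6 : f x - z ≠ 0 := norm_pos_iff.1 (by linarith)
  simp only [G, h5]
  rw [div_eq_mul_inv (f' x), Complex.inv_def (f x - z), Complex.normSq_eq_norm_sq,
    div_eq_mul_inv, Complex.ofReal_inv]

/-- The winding number of a closed curve (parametrized by `[0, 1]`), as an integral. -/
noncomputable def windingIntegral (f : ℝ → ℂ) (z : ℂ) : ℂ :=
  (2 * Real.pi * Complex.I)⁻¹ * ∫ x in (0 : ℝ)..1, deriv f x / (f x - z)

/-- With A(t) the integral over [0, t], the function (f - z) exp(-A) has derivative zero. Its values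
at 0 and 1 agree and f 0 = f 1, so exp(-A(1)) = 1. -/
lemma exists_int_eq_windingIntegral {f : ℝ → ℂ} (hf : ContDiff ℝ 1 f) (h01 : f 0 = f 1)
    {z : ℂ} (hz : ∀ x, f x ≠ z) : ∃ k : ℤ, windingIntegral f z = k := by
  have hne : ∀ x, f x - z ≠ 0 := fun x => sub_ne_zero.2 (hz x)
  have hf' : Continuous (deriv f) := hf.continuous_deriv le_rfl
  have hq : Continuous fun x => deriv f x / (f x - z) :=
    hf'.div (by have := hf.continuous; fun_prop) hne
  let A : ℝ → ℂ := fun t => ∫ x in (0 : ℝ)..t, deriv f x / (f x - z)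
  have hA : ∀ t, HasDerivAt A (deriv f t / (f t - z)) t := fun t =>
    (hq.integral_hasStrictDerivAt 0 t).hasDerivAt
  have hd : ∀ t, HasDerivAt (fun t => (f t - z) * Complex.exp (-A t)) 0 t := by
    intro t
    have h1 : HasDerivAt f (deriv f t) t := (hf.differentiable one_ne_zero t).hasDerivAt
    have h2 := (h1.sub_const z).mul (hA t).fun_neg.cexp
    refine h2.congr_deriv ?_
    have := hne t
    field_simp
    ring
  have hconst := is_const_of_deriv_eq_zero (fun t => (hd t).differentiableAt)
    (fun t => (hd t).deriv) 0 1
  have hA0 : A 0 = 0 := intervalIntegral.integral_same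
  simp only [hA0, neg_zero, Complex.exp_zero, mul_one, ← h01] at hconst
  have h1 : Complex.exp (-A 1) = 1 := by
    exact (mul_left_cancel₀ (hne 0) ((mul_one _).trans hconst)).symm
  obtain ⟨k, hk⟩ := Complex.exp_eq_one_iff.1 h1
  refine ⟨-k, ?_⟩
  have h2 : A 1 = -(k * (2 * Real.pi * Complex.I)) := by rw [← hk, neg_neg]
  have h3 : (2 * Real.pi * Complex.I : ℂ) ≠ 0 := Complex.two_pi_I_ne_zero
  change (2 * Real.pi * Complex.I)⁻¹ * A 1 = _
  rw [h2]
  push_cast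
  field_simp

/-- Each end of the small interval in `tendsto_integral_jump` contributes one such difference of
principal logarithms; two of them make 2πi. -/
lemma log_I_mul_sub_log_neg_I_mul {w : ℂ} (hw : 0 < w.re) :
    Complex.log (Complex.I * w) - Complex.log (-(Complex.I * w)) = Real.pi * Complex.I := by
  have h : 0 < (Complex.I * w).im := by simpa using hw
  apply Complex.ext <;> simp [Complex.log, Complex.arg_neg_eq_arg_sub_pi_of_im_pos h]

/-- Only parameters near 0 matter, since elsewhere both integrals tend to the same limit. Near 0 the
functions log(s + i q) and log(s - i q) are primitives of the two integrands, and as s tends to 0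
their end values combine to πi at each end. -/
lemma tendsto_integral_jump {q q' : ℝ → ℂ} (hq : ∀ x, HasDerivAt q (q' x) x)
    (hq' : Continuous q') {a : ℝ} (ha : 0 < a) (h0 : q 0 = 0) (h0' : q' 0 = 1)
    (hinj : ∀ x ∈ Icc (-a) a, q x = 0 → x = 0) :
    Tendsto (fun s : ℝ => (∫ x in (-a)..a, q' x / (q x - s * Complex.I)) -
      ∫ x in (-a)..a, q' x / (q x + s * Complex.I)) (𝓝[>] 0) (𝓝 (2 * Real.pi * Complex.I)) := by
  have hqc : Continuous q := continuous_iff_continuousAt.2 fun x => (hq x).continuousAt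
  -- a small interval on which `q` is close to the identity
  obtain ⟨δ, hδ, hδa, hre⟩ : ∃ δ > 0, δ < a ∧ ∀ x ∈ Icc (-δ) δ, x ≠ 0 → 0 < x * (q x).re := by
    have hd : HasDerivAt (fun x => (q x).re) 1 0 := by
      have := Complex.reCLM.hasFDerivAt.comp_hasDerivAt (0 : ℝ) (hq 0)
      simpa [h0', Function.comp_def] using this
    -- The bound |re q(x) - x| ≤ |x|/2 forces re q(x) to have the sign of x.
    have ho := hd.isLittleO.def (c := 1 / 2) (by norm_num)
    obtain ⟨ρ, hρ, hball⟩ := Metric.eventually_nhds_iff.1 ho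
    refine ⟨min (ρ / 2) (a / 2), by positivity, (min_le_right _ _).trans_lt (by linarith), ?_⟩
    intro x hx hx0
    have hxr : |x| ≤ ρ / 2 := (abs_le.2 hx).trans (min_le_left _ _)
    have := hball (y := x) (by rw [dist_zero_right, Real.norm_eq_abs]; linarith)
    simp only [h0, Complex.zero_re, sub_zero, smul_eq_mul, mul_one, Real.norm_eq_abs] at this
    obtain ⟨h1, h2⟩ := abs_le.1 this
    rcases lt_or_gt_of_ne hx0 with h | h
    · rw [abs_of_neg h] at h1 h2
      nlinarith
    · rw [abs_of_pos h] at h1 h2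
      nlinarith
  have hreδ : 0 < (q δ).re := by
    have := hre δ ⟨by linarith, le_rfl⟩ hδ.ne'
    exact pos_of_mul_pos_right this hδ.le
  have hreδ' : 0 < (-q (-δ)).re := by
    have := hre (-δ) ⟨le_rfl, by linarith⟩ (by linarith)
    rw [Complex.neg_re]
    nlinarith
  -- The sign σ treats both integrals at once. The imaginary part is σ re q(x), which vanishes only
  -- at x = 0, where the value is s > 0.
  have hsl : ∀ (σ : ℝ), (σ = 1 ∨ σ = -1) → ∀ s : ℝ, 0 < s → ∀ x ∈ Icc (-δ) δ,
      (s + σ * (Complex.I * q x)) ∈ Complex.slitPlane := by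
    intro σ hσ s hs x hx
    rw [Complex.mem_slitPlane_iff]
    by_cases hx0 : x = 0
    · left; simp [hx0, h0, hs]
    · right
      have := hre x hx hx0
      have h2 : (q x).re ≠ 0 := fun h => by simp [h] at this
      rcases hσ with rfl | rfl <;> simpa using h2
  have hsmall : ∀ (σ : ℝ), (σ = 1 ∨ σ = -1) → ∀ s : ℝ, 0 < s →
      ∫ x in (-δ)..δ, q' x / (q x - σ * (s * Complex.I)) =
        Complex.log (s + σ * (Complex.I * q δ)) - Complex.log (s + σ * (Complex.I * q (-δ))) := by
    intro σ hσ s hs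
    have hσ2 : (σ : ℂ) * σ = 1 := by rcases hσ with rfl | rfl <;> norm_num
    have hden : ∀ x ∈ Icc (-δ) δ, q x - σ * (s * Complex.I) ≠ 0 := by
      intro x hx h
      have h1 := Complex.slitPlane_ne_zero (hsl σ hσ s hs x hx)
      apply h1
      rw [sub_eq_zero.1 h]
      linear_combination σ * σ * s * Complex.I_sq - s * hσ2
    apply intervalIntegral.integral_eq_sub_of_hasDerivAt
      (f := fun x => Complex.log (s + σ * (Complex.I * q x)))
    · intro x hx
      rw [uIcc_of_le (by linarith)] at hx
      have h1 : HasDerivAt (fun x => (s : ℂ) + σ * (Complex.I * q x))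
          (σ * (Complex.I * q' x)) x := (((hq x).const_mul _).const_mul _).const_add _
      refine (h1.clog_real (hsl σ hσ s hs x hx)).congr_deriv ?_
      rw [div_eq_div_iff (Complex.slitPlane_ne_zero (hsl σ hσ s hs x hx)) (hden x hx)]
      linear_combination s * q' x * hσ2 - s * q' x * σ * σ * Complex.I_sq
    · apply ContinuousOn.intervalIntegrable
      rw [uIcc_of_le (by linarith)]
      exact hq'.continuousOn.div (by fun_prop) hden
  have hfar : ∀ b c : ℝ, (∀ x ∈ uIcc b c, q x ≠ 0) →
      Tendsto (fun s : ℝ => (∫ x in b..c, q' x / (q x - s * Complex.I)) -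
        ∫ x in b..c, q' x / (q x + s * Complex.I)) (𝓝[>] 0) (𝓝 0) := by
    intro b c hbc
    have hc := continuousAt_integral_div_sub hqc hq' hbc
    have t1 : Tendsto (fun s : ℝ => (s * Complex.I : ℂ)) (𝓝[>] 0) (𝓝 0) := by
      have : Continuous (fun s : ℝ => (s * Complex.I : ℂ)) := by fun_prop
      simpa using (this.tendsto 0).mono_left nhdsWithin_le_nhds
    have t2 : Tendsto (fun s : ℝ => (-(s * Complex.I) : ℂ)) (𝓝[>] 0) (𝓝 0) := by
      simpa using t1.neg
    have := (hc.tendsto.comp t1).sub (hc.tendsto.comp t2)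
    simpa [Function.comp_def] using this
  have hnear : Tendsto (fun s : ℝ => (∫ x in (-δ)..δ, q' x / (q x - s * Complex.I)) -
        ∫ x in (-δ)..δ, q' x / (q x + s * Complex.I)) (𝓝[>] 0) (𝓝 (2 * Real.pi * Complex.I)) := by
    have hlim : ∀ (σ : ℝ), (σ = 1 ∨ σ = -1) → ∀ w : ℂ, w.re ≠ 0 →
        Tendsto (fun s : ℝ => Complex.log (s + σ * (Complex.I * w))) (𝓝[>] 0)
          (𝓝 (Complex.log (σ * (Complex.I * w)))) := by
      intro σ hσ w hw
      have h1 : σ * (Complex.I * w) ∈ Complex.slitPlane := by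
        rw [Complex.mem_slitPlane_iff]
        right
        rcases hσ with rfl | rfl <;> simpa using hw
      have h2 : Tendsto (fun s : ℝ => (s + σ * (Complex.I * w) : ℂ)) (𝓝[>] 0)
          (𝓝 (σ * (Complex.I * w))) := by
        have : Continuous (fun s : ℝ => (s + σ * (Complex.I * w) : ℂ)) := by fun_prop
        simpa using (this.tendsto 0).mono_left nhdsWithin_le_nhds
      exact h2.clog h1
    have e1 := log_I_mul_sub_log_neg_I_mul hreδ
    have e2 := log_I_mul_sub_log_neg_I_mul hreδ'
    have hneg : (q (-δ)).re ≠ 0 := by simpa using hreδ'.ne'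
    have := ((hlim 1 (Or.inl rfl) _ hreδ.ne').sub (hlim 1 (Or.inl rfl) _ hneg)).sub
      ((hlim (-1) (Or.inr rfl) _ hreδ.ne').sub (hlim (-1) (Or.inr rfl) _ hneg))
    refine (this.congr' ?_).trans_eq ?_
    · filter_upwards [self_mem_nhdsWithin] with s hs
      rw [← hsmall 1 (Or.inl rfl) s hs, ← hsmall (-1) (Or.inr rfl) s hs]
      simp
    · congr 1
      simp only [mul_neg, neg_neg] at e2
      push_cast
      simp only [one_mul, neg_mul]
      linear_combination e1 + e2
  have hzero : ∀ x ∈ Icc (-a) a, x ≠ 0 → q x ≠ 0 := fun x hx hx0 h => hx0 (hinj x hx h)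
  have h1 := hfar (-a) (-δ) (by
    intro x hx
    rw [uIcc_of_le (by linarith)] at hx
    exact hzero x ⟨hx.1, by linarith [hx.2]⟩ (by linarith [hx.2]))
  have h2 := hfar δ a (by
    intro x hx
    rw [uIcc_of_le (by linarith)] at hx
    exact hzero x ⟨by linarith [hx.1], hx.2⟩ (by linarith [hx.1]))
  have h3 := (h1.add hnear).add h2
  simp only [zero_add, add_zero] at h3
  refine h3.congr' ?_
  have hseg : ∀ c : ℂ, (∀ x ∈ Icc (-δ) δ, q x - c ≠ 0) → (∀ x ∈ Icc (-a) (-δ), q x - c ≠ 0) →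
      (∀ x ∈ Icc δ a, q x - c ≠ 0) →
      (∫ x in (-a)..(-δ), q' x / (q x - c)) + (∫ x in (-δ)..δ, q' x / (q x - c)) +
        (∫ x in δ..a, q' x / (q x - c)) = ∫ x in (-a)..a, q' x / (q x - c) := by
    intro c hc1 hc2 hc3
    have i1 : IntervalIntegrable (fun x => q' x / (q x - c)) MeasureTheory.volume (-a) (-δ) := by
      apply ContinuousOn.intervalIntegrable
      rw [uIcc_of_le (by linarith)]
      exact hq'.continuousOn.div (by fun_prop) hc2
    have i2 : IntervalIntegrable (fun x => q' x / (q x - c)) MeasureTheory.volume (-δ) δ := by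
      apply ContinuousOn.intervalIntegrable
      rw [uIcc_of_le (by linarith)]
      exact hq'.continuousOn.div (by fun_prop) hc1
    have i3 : IntervalIntegrable (fun x => q' x / (q x - c)) MeasureTheory.volume δ a := by
      apply ContinuousOn.intervalIntegrable
      rw [uIcc_of_le (by linarith)]
      exact hq'.continuousOn.div (by fun_prop) hc3
    rw [intervalIntegral.integral_add_adjacent_intervals i1 i2,
      intervalIntegral.integral_add_adjacent_intervals (i1.trans i2) i3]
  -- away from the parameter `0` the curve stays at a positive distance from `0`
  obtain ⟨m, hm, hbd⟩ : ∃ m > 0, ∀ x ∈ Icc (-a) (-δ) ∪ Icc δ a, m ≤ ‖q x‖ := by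
    have hK : IsCompact (Icc (-a) (-δ) ∪ Icc δ a) := isCompact_Icc.union isCompact_Icc
    obtain ⟨x₀, hx₀, hmin⟩ := hK.exists_isMinOn ⟨δ, Or.inr ⟨le_rfl, hδa.le⟩⟩
      (f := fun x => ‖q x‖) (by fun_prop)
    refine ⟨‖q x₀‖, norm_pos_iff.2 (hzero x₀ ?_ ?_), fun x hx => hmin hx⟩
    · rcases hx₀ with h | h
      · exact ⟨h.1, by linarith [h.2]⟩
      · exact ⟨by linarith [h.1], h.2⟩
    · rcases hx₀ with h | h
      · linarith [h.2]
      · linarith [h.1]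
  -- For s < m the poles ±si stay off the outer pieces of the curve, so all three integrands are
  -- continuous and the integrals add up.
  filter_upwards [Ioo_mem_nhdsGT hm] with s hs
  have hc : ∀ σ : ℝ, (σ = 1 ∨ σ = -1) →
      (∫ x in (-a)..(-δ), q' x / (q x - σ * (s * Complex.I))) +
        (∫ x in (-δ)..δ, q' x / (q x - σ * (s * Complex.I))) +
        (∫ x in δ..a, q' x / (q x - σ * (s * Complex.I))) =
        ∫ x in (-a)..a, q' x / (q x - σ * (s * Complex.I)) := by
    intro σ hσ
    have hnorm : ‖(σ * (s * Complex.I) : ℂ)‖ = s := by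
      rcases hσ with rfl | rfl <;> simp [abs_of_pos hs.1]
    apply hseg
    · intro x hx h
      have h1 := Complex.slitPlane_ne_zero (hsl σ hσ s hs.1 x hx)
      have hσ2 : (σ : ℂ) * σ = 1 := by rcases hσ with rfl | rfl <;> norm_num
      apply h1
      rw [sub_eq_zero.1 h]
      linear_combination σ * σ * s * Complex.I_sq - s * hσ2
    · intro x hx h
      have := hbd x (Or.inl hx)
      rw [sub_eq_zero.1 h, hnorm] at this
      linarith [hs.2]
    · intro x hx h
      have := hbd x (Or.inr hx)
      rw [sub_eq_zero.1 h, hnorm] at this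
      linarith [hs.2]
  have c1 := hc 1 (Or.inl rfl)
  have c2 := hc (-1) (Or.inr rfl)
  simp only [Complex.ofReal_one, one_mul, Complex.ofReal_neg, neg_mul, sub_neg_eq_add] at c1 c2
  rw [← c1, ← c2]
  ring

/-- Dividing by the velocity d gives q(x) = (f(t + x) - f(t))/d with q(0) = 0 and q'(0) = 1, the
normal form of `tendsto_integral_jump`. Periodicity centres the interval of integration at t, and
since the point is passed only once per period, 0 is the only zero of q in [-1/2, 1/2]. -/
lemma tendsto_windingIntegral_jump {f : ℝ → ℂ} (hf : ContDiff ℝ 1 f) (hper : Function.Periodic f 1)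
    {t : ℝ} (hd : deriv f t ≠ 0) (hinj : ∀ t', f t' = f t → ∃ k : ℤ, t' = t + k) :
    Tendsto (fun s : ℝ => windingIntegral f (f t + s * (Complex.I * deriv f t)) -
      windingIntegral f (f t - s * (Complex.I * deriv f t))) (𝓝[>] 0) (𝓝 1) := by
  set d := deriv f t with hdd
  have hperd : Function.Periodic (deriv f) 1 := fun x => by
    have := deriv_comp_add_const f 1 x
    rw [← this]
    congr 1
    exact funext hper
  have hW : ∀ z, windingIntegral f (f t + z * d) = (2 * Real.pi * Complex.I)⁻¹ *
      ∫ x in (-(1 / 2) : ℝ)..(1 / 2), (deriv f (t + x) / d) / ((f (t + x) - f t) / d - z) := by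
    intro z
    unfold windingIntegral
    congr 1
    have hp : Function.Periodic (fun x => deriv f x / (f x - (f t + z * d))) 1 := fun x => by
      simp only [hperd x, hper x]
    have h1 := hp.intervalIntegral_add_eq 0 (t + -(1 / 2))
    rw [zero_add] at h1
    have h2 := intervalIntegral.integral_comp_add_left
      (fun x => deriv f x / (f x - (f t + z * d))) t (a := -(1 / 2)) (b := 1 / 2)
    rw [h1, show t + -(1 / 2) + 1 = t + 1 / 2 by ring, ← h2]
    refine intervalIntegral.integral_congr fun x _ => ?_
    rw [show f (t + x) - (f t + z * d) = ((f (t + x) - f t) / d - z) * d by field_simp; ring,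
      div_div, mul_comm]
  have hj := tendsto_integral_jump (q := fun x => (f (t + x) - f t) / d)
    (q' := fun x => deriv f (t + x) / d) (a := 1 / 2)
    (fun x => by
      have h1 : HasDerivAt f (deriv f (t + x)) (t + x) :=
        (hf.differentiable one_ne_zero _).hasDerivAt
      exact ((h1.comp_const_add t x).sub_const _).div_const d)
    (by have := hf.continuous_deriv le_rfl; fun_prop) (by norm_num) (by simp)
    (by simp [← hdd, hd])
    (fun x hx h => by
      have h1 : f (t + x) = f t := by
        have := (div_eq_zero_iff.1 h).resolve_right hd
        exact sub_eq_zero.1 this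
      obtain ⟨k, hk⟩ := hinj _ h1
      have hxk : x = k := by linarith
      have h2 : |(k : ℝ)| < 1 := by
        rw [← hxk]; exact (abs_le.2 hx).trans_lt (by norm_num)
      have h3 : |k| < 1 := by exact_mod_cast h2
      rw [hxk, Int.abs_lt_one_iff.1 h3]
      simp)
  have h2 := hj.const_mul ((2 * Real.pi * Complex.I)⁻¹)
  rw [inv_mul_cancel₀ Complex.two_pi_I_ne_zero] at h2
  refine h2.congr fun s => ?_
  have e1 := hW (s * Complex.I)
  have e2 := hW (-(s * Complex.I))
  rw [show f t + s * (Complex.I * d) = f t + s * Complex.I * d by ring,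
    show f t - s * (Complex.I * d) = f t + -(s * Complex.I) * d by ring, e1, e2, ← mul_sub]
  simp only [sub_neg_eq_add]

lemma SamePoint.refl {n : ℕ} (a : Fin n × ℝ) : SamePoint a a := ⟨rfl, 0, by simp⟩

lemma exists_eq_add_int_mem_Ico (t : ℝ) : ∃ k : ℤ, t + k ∈ Ico (0 : ℝ) 1 :=
  ⟨-⌊t⌋, by
    have h1 := Int.fract_nonneg t
    have h2 := Int.fract_lt_one t
    unfold Int.fract at h1 h2
    push_cast
    exact ⟨by linarith, by linarith⟩⟩

/-! ### The diagram in the complex line -/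

/-- The plane as the complex line. -/
noncomputable def planeEquivComplex : Plane ≃ₗᵢ[ℝ] ℂ := Complex.orthonormalBasisOneI.repr.symm

namespace GeneralizedLinkDiagram

variable {T : Type*} (D : GeneralizedLinkDiagram T)

/-- The curves of the diagram in the complex line. -/
noncomputable def z (i : Fin D.numComponents) (t : ℝ) : ℂ := planeEquivComplex (D.curve i t)

/-- The velocity of the curves of the diagram in the complex line. -/
noncomputable def vel (i : Fin D.numComponents) (t : ℝ) : ℂ := deriv (D.z i) t

/-- The parameter passes through a crossing. -/
def IsDouble (a : Fin D.numComponents × ℝ) : Prop := D.curve a.1 a.2 ∈ doublePoints D.curve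

/-- The underlying set of the diagram. -/
def image : Set ℂ := {w | ∃ i t, D.z i t = w}

variable {D}

lemma z_eq_iff {i j : Fin D.numComponents} {s t : ℝ} :
    D.z i s = D.z j t ↔ D.curve i s = D.curve j t := planeEquivComplex.injective.eq_iff

lemma z_add_int (i : Fin D.numComponents) (t : ℝ) (k : ℤ) : D.z i (t + k) = D.z i t := by
  rw [z_eq_iff, curve_add_int]

lemma z_contDiff (i : Fin D.numComponents) : ContDiff ℝ ∞ (D.z i) :=
  planeEquivComplex.contDiff.comp (D.contDiff i)

lemma continuous_z (i : Fin D.numComponents) : Continuous (D.z i) := (z_contDiff i).continuous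

lemma hasDerivAt_z (i : Fin D.numComponents) (t : ℝ) : HasDerivAt (D.z i) (D.vel i t) t :=
  ((z_contDiff i).differentiable (by simp) t).hasDerivAt

lemma vel_contDiff (i : Fin D.numComponents) : ContDiff ℝ ∞ (D.vel i) :=
  (contDiff_infty_iff_deriv.1 (z_contDiff i)).2

lemma continuous_vel (i : Fin D.numComponents) : Continuous (D.vel i) := (vel_contDiff i).continuous

lemma vel_eq (i : Fin D.numComponents) (t : ℝ) :
    D.vel i t = planeEquivComplex (deriv (D.curve i) t) := by
  have h : HasDerivAt (D.curve i) (deriv (D.curve i) t) t :=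
    ((D.contDiff i).differentiable (by simp) t).hasDerivAt
  exact (planeEquivComplex.toContinuousLinearEquiv.hasFDerivAt.comp_hasDerivAt t h).deriv

lemma vel_ne_zero (i : Fin D.numComponents) (t : ℝ) : D.vel i t ≠ 0 := by
  rw [vel_eq]
  exact (map_ne_zero_iff _ planeEquivComplex.injective).2 (D.deriv_ne_zero i t)

lemma vel_add_int (i : Fin D.numComponents) (t : ℝ) (k : ℤ) : D.vel i (t + k) = D.vel i t := by
  unfold vel
  rw [← deriv_comp_add_const]
  congr 1
  exact funext fun s => z_add_int i s k

lemma z_eq_of_samePoint {a b : Fin D.numComponents × ℝ} (h : SamePoint a b) :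
    D.z a.1 a.2 = D.z b.1 b.2 := by
  obtain ⟨h1, k, hk⟩ := h
  rw [← h1, hk, z_add_int]

lemma vel_eq_of_samePoint {a b : Fin D.numComponents × ℝ} (h : SamePoint a b) :
    D.vel a.1 a.2 = D.vel b.1 b.2 := by
  obtain ⟨h1, k, hk⟩ := h
  rw [← h1, hk, vel_add_int]

lemma isDouble_iff {a : Fin D.numComponents × ℝ} :
    D.IsDouble a ↔ ∃ b, ¬ SamePoint a b ∧ D.z a.1 a.2 = D.z b.1 b.2 := by
  constructor
  · rintro ⟨b, c, hbc, hb, hc⟩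
    by_cases hab : SamePoint a b
    · exact ⟨c, fun hac => hbc (hab.symm.trans hac), z_eq_iff.2 hc.symm⟩
    · exact ⟨b, hab, z_eq_iff.2 hb.symm⟩
  · rintro ⟨b, hab, h⟩
    exact ⟨a, b, hab, rfl, z_eq_iff.1 h.symm⟩

lemma isDouble_congr {a b : Fin D.numComponents × ℝ} (h : D.z a.1 a.2 = D.z b.1 b.2) :
    D.IsDouble a ↔ D.IsDouble b := by
  unfold IsDouble
  rw [z_eq_iff.1 h]

lemma samePoint_of_not_isDouble {a b : Fin D.numComponents × ℝ} (ha : ¬ D.IsDouble a)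
    (h : D.z a.1 a.2 = D.z b.1 b.2) : SamePoint a b := by
  by_contra hab
  exact ha (isDouble_iff.2 ⟨b, hab, h⟩)

lemma samePoint_or_of_eq {a b c : Fin D.numComponents × ℝ} (hab : ¬ SamePoint a b)
    (h : D.z a.1 a.2 = D.z b.1 b.2) (h' : D.z a.1 a.2 = D.z c.1 c.2) :
    SamePoint a c ∨ SamePoint b c :=
  (D.no_triple a b c (z_eq_iff.1 h) (z_eq_iff.1 h')).resolve_left hab

/-- If the determinant vanished, the imaginary parts and the real parts of the two velocities would
each supply coefficients of a linear relation; independence would then make a velocity zero. -/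
lemma cross_vel_ne_zero {a b : Fin D.numComponents × ℝ} (hab : ¬ SamePoint a b)
    (h : D.z a.1 a.2 = D.z b.1 b.2) : cross (D.vel a.1 a.2) (D.vel b.1 b.2) ≠ 0 := by
  have hli := D.transverse a b hab (z_eq_iff.1 h)
  have hli' := hli.map' planeEquivComplex.toLinearEquiv.toLinearMap (LinearEquiv.ker _)
  intro h0
  have he : ![D.vel a.1 a.2, D.vel b.1 b.2] = planeEquivComplex.toLinearEquiv.toLinearMap ∘
      ![deriv (D.curve a.1) a.2, deriv (D.curve b.1) b.2] := by
    ext i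
    fin_cases i
    · exact vel_eq a.1 a.2
    · exact vel_eq b.1 b.2
  have h1 := LinearIndependent.pair_iff.1 (he ▸ hli')
  unfold cross at h0
  have h2 := h1 (D.vel b.1 b.2).im (-(D.vel a.1 a.2).im) (by
    apply Complex.ext <;> simp <;> linarith)
  have h3 := h1 (D.vel b.1 b.2).re (-(D.vel a.1 a.2).re) (by
    apply Complex.ext <;> simp <;> linarith)
  exact vel_ne_zero b.1 b.2 (Complex.ext h3.1 h2.1)

/-- Points of the diagram near `p` come from parameters near the preimages of `p`. -/
lemma eventually_mem_image {p : ℂ} (A : Set (Fin D.numComponents × ℝ))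
    (hA : ∀ c : Fin D.numComponents × ℝ, D.z c.1 c.2 = p → ∃ a ∈ A, SamePoint a c)
    {δ : ℝ} (hδ : 0 < δ) :
    ∀ᶠ w in 𝓝 p, w ∈ D.image → ∃ a ∈ A, ∃ t, |t - a.2| < δ ∧ D.z a.1 t = w := by
  have key : ∀ i, ∀ᶠ w in 𝓝 p, ∀ t ∈ Icc (0 : ℝ) 1, D.z i t = w →
      ∃ a ∈ A, ∃ t', |t' - a.2| < δ ∧ D.z a.1 t' = w := by
    intro i
    -- By compactness of a period it suffices to look near one t: either `D.z i t` differs from p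
    -- and nearby points stay apart, or t is an integer shift of a parameter in A.
    refine isCompact_Icc.eventually_forall_of_forall_eventually fun t _ => ?_
    by_cases hp : D.z i t = p
    · obtain ⟨a, haA, h1, k, hk⟩ := hA (i, t) hp
      have : ∀ᶠ x : ℂ × ℝ in 𝓝 (p, t), dist x.2 t < δ :=
        (continuous_snd.tendsto (p, t)).eventually (Metric.ball_mem_nhds t hδ)
      filter_upwards [this] with x hx hxw
      refine ⟨a, haA, x.2 + (-k : ℤ), ?_, ?_⟩
      · rw [Real.dist_eq] at hx
        dsimp only at hk
        convert hx using 2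
        rw [hk]
        push_cast
        ring
      · rw [z_add_int, h1]
        exact hxw
    · have hc : Continuous fun x : ℂ × ℝ => D.z i x.2 - x.1 :=
        ((continuous_z i).comp continuous_snd).sub continuous_fst
      have : ∀ᶠ x : ℂ × ℝ in 𝓝 (p, t), D.z i x.2 - x.1 ≠ 0 :=
        hc.continuousAt.eventually_ne (sub_ne_zero.2 hp)
      filter_upwards [this] with x hx hxw
      exact absurd (sub_eq_zero.2 hxw) hx
  filter_upwards [eventually_all.2 key] with w hw
  rintro ⟨i, t, rfl⟩
  obtain ⟨k, hk⟩ := exists_eq_add_int_mem_Ico t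
  exact hw i (t + k) (Ico_subset_Icc_self hk) (z_add_int i t k)

lemma isClosed_image : IsClosed D.image := by
  rw [← isOpen_compl_iff, isOpen_iff_mem_nhds]
  intro p hp
  filter_upwards [eventually_mem_image (p := p) ∅ (fun c hc => absurd ⟨c.1, c.2, hc⟩ hp)
    one_pos] with w hw hwi
  obtain ⟨a, ha, _⟩ := hw hwi
  exact ha

end GeneralizedLinkDiagram

/-! ### Displacing points off germs of curves -/

/-- A curve is strictly monotone near `t` with respect to a functional that is positive on its
velocity. -/
lemma strictMonoOn_crossL {f f' : ℝ → ℂ} (hf : ∀ t, HasDerivAt f (f' t) t) {n : ℂ} {s : Set ℝ}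
    (hs : Convex ℝ s) (hpos : ∀ t ∈ s, 0 < cross (f' t) n) :
    StrictMonoOn (fun t => cross (f t) n) s := by
  have hd : ∀ t, HasDerivAt (fun t => cross (f t) n) (cross (f' t) n) t := by
    intro t
    have := ((crossL n).hasFDerivAt.comp_hasDerivAt t (hf t)).fun_neg
    simpa only [Function.comp_def, crossL_apply, cross_swap n, neg_neg] using this
  refine strictMonoOn_of_deriv_pos hs (fun t _ => (hd t).continuousAt.continuousWithinAt) ?_
  intro t ht
  rw [(hd t).deriv]
  exact hpos t (interior_subset ht)

/-- First order growth of a curve with respect to a functional that is positive on its velocity. -/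
lemma eventually_cross_growth {f : ℝ → ℂ} {f₀ : ℂ} {t₀ : ℝ} (hf : HasDerivAt f f₀ t₀) {m : ℂ}
    (hpos : 0 < cross m f₀) :
    ∀ᶠ t in 𝓝 t₀, (t₀ ≤ t → cross m f₀ / 2 * (t - t₀) ≤ cross m (f t - f t₀)) ∧
      (t ≤ t₀ → cross m (f t - f t₀) ≤ cross m f₀ / 2 * (t - t₀)) := by
  have h1 := ((crossL m).hasFDerivAt.comp_hasDerivAt t₀ hf).isLittleO.def
    (c := cross m f₀ / 2) (by linarith)
  filter_upwards [h1] with t ht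
  simp only [Function.comp, crossL_apply, smul_eq_mul, Real.norm_eq_abs] at ht
  have e : cross m (f t) - cross m (f t₀) = cross m (f t - f t₀) := by
    simp only [← crossL_apply, map_sub]
  rw [e] at ht
  obtain ⟨h2, h3⟩ := abs_le.1 ht
  constructor <;> intro h
  · rw [abs_of_nonneg (sub_nonneg.2 h)] at *
    linarith
  · rw [abs_of_nonpos (sub_nonpos.2 h)] at *
    linarith

/-- For the corner path formed by two curve germs, points displaced from the corner path towards the
side it turns to do not lie on the two curves. -/
lemma corner_displaced_ne {f₁ f₂ f₁' f₂' : ℝ → ℂ} (h₁ : ∀ t, HasDerivAt f₁ (f₁' t) t)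
    (h₂ : ∀ t, HasDerivAt f₂ (f₂' t) t) (c₁ : Continuous f₁') (c₂ : Continuous f₂')
    (h0 : f₁ 0 = f₂ 0) (hpos : 0 < cross (f₁' 0) (f₂' 0)) :
    ∃ δ > 0, ∀ x ∈ Ioo (-δ) δ, ∀ s > (0 : ℝ), ∀ t ∈ Ioo (-δ) δ,
      (if x ≤ 0 then f₁ x else f₂ x) + s * (f₂' 0 - f₁' 0) ≠ f₁ t ∧
      (if x ≤ 0 then f₁ x else f₂ x) + s * (f₂' 0 - f₁' 0) ≠ f₂ t := by
  set u := f₁' 0 with hu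
  set v := f₂' 0 with hv
  set n := v - u with hn
  have hun : 0 < cross u n := by simp only [cross, hn, Complex.sub_re, Complex.sub_im] at *; linarith
  have hvn : 0 < cross v n := by simp only [cross, hn, Complex.sub_re, Complex.sub_im] at *; linarith
  have e1 : ∀ᶠ t in 𝓝 (0 : ℝ), 0 < cross (f₁' t) n :=
    (continuous_cross.comp (c₁.prodMk continuous_const)).continuousAt.eventually
      (lt_mem_nhds hun)
  have e2 : ∀ᶠ t in 𝓝 (0 : ℝ), 0 < cross (f₂' t) n :=
    (continuous_cross.comp (c₂.prodMk continuous_const)).continuousAt.eventually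
      (lt_mem_nhds hvn)
  -- Two functionals control the corner. The height cross (u + v) falls along `f₁`, rises along
  -- `f₂`, and grows under displacement by n. So a displaced point on `f₁` has t < 0 and one on `f₂`
  -- has t > 0. The functional cross (·) n is unchanged by the displacement and strictly increases
  -- through the corner, so it forces t = x, hence s * n = 0.
  have hg1 : 0 < cross (-(u + v)) u := by
    simp only [cross, Complex.neg_re, Complex.neg_im, Complex.add_re, Complex.add_im] at *; linarith
  have hg2 : 0 < cross (u + v) v := by
    simp only [cross, Complex.add_re, Complex.add_im] at *; linarith
  have g1 := eventually_cross_growth (h₁ 0) hg1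
  have g2 := eventually_cross_growth (h₂ 0) hg2
  obtain ⟨δ, hδ, hball⟩ := Metric.eventually_nhds_iff.1 (e1.and (e2.and (g1.and g2)))
  have hmem : ∀ t ∈ Ioo (-δ) δ, dist t 0 < δ := fun t ht => by
    rw [Real.dist_eq, sub_zero]; exact abs_lt.2 ht
  have m1 := strictMonoOn_crossL h₁ (convex_Ioo (-δ) δ) (n := n)
    (fun t ht => (hball (hmem t ht)).1)
  have m2 := strictMonoOn_crossL h₂ (convex_Ioo (-δ) δ) (n := n)
    (fun t ht => (hball (hmem t ht)).2.1)
  have hneg : ∀ w, cross (-(u + v)) w = -cross (u + v) w := fun w => by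
    simp only [cross, Complex.neg_re, Complex.neg_im]; ring
  have z0 : (0 : ℝ) ∈ Ioo (-δ) δ := ⟨by linarith, hδ⟩
  have hetan : 0 < cross (u + v) n := by
    simp only [cross, hn, Complex.add_re, Complex.add_im, Complex.sub_re, Complex.sub_im] at *
    linarith
  -- the height of the corner path
  have hk : ∀ x ∈ Ioo (-δ) δ, 0 ≤ cross (u + v) ((if x ≤ 0 then f₁ x else f₂ x) - f₁ 0) := by
    intro x hx
    split_ifs with hx0
    · have := (hball (hmem x hx)).2.2.1.2 hx0
      rw [hneg (f₁ x - _)] at this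
      nlinarith
    · have := (hball (hmem x hx)).2.2.2.1 (by linarith)
      rw [h0]
      nlinarith
  have hadd : ∀ (w w' : ℂ) (s : ℝ), cross (u + v) (w + s * n - w') =
      cross (u + v) (w - w') + s * cross (u + v) n := fun w w' s => by
    simp [cross]; ring
  have hpar : ∀ (w : ℂ) (s : ℝ), cross (w + s * n) n = cross w n := fun w s => by
    simp [cross]; ring
  have hn0 : n ≠ 0 := fun h => by rw [h] at hun; simp [cross] at hun
  refine ⟨δ, hδ, fun x hx s hs t ht => ⟨fun h => ?_, fun h => ?_⟩⟩
  · have h1 := hadd (if x ≤ 0 then f₁ x else f₂ x) (f₁ 0) s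
    rw [h] at h1
    have h2 : 0 < cross (u + v) (f₁ t - f₁ 0) := by
      rw [h1]; have := hk x hx; positivity
    have ht0 : t < 0 := by
      by_contra hcon
      have := (hball (hmem t ht)).2.2.1.1 (not_lt.1 hcon)
      rw [hneg (f₁ t - _)] at this
      nlinarith [not_lt.1 hcon]
    have h3 := hpar (if x ≤ 0 then f₁ x else f₂ x) s
    rw [h] at h3
    split_ifs at h h3 with hx0
    · have := m1.injOn ht hx h3
      rw [this] at h
      simp [hs.ne', hn0] at h
    · have q1 := m1 ht z0 ht0
      have q2 := m2 z0 hx (not_le.1 hx0)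
      simp only [h0] at q1 q2
      linarith
  · have h1 := hadd (if x ≤ 0 then f₁ x else f₂ x) (f₁ 0) s
    rw [h] at h1
    have h2 : 0 < cross (u + v) (f₂ t - f₂ 0) := by
      rw [← h0, h1]; have := hk x hx; positivity
    have ht0 : 0 < t := by
      by_contra hcon
      have := (hball (hmem t ht)).2.2.2.2 (not_lt.1 hcon)
      nlinarith [not_lt.1 hcon]
    have h3 := hpar (if x ≤ 0 then f₁ x else f₂ x) s
    rw [h] at h3
    split_ifs at h h3 with hx0
    · have q1 := m1.monotoneOn hx z0 hx0
      have q2 := m2 z0 ht ht0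
      simp only [h0] at q1 q2
      linarith
    · have := m2.injOn ht hx h3
      rw [this] at h
      simp [hs.ne', hn0] at h

/-- Points displaced transversally from a curve do not lie on the curve. -/
lemma displaced_ne {f f' : ℝ → ℂ} (hf : ∀ t, HasDerivAt f (f' t) t) (hf' : Continuous f')
    {t₀ : ℝ} {n₀ : ℂ} (hc : cross (f' t₀) n₀ ≠ 0) :
    ∃ δ > 0, ∀ t ∈ Ioo (t₀ - δ) (t₀ + δ), ∀ n ∈ Metric.ball n₀ δ, ∀ s > (0 : ℝ),
      ∀ t' ∈ Ioo (t₀ - δ) (t₀ + δ), f t + s * n ≠ f t' := by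
  -- Reversing the parameter changes the sign of the determinant and leaves the set of points the
  -- same.
  wlog hpos : 0 < cross (f' t₀) n₀ generalizing f f' t₀
  · have hrev : ∀ t, HasDerivAt (fun t => f (-t)) (-f' (-t)) t := fun t => by
      have := (hf (-t)).scomp t (hasDerivAt_neg t)
      simpa [Function.comp_def] using this
    have hneg : cross (-f' (- -t₀)) n₀ = -cross (f' t₀) n₀ := by simp [cross]; ring
    obtain ⟨δ, hδ, h⟩ := this (t₀ := -t₀) hrev (by fun_prop) (by rw [hneg]; simpa using hc)
      (by rw [hneg]; rcases lt_or_gt_of_ne hc with h | h <;> linarith)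
    refine ⟨δ, hδ, fun t ht n hn s hs t' ht' heq => ?_⟩
    exact h (-t) ⟨by linarith [ht.2], by linarith [ht.1]⟩ n hn s hs (-t')
      ⟨by linarith [ht'.2], by linarith [ht'.1]⟩ (by simpa using heq)
  have e : ∀ᶠ x : ℝ × ℂ in 𝓝 (t₀, n₀), 0 < cross (f' x.1) x.2 :=
    (continuous_cross.comp ((hf'.comp continuous_fst).prodMk continuous_snd)).continuousAt.eventually
      (lt_mem_nhds hpos)
  obtain ⟨δ, hδ, hball⟩ := Metric.eventually_nhds_iff.1 e
  refine ⟨δ, hδ, fun t ht n hn s hs t' ht' heq => ?_⟩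
  have hm := strictMonoOn_crossL hf (convex_Ioo (t₀ - δ) (t₀ + δ)) (n := n) (fun τ hτ => by
    refine hball (y := (τ, n)) ?_
    rw [Prod.dist_eq]
    refine max_lt ?_ hn
    rw [Real.dist_eq, abs_lt]
    exact ⟨by linarith [hτ.1], by linarith [hτ.2]⟩)
  -- Displacement along n does not change the functional cross (·) n, which is strictly monotone on
  -- the curve; hence t' = t.
  have hpar : cross (f t + s * n) n = cross (f t) n := by simp [cross]; ring
  rw [heq] at hpar
  have := hm.injOn ht' ht hpar
  rw [this] at heq
  have hn0 : n ≠ 0 := fun h => by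
    have := hball (y := (t₀, n)) (by
      rw [Prod.dist_eq]; exact max_lt (by simpa using hδ) hn)
    rw [h] at this
    simp [cross] at this
  simp [hs.ne', hn0] at heq

/-! ### The Alexander numbering and its values beside the diagram -/

namespace GeneralizedLinkDiagram

variable {T : Type*} (D : GeneralizedLinkDiagram T)

/-- The sum of the winding numbers of the components around a point. -/
noncomputable def totalWinding (w : ℂ) : ℂ := ∑ i, windingIntegral (D.z i) w

/-- The Alexander numbering: the index of a point with respect to the diagram. -/
noncomputable def index (w : ℂ) : ℤ := round (D.totalWinding w).re

/-- The index of the points next to a point of the diagram in a transverse direction. -/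
noncomputable def sideIndex (i : Fin D.numComponents) (t : ℝ) (n : ℂ) : ℤ :=
  limUnder (𝓝[>] (0 : ℝ)) fun s => D.index (D.z i t + s * n)

/-- The index on the left of a point of the diagram. -/
noncomputable def leftIndex (i : Fin D.numComponents) (t : ℝ) : ℤ :=
  D.sideIndex i t (Complex.I * D.vel i t)

/-- The index on the right of a point of the diagram. -/
noncomputable def rightIndex (i : Fin D.numComponents) (t : ℝ) : ℤ :=
  D.sideIndex i t (-(Complex.I * D.vel i t))

variable {D}

lemma z_contDiff_one (i : Fin D.numComponents) : ContDiff ℝ 1 (D.z i) :=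
  (z_contDiff i).of_le (by exact_mod_cast le_top)

lemma z_periodic (i : Fin D.numComponents) : Function.Periodic (D.z i) 1 := fun t => by
  simpa using z_add_int i t 1

lemma index_eq {w : ℂ} (hw : w ∉ D.image) : (D.index w : ℂ) = D.totalWinding w := by
  have h : ∀ i, ∃ k : ℤ, windingIntegral (D.z i) w = k := fun i =>
    exists_int_eq_windingIntegral (z_contDiff_one i) (by simpa using (z_periodic i 0).symm)
      (fun x hx => hw ⟨i, x, hx⟩)
  choose k hk using h
  have : D.totalWinding w = ((∑ i, k i : ℤ) : ℂ) := by
    unfold totalWinding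
    push_cast
    exact Finset.sum_congr rfl fun i _ => hk i
  unfold index
  rw [this, Complex.intCast_re, round_intCast]

lemma continuousAt_windingIntegral {i : Fin D.numComponents} {w : ℂ} (hw : ∀ t, D.z i t ≠ w) :
    ContinuousAt (windingIntegral (D.z i)) w :=
  (continuousAt_integral_div_sub (continuous_z i) (continuous_vel i) fun x _ => hw x).const_mul _

/-- Off the closed image the total winding number is continuous and integral, so values less than 1
apart are equal. -/
lemma continuousAt_index {w : ℂ} (hw : w ∉ D.image) : ContinuousAt D.index w := by
  have hc : ContinuousAt (fun w => (D.totalWinding w).re) w := by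
    refine Complex.continuous_re.continuousAt.comp ?_
    exact tendsto_finsetSum _ fun i _ =>
      continuousAt_windingIntegral fun t ht => hw ⟨i, t, ht⟩
  rw [ContinuousAt, nhds_discrete ℤ, tendsto_pure]
  have e1 := hc.eventually (Metric.ball_mem_nhds _ (one_pos))
  have e2 : ∀ᶠ w' in 𝓝 w, w' ∉ D.image := isClosed_image.isOpen_compl.mem_nhds hw
  filter_upwards [e1, e2] with w' h1 h2
  rw [← index_eq hw, ← index_eq h2, Complex.intCast_re, Complex.intCast_re, Real.dist_eq] at h1
  have h3 : |D.index w' - D.index w| < 1 := by exact_mod_cast h1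
  exact sub_eq_zero.1 (Int.abs_lt_one_iff.1 h3)

lemma index_eq_of_isPreconnected {A : Set ℂ} (hA : IsPreconnected A) (hAD : Disjoint A D.image)
    {w w' : ℂ} (hw : w ∈ A) (hw' : w' ∈ A) : D.index w = D.index w' :=
  hA.constant (fun _ hx => (continuousAt_index
    (disjoint_left.1 hAD hx)).continuousWithinAt) hw hw'

lemma sideIndex_eq {i : Fin D.numComponents} {t : ℝ} {n : ℂ} {k : ℤ}
    (h : ∀ᶠ s : ℝ in 𝓝[>] 0, D.index (D.z i t + s * n) = k) : D.sideIndex i t n = k :=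
  Tendsto.limUnder_eq (tendsto_nhds_of_eventually_eq h)

/-- As `a` is not at a crossing, image points near it come only from parameters near `a`
(`eventually_mem_image`), and these are excluded by `displaced_ne`. -/
lemma exists_box_disjoint {a : Fin D.numComponents × ℝ} (ha : ¬ D.IsDouble a) {n₀ : ℂ}
    (hc : cross (D.vel a.1 a.2) n₀ ≠ 0) :
    ∃ δ > 0, ∀ t ∈ Ioo (a.2 - δ) (a.2 + δ), ∀ n ∈ Metric.ball n₀ δ, ∀ s ∈ Ioo 0 δ,
      D.z a.1 t + s * n ∉ D.image := by
  obtain ⟨δ, hδ, h⟩ := displaced_ne (hasDerivAt_z a.1) (continuous_vel a.1) hc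
  have e := eventually_mem_image (p := D.z a.1 a.2) {a}
    (fun c hcz => ⟨a, rfl, samePoint_of_not_isDouble ha hcz.symm⟩) hδ
  have hcont : Continuous fun x : ℝ × ℂ × ℝ => D.z a.1 x.1 + x.2.2 * x.2.1 := by
    have := continuous_z (D := D) a.1
    fun_prop
  have e2 := (hcont.tendsto' (a.2, n₀, 0) (D.z a.1 a.2) (by simp)).eventually e
  obtain ⟨δ', hδ', h'⟩ := Metric.eventually_nhds_iff.1 e2
  refine ⟨min δ δ', lt_min hδ hδ', fun t ht n hn s hs hmem => ?_⟩
  have hmin1 := min_le_left δ δ'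
  have hmin2 := min_le_right δ δ'
  obtain ⟨b, hb, t', ht', heq⟩ := h' (y := (t, n, s)) (by
    rw [Prod.dist_eq, Prod.dist_eq]
    refine max_lt ?_ (max_lt ?_ ?_)
    · rw [Real.dist_eq, abs_lt]
      exact ⟨by linarith [ht.1], by linarith [ht.2]⟩
    · exact (Metric.mem_ball.1 hn).trans_le hmin2
    · rw [Real.dist_eq, sub_zero, abs_of_pos hs.1]
      exact hs.2.trans_le hmin2) hmem
  rw [mem_singleton_iff] at hb
  subst hb
  obtain ⟨h1, h2⟩ := abs_lt.1 ht'
  exact h t ⟨by linarith [ht.1], by linarith [ht.2]⟩ n (Metric.ball_subset_ball hmin1 hn) s hs.1 t'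
    ⟨by linarith, by linarith⟩ heq.symm

/-- Near a point that is not a crossing, the index on a side is locally constant. -/
lemma exists_box_index_eq {a : Fin D.numComponents × ℝ} (ha : ¬ D.IsDouble a) {n₀ : ℂ}
    (hc : cross (D.vel a.1 a.2) n₀ ≠ 0) :
    ∃ k : ℤ, ∃ δ > 0, ∀ t ∈ Ioo (a.2 - δ) (a.2 + δ), ∀ n ∈ Metric.ball n₀ δ, ∀ s ∈ Ioo 0 δ,
      D.index (D.z a.1 t + s * n) = k := by
  obtain ⟨δ, hδ, h⟩ := exists_box_disjoint ha hc
  have hcont : Continuous fun x : ℝ × ℂ × ℝ => D.z a.1 x.1 + x.2.2 * x.2.1 := by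
    have := continuous_z (D := D) a.1
    fun_prop
  have hA : IsPreconnected ((fun x : ℝ × ℂ × ℝ => D.z a.1 x.1 + x.2.2 * x.2.1) ''
      (Ioo (a.2 - δ) (a.2 + δ) ×ˢ Metric.ball n₀ δ ×ˢ Ioo 0 δ)) :=
    (isPreconnected_Ioo.prod ((convex_ball n₀ δ).isPreconnected.prod isPreconnected_Ioo)).image _
      hcont.continuousOn
  refine ⟨D.index (D.z a.1 a.2 + (δ / 2 : ℝ) * n₀), δ, hδ, fun t ht n hn s hs => ?_⟩
  refine index_eq_of_isPreconnected hA ?_ ⟨(t, n, s), ⟨ht, hn, hs⟩, rfl⟩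
    ⟨(a.2, n₀, δ / 2), ⟨⟨by linarith, by linarith⟩, Metric.mem_ball_self hδ,
      by constructor <;> linarith⟩, rfl⟩
  rw [disjoint_left]
  rintro _ ⟨x, ⟨hx1, hx2, hx3⟩, rfl⟩
  exact h _ hx1 _ hx2 _ hx3

lemma eventually_index_eq_sideIndex {a : Fin D.numComponents × ℝ} (ha : ¬ D.IsDouble a) {n : ℂ}
    (hc : cross (D.vel a.1 a.2) n ≠ 0) :
    ∀ᶠ s : ℝ in 𝓝[>] 0, D.index (D.z a.1 a.2 + s * n) = D.sideIndex a.1 a.2 n := by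
  obtain ⟨k, δ, hδ, h⟩ := exists_box_index_eq ha hc
  have : ∀ᶠ s : ℝ in 𝓝[>] 0, D.index (D.z a.1 a.2 + s * n) = k := by
    filter_upwards [Ioo_mem_nhdsGT hδ] with s hs
    exact h a.2 ⟨by linarith, by linarith⟩ n (Metric.mem_ball_self hδ) s hs
  rw [sideIndex_eq this]
  exact this

lemma eventually_sideIndex_eq {a : Fin D.numComponents × ℝ} (ha : ¬ D.IsDouble a) {n : ℂ}
    (hc : cross (D.vel a.1 a.2) n ≠ 0) :
    ∀ᶠ x : ℝ × ℂ in 𝓝 (a.2, n), D.sideIndex a.1 x.1 x.2 = D.sideIndex a.1 a.2 n := by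
  obtain ⟨k, δ, hδ, h⟩ := exists_box_index_eq ha hc
  have hx : ∀ t ∈ Ioo (a.2 - δ) (a.2 + δ), ∀ n' ∈ Metric.ball n δ, D.sideIndex a.1 t n' = k := by
    intro t ht n' hn'
    apply sideIndex_eq
    filter_upwards [Ioo_mem_nhdsGT hδ] with s hs
    exact h t ht n' hn' s hs
  rw [hx a.2 ⟨by linarith, by linarith⟩ n (Metric.mem_ball_self hδ)]
  filter_upwards [prod_mem_nhds (Ioo_mem_nhds (by linarith : a.2 - δ < a.2)
    (by linarith : a.2 < a.2 + δ)) (Metric.ball_mem_nhds n hδ)] with x hx'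
  exact hx _ hx'.1 _ hx'.2

/-- The determinant with the velocity does not vanish on the segment from n to n', so all directions
on it are transverse and the side index is locally constant along it. -/
lemma sideIndex_eq_of_cross_pos {a : Fin D.numComponents × ℝ} (ha : ¬ D.IsDouble a) {n n' : ℂ}
    (h : 0 < cross (D.vel a.1 a.2) n * cross (D.vel a.1 a.2) n') :
    D.sideIndex a.1 a.2 n = D.sideIndex a.1 a.2 n' := by
  have hseg : IsPreconnected (segment ℝ n n') := (convex_segment n n').isPreconnected
  refine hseg.constant (f := fun m => D.sideIndex a.1 a.2 m) ?_ (left_mem_segment ℝ n n')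
    (right_mem_segment ℝ n n')
  rintro m ⟨α, β, hα, hβ, hαβ, rfl⟩
  have hne : cross (D.vel a.1 a.2) (α • n + β • n') ≠ 0 := by
    rw [← crossL_apply, map_add, map_smul, map_smul, crossL_apply, crossL_apply, smul_eq_mul,
      smul_eq_mul]
    rcases pos_and_pos_or_neg_and_neg_of_mul_pos h with ⟨h1, h2⟩ | ⟨h1, h2⟩
    · rcases hα.eq_or_lt with rfl | hα
      · have : β = 1 := by linarith
        subst this
        linarith
      · have := mul_pos hα h1
        have := mul_nonneg hβ h2.le
        linarith
    · rcases hα.eq_or_lt with rfl | hα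
      · have : β = 1 := by linarith
        subst this
        linarith
      · have := mul_neg_of_pos_of_neg hα h1
        have := mul_nonpos_of_nonneg_of_nonpos hβ h2.le
        linarith
  refine ContinuousAt.continuousWithinAt ?_
  rw [ContinuousAt, nhds_discrete ℤ, tendsto_pure]
  exact ((continuous_const (y := a.2)).prodMk continuous_id).continuousAt.eventually
    (eventually_sideIndex_eq ha hne)

lemma cross_I_mul (w : ℂ) : cross w (Complex.I * w) = ‖w‖ ^ 2 := by
  rw [← Complex.normSq_eq_norm_sq]
  simp [cross, Complex.normSq]

lemma cross_I_mul_vel_pos (i : Fin D.numComponents) (t : ℝ) :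
    0 < cross (D.vel i t) (Complex.I * D.vel i t) := by
  rw [cross_I_mul]
  have := vel_ne_zero (D := D) i t
  positivity

lemma cross_neg_right (w w' : ℂ) : cross w (-w') = -cross w w' := by simp [cross]; ring

lemma sideIndex_eq_leftIndex {a : Fin D.numComponents × ℝ} (ha : ¬ D.IsDouble a) {n : ℂ}
    (h : 0 < cross (D.vel a.1 a.2) n) : D.sideIndex a.1 a.2 n = D.leftIndex a.1 a.2 :=
  sideIndex_eq_of_cross_pos ha (mul_pos h (cross_I_mul_vel_pos a.1 a.2))

lemma sideIndex_eq_rightIndex {a : Fin D.numComponents × ℝ} (ha : ¬ D.IsDouble a) {n : ℂ}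
    (h : cross (D.vel a.1 a.2) n < 0) : D.sideIndex a.1 a.2 n = D.rightIndex a.1 a.2 :=
  sideIndex_eq_of_cross_pos ha (mul_pos_of_neg_of_neg h (by
    rw [cross_neg_right]; linarith [cross_I_mul_vel_pos a.1 a.2]))

lemma leftIndex_eq_of_Icc {i : Fin D.numComponents} {t t' : ℝ} (htt' : t ≤ t')
    (h : ∀ τ ∈ Icc t t', ¬ D.IsDouble (i, τ)) : D.leftIndex i t = D.leftIndex i t' := by
  refine isPreconnected_Icc.constant (f := D.leftIndex i) (fun τ hτ => ?_)
    (left_mem_Icc.2 htt') (right_mem_Icc.2 htt')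
  refine ContinuousAt.continuousWithinAt ?_
  rw [ContinuousAt, nhds_discrete ℤ, tendsto_pure]
  have hc : Continuous fun τ => (τ, Complex.I * D.vel i τ) := by
    have := continuous_vel (D := D) i
    fun_prop
  exact hc.continuousAt.eventually
    (eventually_sideIndex_eq (a := (i, τ)) (h τ hτ) (cross_I_mul_vel_pos i τ).ne')

/-- The index on the left is larger than the one on the right by `1`. -/
lemma leftIndex_eq_rightIndex_add_one {a : Fin D.numComponents × ℝ} (ha : ¬ D.IsDouble a) :
    D.leftIndex a.1 a.2 = D.rightIndex a.1 a.2 + 1 := by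
  obtain ⟨i, t⟩ := a
  set n := Complex.I * D.vel i t with hn
  have hc := cross_I_mul_vel_pos i t
  have hc' : cross (D.vel i t) (-n) ≠ 0 := by rw [cross_neg_right]; linarith
  have e1 := eventually_index_eq_sideIndex ha (n := n) hc.ne'
  have e2 := eventually_index_eq_sideIndex ha hc'
  obtain ⟨δ, hδ, b1⟩ := exists_box_disjoint ha (n₀ := n) hc.ne'
  obtain ⟨δ', hδ', b2⟩ := exists_box_disjoint ha hc'
  have hj := tendsto_windingIntegral_jump (z_contDiff_one i) (z_periodic i) (vel_ne_zero i t)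
    (fun t' ht' => (samePoint_of_not_isDouble (b := (i, t')) ha ht'.symm).2)
  have hlim : ∀ σ : ℝ, Tendsto (fun s : ℝ => D.z i t + σ * (s * n)) (𝓝[>] 0) (𝓝 (D.z i t)) := by
    intro σ
    have : Continuous fun s : ℝ => D.z i t + σ * (s * n) := by fun_prop
    simpa using (this.tendsto 0).mono_left nhdsWithin_le_nhds
  -- The other components miss the point, so their winding numbers are continuous there and only
  -- component i contributes to the jump.
  have hother : ∀ j ∈ Finset.univ.erase i, Tendsto (fun s : ℝ =>
      windingIntegral (D.z j) (D.z i t + s * n) - windingIntegral (D.z j) (D.z i t - s * n))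
      (𝓝[>] 0) (𝓝 0) := by
    intro j hj
    have hcj : ContinuousAt (windingIntegral (D.z j)) (D.z i t) :=
      continuousAt_windingIntegral fun t' ht' => (Finset.mem_erase.1 hj).1
        (samePoint_of_not_isDouble (b := (j, t')) ha ht'.symm).1.symm
    have := (hcj.tendsto.comp (hlim 1)).sub (hcj.tendsto.comp (hlim (-1)))
    simpa [Function.comp_def, sub_eq_add_neg] using this
  have htot : Tendsto (fun s : ℝ => D.totalWinding (D.z i t + s * n) -
      D.totalWinding (D.z i t - s * n)) (𝓝[>] 0) (𝓝 1) := by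
    have := hj.add (tendsto_finsetSum _ hother)
    simp only [Finset.sum_const_zero, add_zero] at this
    refine this.congr fun s => ?_
    unfold totalWinding
    rw [← Finset.sum_sub_distrib, ← Finset.add_sum_erase _ _ (Finset.mem_univ i)]
    rfl
  have hconst : Tendsto (fun _ : ℝ => ((D.leftIndex i t - D.rightIndex i t : ℤ) : ℂ)) (𝓝[>] 0)
      (𝓝 1) := by
    refine htot.congr' ?_
    filter_upwards [e1, e2, Ioo_mem_nhdsGT hδ, Ioo_mem_nhdsGT hδ'] with s h1 h2 h3 h4
    have d1 := b1 t ⟨by linarith, by linarith⟩ n (Metric.mem_ball_self hδ) s h3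
    have d2 := b2 t ⟨by linarith, by linarith⟩ (-n) (Metric.mem_ball_self hδ') s h4
    dsimp only at d1 d2 h1 h2
    rw [mul_neg, ← sub_eq_add_neg] at d2 h2
    rw [← index_eq d1, ← index_eq d2, h1, h2]
    push_cast
    rfl
  have h1 := tendsto_nhds_unique hconst tendsto_const_nhds
  have h2 : D.leftIndex i t - D.rightIndex i t = 1 := by exact_mod_cast h1.symm
  exact sub_eq_iff_eq_add'.1 h2

/-! ### The index at a crossing, and bipartiteness -/

/-- The two sides of a corner have the same index: here the corner is formed by the passages
through a crossing, each of which may be run through in either direction. -/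
lemma exists_sideIndex_corner {a b : Fin D.numComponents × ℝ} (hab : ¬ SamePoint a b)
    (hz : D.z a.1 a.2 = D.z b.1 b.2) {σ τ : ℝ} (hσ : |σ| = 1) (hτ : |τ| = 1)
    (hpos : 0 < cross (σ * D.vel a.1 a.2) (τ * D.vel b.1 b.2)) :
    ∃ k : ℤ, (∀ᶠ x in 𝓝[<] (0 : ℝ), D.sideIndex a.1 (a.2 + σ * x)
        (τ * D.vel b.1 b.2 - σ * D.vel a.1 a.2) = k) ∧
      ∀ᶠ x in 𝓝[>] (0 : ℝ), D.sideIndex b.1 (b.2 + τ * x)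
        (τ * D.vel b.1 b.2 - σ * D.vel a.1 a.2) = k := by
  have hd : ∀ (c : Fin D.numComponents × ℝ) (ρ x : ℝ), HasDerivAt
      (fun x => D.z c.1 (c.2 + ρ * x)) (ρ * D.vel c.1 (c.2 + ρ * x)) x := by
    intro c ρ x
    have h1 : HasDerivAt (fun x => c.2 + ρ * x) ρ x := by
      simpa using ((hasDerivAt_id x).const_mul ρ).const_add c.2
    have := (hasDerivAt_z c.1 (c.2 + ρ * x)).scomp x h1
    simpa [Function.comp_def] using this
  have hcv : ∀ (c : Fin D.numComponents × ℝ) (ρ : ℝ),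
      Continuous fun x : ℝ => (ρ : ℂ) * D.vel c.1 (c.2 + ρ * x) := by
    intro c ρ
    have := continuous_vel (D := D) c.1
    fun_prop
  obtain ⟨δ, hδ, h⟩ := corner_displaced_ne (hd a σ) (hd b τ) (hcv a σ) (hcv b τ)
    (by simpa using hz) (by simpa using hpos)
  simp only [mul_zero, add_zero] at h
  set n : ℂ := τ * D.vel b.1 b.2 - σ * D.vel a.1 a.2 with hn
  -- The corner path comes in along `a` and leaves along `b`. Its displacements by small positive
  -- multiples of n sweep out a connected set off the diagram that runs beside both legs.
  let κ : ℝ → ℂ := fun x => if x ≤ 0 then D.z a.1 (a.2 + σ * x) else D.z b.1 (b.2 + τ * x)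
  have hκ : Continuous κ := by
    refine Continuous.if_le ?_ ?_ continuous_id continuous_const ?_
    · exact (continuous_z a.1).comp (by fun_prop)
    · exact (continuous_z b.1).comp (by fun_prop)
    · intro x hx
      simpa [show x = 0 from hx] using hz
  have e := eventually_mem_image (p := D.z a.1 a.2) {a, b} (fun c hc => by
    rcases samePoint_or_of_eq hab hz hc.symm with h | h
    · exact ⟨a, by simp, h⟩
    · exact ⟨b, by simp, h⟩) hδ
  have hcont : Continuous fun x : ℝ × ℝ => κ x.1 + x.2 * n := by fun_prop
  have hκ0 : κ 0 = D.z a.1 a.2 := by simp [κ]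
  have e2 := (hcont.tendsto' (0, 0) (D.z a.1 a.2) (by simp [hκ0])).eventually e
  obtain ⟨δ', hδ', h'⟩ := Metric.eventually_nhds_iff.1 e2
  set ε := min δ δ' with hε
  have hεpos : 0 < ε := lt_min hδ hδ'
  have hmin1 : ε ≤ δ := min_le_left δ δ'
  have hmin2 : ε ≤ δ' := min_le_right δ δ'
  have habs : ∀ ρ x : ℝ, |ρ| = 1 → |ρ * x| = |x| := fun ρ x h => by rw [abs_mul, h, one_mul]
  have hinv : ∀ ρ x : ℝ, |ρ| = 1 → ρ * (ρ * x) = x := fun ρ x h => by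
    rw [← mul_assoc, ← abs_mul_abs_self ρ, h]; ring
  have hdisj : ∀ x ∈ Ioo (-ε) ε, ∀ s ∈ Ioo 0 ε, κ x + s * n ∉ D.image := by
    intro x hx s hs hmem
    obtain ⟨c, hc, t, ht, heq⟩ := h' (y := (x, s)) (by
      rw [Prod.dist_eq]
      refine max_lt ?_ ?_
      · rw [Real.dist_eq, sub_zero]
        exact (abs_lt.2 hx).trans_le hmin2
      · rw [Real.dist_eq, sub_zero, abs_of_pos hs.1]
        exact hs.2.trans_le hmin2) hmem
    have hx' : x ∈ Ioo (-δ) δ := ⟨by linarith [hx.1], by linarith [hx.2]⟩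
    rcases hc with rfl | rfl
    · refine (h x hx' s hs.1 (σ * (t - c.2)) ?_).1 ?_
      · rw [mem_Ioo, ← abs_lt, habs σ _ hσ]; exact ht
      · rw [hinv σ _ hσ, add_sub_cancel]; exact heq.symm
    · refine (h x hx' s hs.1 (τ * (t - c.2)) ?_).2 ?_
      · rw [mem_Ioo, ← abs_lt, habs τ _ hτ]; exact ht
      · rw [hinv τ _ hτ, add_sub_cancel]; exact heq.symm
  have hA : IsPreconnected ((fun x : ℝ × ℝ => κ x.1 + x.2 * n) '' (Ioo (-ε) ε ×ˢ Ioo 0 ε)) :=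
    (isPreconnected_Ioo.prod isPreconnected_Ioo).image _ hcont.continuousOn
  have hAd : Disjoint ((fun x : ℝ × ℝ => κ x.1 + x.2 * n) '' (Ioo (-ε) ε ×ˢ Ioo 0 ε)) D.image := by
    rw [disjoint_left]
    rintro _ ⟨x, hx, rfl⟩
    exact hdisj _ hx.1 _ hx.2
  have hk : ∀ x ∈ Ioo (-ε) ε, ∀ s ∈ Ioo 0 ε, D.index (κ x + s * n) =
      D.index (κ 0 + (ε / 2 : ℝ) * n) := fun x hx s hs =>
    index_eq_of_isPreconnected hA hAd ⟨(x, s), ⟨hx, hs⟩, rfl⟩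
      ⟨(0, ε / 2), ⟨⟨by linarith, hεpos⟩, by constructor <;> linarith⟩, rfl⟩
  refine ⟨D.index (κ 0 + (ε / 2 : ℝ) * n), ?_, ?_⟩
  · filter_upwards [Ioo_mem_nhdsLT (neg_neg_of_pos hεpos)] with x hx
    apply sideIndex_eq
    filter_upwards [Ioo_mem_nhdsGT hεpos] with s hs
    have := hk x ⟨hx.1, hx.2.trans hεpos⟩ s hs
    simpa [κ, hx.2.le] using this
  · filter_upwards [Ioo_mem_nhdsGT hεpos] with x hx
    apply sideIndex_eq
    filter_upwards [Ioo_mem_nhdsGT hεpos] with s hs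
    have := hk x ⟨by linarith [hx.1], hx.2⟩ s hs
    simpa [κ, hx.1.not_ge] using this

lemma eventually_leftIndex_of_arrivesAt {r : D.RegularParam} {a : Fin D.numComponents × ℝ}
    (h : D.ArrivesAt r a) :
    ∀ᶠ x in 𝓝[<] (0 : ℝ), ¬ D.IsDouble (a.1, a.2 + x) ∧
      D.leftIndex a.1 (a.2 + x) = D.leftIndex r.1.1 r.1.2 := by
  obtain ⟨h1, h2, h3⟩ := h
  filter_upwards [Ioo_mem_nhdsLT (sub_neg.2 h2)] with x hx
  refine ⟨h3 _ ⟨by linarith [hx.1], by linarith [hx.2]⟩, ?_⟩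
  rw [h1]
  exact (leftIndex_eq_of_Icc (by linarith [hx.1]) fun τ hτ =>
    h3 τ ⟨hτ.1, by linarith [hτ.2, hx.2]⟩).symm

lemma eventually_leftIndex_of_departsFrom {r : D.RegularParam} {a : Fin D.numComponents × ℝ}
    (h : D.DepartsFrom r a) :
    ∀ᶠ x in 𝓝[>] (0 : ℝ), ¬ D.IsDouble (a.1, a.2 + x) ∧
      D.leftIndex a.1 (a.2 + x) = D.leftIndex r.1.1 r.1.2 := by
  obtain ⟨h1, h2, h3⟩ := h
  filter_upwards [Ioo_mem_nhdsGT (sub_pos.2 h2)] with x hx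
  refine ⟨h3 _ ⟨by linarith [hx.1], by linarith [hx.2]⟩, ?_⟩
  rw [h1]
  exact leftIndex_eq_of_Icc (by linarith [hx.2]) fun τ hτ =>
    h3 τ ⟨by linarith [hτ.1, hx.1], hτ.2⟩

lemma eventually_cross_vel_pos {a : Fin D.numComponents × ℝ} {n : ℂ}
    (h : 0 < cross (D.vel a.1 a.2) n) : ∀ᶠ x in 𝓝 (0 : ℝ), 0 < cross (D.vel a.1 (a.2 + x)) n := by
  have hc : Continuous fun x : ℝ => cross (D.vel a.1 (a.2 + x)) n :=
    continuous_cross.comp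
      (((continuous_vel a.1).comp (continuous_const.add continuous_id)).prodMk continuous_const)
  exact hc.continuousAt.eventually (lt_mem_nhds (by simpa using h))

lemma eventually_cross_vel_neg {a : Fin D.numComponents × ℝ} {n : ℂ}
    (h : cross (D.vel a.1 a.2) n < 0) : ∀ᶠ x in 𝓝 (0 : ℝ), cross (D.vel a.1 (a.2 + x)) n < 0 := by
  have := eventually_cross_vel_pos (a := a) (n := -n) (by rw [cross_neg_right]; linarith)
  filter_upwards [this] with x hx
  rw [cross_neg_right] at hx
  linarith

/-- Let u and v be the velocities at `a` and `b`. The direction v - u points into the sector between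
the strand arriving at `a` and the one departing from `b`. For cross u v > 0 this sector is on the
left of both. Otherwise it is on the right of both; the corner is then run through backwards, and
the right indices are compared instead. -/
lemma leftIndex_eq_of_turn {r s : D.RegularParam} {a b : Fin D.numComponents × ℝ}
    (hab : ¬ SamePoint a b) (hz : D.z a.1 a.2 = D.z b.1 b.2) (hr : D.ArrivesAt r a)
    (hs : D.DepartsFrom s b) : D.leftIndex r.1.1 r.1.2 = D.leftIndex s.1.1 s.1.2 := by
  set u := D.vel a.1 a.2 with hu
  set v := D.vel b.1 b.2 with hv
  have er := eventually_leftIndex_of_arrivesAt hr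
  have es := eventually_leftIndex_of_departsFrom hs
  rcases lt_or_gt_of_ne (cross_vel_ne_zero hab hz) with h | h
  · obtain ⟨k, h1, h2⟩ := exists_sideIndex_corner (σ := -1) (τ := -1) (a := b) (b := a)
      (fun h => hab h.symm) hz.symm (by simp) (by simp) (by
        simp only [cross] at h ⊢; simp; linarith)
    have hn : ((-1 : ℝ) : ℂ) * u - ((-1 : ℝ) : ℂ) * v = v - u := by push_cast; ring
    rw [← hu, ← hv, hn] at h1 h2
    have hun : cross u (v - u) < 0 := by simp only [cross] at h ⊢; simp; linarith
    have hvn : cross v (v - u) < 0 := by simp only [cross] at h ⊢; simp; linarith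
    have n1 : Tendsto (fun x : ℝ => -x) (𝓝[>] 0) (𝓝[<] 0) := by
      simpa using tendsto_neg_nhdsGT (a := (0 : ℝ))
    have n2 : Tendsto (fun x : ℝ => -x) (𝓝[<] 0) (𝓝[>] 0) := by
      simpa using tendsto_neg_nhdsLT (a := (0 : ℝ))
    obtain ⟨x, hx1, hx2, hx3⟩ := ((n2.eventually h2).and
      (er.and (nhdsWithin_le_nhds (eventually_cross_vel_neg (a := a) hun)))).exists
    obtain ⟨y, hy1, hy2, hy3⟩ := ((n1.eventually h1).and
      (es.and (nhdsWithin_le_nhds (eventually_cross_vel_neg (a := b) hvn)))).exists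
    simp only [neg_mul, one_mul, neg_neg] at hx1 hy1
    have q1 := sideIndex_eq_rightIndex (a := (a.1, a.2 + x)) hx2.1 hx3
    have q2 := sideIndex_eq_rightIndex (a := (b.1, b.2 + y)) hy2.1 hy3
    have q3 := leftIndex_eq_rightIndex_add_one hx2.1
    have q4 := leftIndex_eq_rightIndex_add_one hy2.1
    dsimp only at q1 q2 q3 q4
    rw [← hx2.2, ← hy2.2, q3, q4, ← q1, ← q2, hx1, hy1]
  · obtain ⟨k, h1, h2⟩ := exists_sideIndex_corner (σ := 1) (τ := 1) hab hz (by simp) (by simp)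
      (by simpa using h)
    have hn : ((1 : ℝ) : ℂ) * v - ((1 : ℝ) : ℂ) * u = v - u := by push_cast; ring
    rw [← hu, ← hv, hn] at h1 h2
    have hun : 0 < cross u (v - u) := by simp only [cross] at h ⊢; simp; linarith
    have hvn : 0 < cross v (v - u) := by simp only [cross] at h ⊢; simp; linarith
    obtain ⟨x, hx1, hx2, hx3⟩ := (h1.and
      (er.and (nhdsWithin_le_nhds (eventually_cross_vel_pos (a := a) hun)))).exists
    obtain ⟨y, hy1, hy2, hy3⟩ := (h2.and
      (es.and (nhdsWithin_le_nhds (eventually_cross_vel_pos (a := b) hvn)))).exists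
    simp only [one_mul] at hx1 hy1
    have q1 := sideIndex_eq_leftIndex (a := (a.1, a.2 + x)) hx2.1 hx3
    have q2 := sideIndex_eq_leftIndex (a := (b.1, b.2 + y)) hy2.1 hy3
    dsimp only at q1 q2
    rw [← hx2.2, ← hy2.2, ← q1, ← q2, hx1, hy1]

/-- The sector between the two arriving strands, in direction -(u + v), is on the right of the first
and on the left of the second. The corner in question runs forwards to the crossing along `b` and
back along `a`. -/
lemma leftIndex_eq_add_one_of_arrivesAt {r s : D.RegularParam} {a b : Fin D.numComponents × ℝ}
    (hab : ¬ SamePoint a b) (hz : D.z a.1 a.2 = D.z b.1 b.2) (hr : D.ArrivesAt r a)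
    (hs : D.ArrivesAt s b) (h : 0 < cross (D.vel a.1 a.2) (D.vel b.1 b.2)) :
    D.leftIndex r.1.1 r.1.2 = D.leftIndex s.1.1 s.1.2 + 1 := by
  set u := D.vel a.1 a.2 with hu
  set v := D.vel b.1 b.2 with hv
  have er := eventually_leftIndex_of_arrivesAt hr
  have es := eventually_leftIndex_of_arrivesAt hs
  obtain ⟨k, h1, h2⟩ := exists_sideIndex_corner (σ := 1) (τ := -1) (a := b) (b := a)
    (fun h => hab h.symm) hz.symm (by simp) (by simp) (by
      simp only [cross] at h ⊢; simp; linarith)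
  have hn : ((-1 : ℝ) : ℂ) * u - ((1 : ℝ) : ℂ) * v = -(u + v) := by push_cast; ring
  rw [← hu, ← hv, hn] at h1 h2
  have hun : cross u (-(u + v)) < 0 := by simp only [cross] at h ⊢; simp; linarith
  have hvn : 0 < cross v (-(u + v)) := by simp only [cross] at h ⊢; simp; linarith
  have n2 : Tendsto (fun x : ℝ => -x) (𝓝[<] 0) (𝓝[>] 0) := by
    simpa using tendsto_neg_nhdsLT (a := (0 : ℝ))
  obtain ⟨x, hx1, hx2, hx3⟩ := ((n2.eventually h2).and
    (er.and (nhdsWithin_le_nhds (eventually_cross_vel_neg (a := a) hun)))).exists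
  obtain ⟨y, hy1, hy2, hy3⟩ := (h1.and
    (es.and (nhdsWithin_le_nhds (eventually_cross_vel_pos (a := b) hvn)))).exists
  simp only [neg_mul, one_mul, neg_neg] at hx1 hy1
  have q1 := sideIndex_eq_rightIndex (a := (a.1, a.2 + x)) hx2.1 hx3
  have q2 := sideIndex_eq_leftIndex (a := (b.1, b.2 + y)) hy2.1 hy3
  have q3 := leftIndex_eq_rightIndex_add_one hx2.1
  dsimp only at q1 q2 q3
  rw [← hx2.2, ← hy2.2, q3, ← q1, ← q2, hx1, hy1]

lemma leftIndex_add_int (i : Fin D.numComponents) (t : ℝ) (k : ℤ) :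
    D.leftIndex i (t + k) = D.leftIndex i t := by
  unfold leftIndex sideIndex
  rw [z_add_int, vel_add_int]

variable (D) in
/-- The index on the left of a Seifert circle. -/
noncomputable def circleIndex : D.SeifertCircle → ℤ :=
  Quot.lift (fun r => D.leftIndex r.1.1 r.1.2) (by
    intro r s h
    cases h with
    | same h =>
      obtain ⟨h1, k, hk⟩ := h
      rw [hk, ← h1, leftIndex_add_int]
    | along h hle hreg =>
      rw [← h]
      exact leftIndex_eq_of_Icc hle hreg
    | turn a b hab hcross hr hs => exact leftIndex_eq_of_turn hab (z_eq_iff.2 hcross) hr hs)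

/-- Which circle has the larger index depends on the sign of the determinant; modulo 2 the
distinction disappears. -/
lemma circleIndex_of_joins {e : D.Crossing} {x y : D.SeifertCircle} (h : D.Joins e x y) :
    (D.circleIndex y : ZMod 2) = D.circleIndex x + 1 := by
  obtain ⟨a, b, r, s, hab, ha, hb, hr, hs, rfl, rfl⟩ := h
  have hz : D.z a.1 a.2 = D.z b.1 b.2 := z_eq_iff.2 (ha.trans hb.symm)
  have h2 : (2 : ZMod 2) = 0 := rfl
  rcases lt_or_gt_of_ne (cross_vel_ne_zero hab hz) with h | h
  · have := leftIndex_eq_add_one_of_arrivesAt (fun h => hab h.symm) hz.symm hs hr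
      (by rw [cross_swap]; linarith)
    change ((D.leftIndex s.1.1 s.1.2 : ℤ) : ZMod 2) = (D.leftIndex r.1.1 r.1.2 : ℤ) + 1
    rw [this]
    push_cast
    rfl
  · have := leftIndex_eq_add_one_of_arrivesAt hab hz hr hs h
    change ((D.leftIndex s.1.1 s.1.2 : ℤ) : ZMod 2) = (D.leftIndex r.1.1 r.1.2 : ℤ) + 1
    rw [this]
    push_cast
    linear_combination -h2

variable (D) in
theorem isBipartiteGraph_seifertGraph : IsBipartiteGraph D.seifertGraph := by
  intro n c
  have : NeZero n := ⟨c.pos.ne'⟩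
  have h : ∀ i, (D.circleIndex (c.vertex (i + 1)) : ZMod 2) = D.circleIndex (c.vertex i) + 1 :=
    fun i => circleIndex_of_joins (c.isLink i)
  -- Summed around the cycle, the colours are invariant under the shift of i, while each edge adds
  -- 1; so n = 0 in `ZMod 2`. Loops need no separate treatment.
  have h1 : ∑ i : ZMod n, (D.circleIndex (c.vertex (i + 1)) : ZMod 2) =
      ∑ i : ZMod n, (D.circleIndex (c.vertex i) : ZMod 2) :=
    Equiv.sum_comp (Equiv.addRight (1 : ZMod n)) fun i => (D.circleIndex (c.vertex i) : ZMod 2)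
  simp only [h, Finset.sum_add_distrib, Finset.sum_const, Finset.card_univ, ZMod.card,
    nsmul_eq_mul, mul_one, add_eq_left] at h1
  exact (ZMod.natCast_eq_zero_iff_even).1 h1

end GeneralizedLinkDiagram

/-! ### Passages and the permutation along Seifert circles -/

namespace GeneralizedLinkDiagram

variable {T : Type*} (D : GeneralizedLinkDiagram T)

/-- The passages of the diagram through its crossings, with parameters in `[0, 1)`. -/
structure Passage where
  param : Fin D.numComponents × ℝ
  param_mem : param.2 ∈ Ico (0 : ℝ) 1
  isDouble : D.IsDouble param

variable {D}

lemma isDouble_congr_samePoint {a b : Fin D.numComponents × ℝ} (h : SamePoint a b) :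
    D.IsDouble a ↔ D.IsDouble b := isDouble_congr (z_eq_of_samePoint h)

lemma Passage.ext_samePoint {p q : D.Passage} (h : SamePoint p.param q.param) : p = q := by
  obtain ⟨⟨i, t⟩, ht, hp⟩ := p
  obtain ⟨⟨j, u⟩, hu, hq⟩ := q
  obtain ⟨h1, k, hk⟩ := h
  dsimp only at h1 hk ht hu
  have hk1 : |(k : ℝ)| < 1 := by
    rw [abs_lt]
    constructor <;> linarith [ht.1, ht.2, hu.1, hu.2]
  have hk0 : k = 0 := Int.abs_lt_one_iff.1 (by exact_mod_cast hk1)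
  subst h1 hk0
  simp only [Int.cast_zero, add_zero] at hk
  subst hk
  rfl

lemma exists_passage {a : Fin D.numComponents × ℝ} (ha : D.IsDouble a) :
    ∃ p : D.Passage, SamePoint p.param a := by
  obtain ⟨k, hk⟩ := exists_eq_add_int_mem_Ico a.2
  have hs : SamePoint (a.1, a.2 + k) a := ⟨rfl, -k, by push_cast; ring⟩
  exact ⟨⟨(a.1, a.2 + k), hk, (isDouble_congr_samePoint hs).2 ha⟩, hs⟩

/-- The point of the plane at which a passage takes place. -/
noncomputable def Passage.pt (p : D.Passage) : ℂ := D.z p.param.1 p.param.2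

lemma exists_other (p : D.Passage) : ∃ q : D.Passage, q ≠ p ∧ q.pt = p.pt := by
  obtain ⟨b, hb, hz⟩ := isDouble_iff.1 p.isDouble
  obtain ⟨q, hq⟩ := exists_passage ((isDouble_congr hz).1 p.isDouble)
  refine ⟨q, fun h => hb (h ▸ hq), ?_⟩
  exact (z_eq_of_samePoint hq).trans hz.symm

/-- The other passage through the same crossing. -/
noncomputable def Passage.other (p : D.Passage) : D.Passage := (exists_other p).choose

lemma Passage.other_ne (p : D.Passage) : p.other ≠ p := (exists_other p).choose_spec.1

@[simp] lemma Passage.pt_other (p : D.Passage) : p.other.pt = p.pt :=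
  (exists_other p).choose_spec.2

lemma Passage.not_samePoint_other (p : D.Passage) : ¬ SamePoint p.param p.other.param := fun h =>
  p.other_ne (ext_samePoint h).symm

lemma Passage.eq_or_eq_other {p q : D.Passage} (h : q.pt = p.pt) : q = p ∨ q = p.other := by
  rcases samePoint_or_of_eq p.not_samePoint_other p.pt_other.symm h.symm with h | h
  · exact Or.inl (ext_samePoint h).symm
  · exact Or.inr (ext_samePoint h).symm

@[simp] lemma Passage.other_other (p : D.Passage) : p.other.other = p :=
  ((eq_or_eq_other (p := p) (q := p.other.other) (by simp)).resolve_right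
    fun h => p.other.other_ne h)

/-- There are finitely many double points, and over each of them lie only a passage and its `other`.
-/
instance : Finite D.Passage := by
  have h : (univ : Set D.Passage) = (fun p : D.Passage => D.curve p.param.1 p.param.2) ⁻¹'
      doublePoints D.curve := by
    ext p
    exact ⟨fun _ => p.isDouble, fun _ => mem_univ p⟩
  refine finite_univ_iff.1 ?_
  rw [h]
  refine Finite.preimage' D.finite_doublePoints fun b _ => ?_
  by_cases hb : ∃ p : D.Passage, D.curve p.param.1 p.param.2 = b
  · obtain ⟨p, rfl⟩ := hb
    refine Finite.subset (Set.toFinite {p, p.other}) fun q hq => ?_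
    exact Passage.eq_or_eq_other (z_eq_iff.2 hq)
  · convert Set.finite_empty
    ext q
    simpa using fun h => hb ⟨q, h⟩

/-- From any point of a component with a crossing one arrives at a crossing. -/
lemma exists_first_double (i : Fin D.numComponents) (t : ℝ) (h : ∃ t', D.IsDouble (i, t')) :
    ∃ x > 0, x ≤ 1 ∧ D.IsDouble (i, t + x) ∧ ∀ y ∈ Ioo 0 x, ¬ D.IsDouble (i, t + y) := by
  let A : Set ℝ := {x | x ∈ Ioc (0 : ℝ) 1 ∧ D.IsDouble (i, t + x)}
  obtain ⟨t', ht'⟩ := h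
  have : Nonempty D.Passage := ⟨(exists_passage ht').choose⟩
  have hfin : A.Finite := by
    choose! f hf using fun x (hx : x ∈ A) => exists_passage hx.2
    refine Set.Finite.of_finite_image (f := f) (Set.toFinite _) ?_
    intro x hx y hy hxy
    have h1 := (hf x hx).symm.trans (hxy ▸ hf y hy)
    obtain ⟨-, k, hk⟩ := h1
    dsimp only at hk
    have hk1 : |(k : ℝ)| < 1 := by
      rw [abs_lt]
      constructor <;> linarith [hx.1.1, hx.1.2, hy.1.1, hy.1.2]
    have hk0 : k = 0 := Int.abs_lt_one_iff.1 (by exact_mod_cast hk1)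
    subst hk0
    simpa using hk.symm
  have hne : A.Nonempty := by
    -- Subtracting a representative in [0, 1) from 1 gives a distance in (0, 1]. So a passage at t
    -- itself is found again after a full period, not at distance 0.
    obtain ⟨k, hk⟩ := exists_eq_add_int_mem_Ico (t - t')
    refine ⟨1 - (t - t' + k), ⟨by linarith [hk.2], by linarith [hk.1]⟩, ?_⟩
    refine (isDouble_congr_samePoint ?_).1 ht'
    exact ⟨rfl, 1 - k, by push_cast; ring⟩
  obtain ⟨x, hx, hmin⟩ := Set.exists_min_image A id hfin hne
  refine ⟨x, hx.1.1, hx.1.2, hx.2, fun y hy hd => ?_⟩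
  have := hmin y ⟨⟨hy.1, hy.2.le.trans hx.1.2⟩, hd⟩
  exact absurd hy.2 (not_lt.2 this)

namespace Passage

lemma exists_len (p : D.Passage) : ∃ x > 0, x ≤ 1 ∧ D.IsDouble (p.param.1, p.param.2 + x) ∧
    ∀ y ∈ Ioo 0 x, ¬ D.IsDouble (p.param.1, p.param.2 + y) :=
  exists_first_double p.param.1 p.param.2 ⟨_, p.isDouble⟩

/-- The length of the parameter interval from a passage to the next one on its component. -/
noncomputable def len (p : D.Passage) : ℝ := p.exists_len.choose

lemma len_pos (p : D.Passage) : 0 < p.len := p.exists_len.choose_spec.1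

lemma isDouble_add_len (p : D.Passage) : D.IsDouble (p.param.1, p.param.2 + p.len) :=
  p.exists_len.choose_spec.2.2.1

lemma not_isDouble_add (p : D.Passage) {y : ℝ} (h0 : 0 < y) (h1 : y < p.len) :
    ¬ D.IsDouble (p.param.1, p.param.2 + y) := p.exists_len.choose_spec.2.2.2 y ⟨h0, h1⟩

/-- The next passage on the same component. -/
noncomputable def next (p : D.Passage) : D.Passage := (exists_passage p.isDouble_add_len).choose

lemma samePoint_next (p : D.Passage) : SamePoint p.next.param (p.param.1, p.param.2 + p.len) :=
  (exists_passage p.isDouble_add_len).choose_spec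

/-- Two strands that meet at parameters before their ends coincide. -/
lemma eq_of_samePoint_add {p q : D.Passage} {x y : ℝ} (hx0 : 0 ≤ x)
    (hy0 : 0 ≤ y) (hxy : (x < p.len ∧ y < q.len) ∨ (0 < x ∧ x ≤ p.len ∧ 0 < y ∧ y ≤ q.len))
    (h : SamePoint (p.param.1, p.param.2 + x) (q.param.1, q.param.2 + y)) : p = q ∧ x = y := by
  wlog hle : y ≤ x generalizing p q x y
  · have := this hy0 hx0 (by tauto) h.symm (le_of_not_ge hle)
    exact ⟨this.1.symm, this.2.symm⟩
  obtain ⟨h1, k, hk⟩ := h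
  dsimp only at h1 hk
  -- The passage q lies at distance x - y after p. This is less than `p.len`, so it must be zero.
  have hs : SamePoint q.param (p.param.1, p.param.2 + (x - y)) := ⟨h1.symm, -k, by
    push_cast; linarith⟩
  have hd := (isDouble_congr_samePoint hs).1 q.isDouble
  have hxy0 : x - y = 0 := by
    by_contra hne
    refine p.not_isDouble_add (lt_of_le_of_ne (sub_nonneg.2 hle) (Ne.symm hne)) ?_ hd
    rcases hxy with h | h <;> linarith [h.1, h.2]
  rw [hxy0, add_zero] at hs
  exact ⟨(ext_samePoint hs).symm, sub_eq_zero.1 hxy0⟩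

lemma next_injective : Function.Injective (next : D.Passage → D.Passage) := fun p q h =>
  (eq_of_samePoint_add (x := p.len) (y := q.len) p.len_pos.le q.len_pos.le
    (Or.inr ⟨p.len_pos, le_rfl, q.len_pos, le_rfl⟩)
    (p.samePoint_next.symm.trans (h ▸ q.samePoint_next))).1

variable (D) in
/-- The passage to the next one, as a permutation. -/
noncomputable def nextPerm : Equiv.Perm D.Passage :=
  Equiv.ofBijective next (Finite.injective_iff_bijective.1 next_injective)

@[simp] lemma nextPerm_apply (p : D.Passage) : nextPerm D p = p.next := rfl

variable (D) in
/-- The passage to the other one through the same crossing, as a permutation. -/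
noncomputable def otherPerm : Equiv.Perm D.Passage := Function.Involutive.toPerm other other_other

@[simp] lemma otherPerm_apply (p : D.Passage) : otherPerm D p = p.other := rfl

variable (D) in
/-- The passage along Seifert circles: the strand that arrives at `p` is joined to the one that
departs from the other passage and arrives at the passage next to that one. -/
noncomputable def seifertPerm : Equiv.Perm D.Passage := (otherPerm D).trans (nextPerm D)

@[simp] lemma seifertPerm_apply (p : D.Passage) : seifertPerm D p = p.other.next := rfl

/-- The parameter in the middle of the strand that departs from a passage. -/
noncomputable def mid (p : D.Passage) : D.RegularParam :=
  ⟨(p.param.1, p.param.2 + p.len / 2), p.not_isDouble_add (by linarith [p.len_pos])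
    (by linarith [p.len_pos])⟩

lemma arrivesAt_mid (p : D.Passage) : D.ArrivesAt p.mid (p.param.1, p.param.2 + p.len) := by
  refine ⟨rfl, ?_, fun t ht => ?_⟩
  · simp only [mid]
    linarith [p.len_pos]
  · simp only [mid] at ht
    have := p.not_isDouble_add (y := t - p.param.2) (by linarith [p.len_pos, ht.1])
      (by linarith [ht.2])
    rwa [add_sub_cancel] at this

lemma departsFrom_mid (p : D.Passage) : D.DepartsFrom p.mid p.param := by
  refine ⟨rfl, ?_, fun t ht => ?_⟩
  · simp only [mid]
    linarith [p.len_pos]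
  · simp only [mid] at ht
    have := p.not_isDouble_add (y := t - p.param.2) (by linarith [ht.1])
      (by linarith [ht.2, p.len_pos])
    rwa [add_sub_cancel] at this

/-- The Seifert circle that contains the strand arriving at a passage. -/
noncomputable def circle (p : D.Passage) : D.SeifertCircle :=
  D.seifertCircle ((nextPerm D).symm p).mid

lemma exists_arrivesAt (p : D.Passage) : ∃ a, SamePoint p.param a ∧
    D.ArrivesAt ((nextPerm D).symm p).mid a := by
  refine ⟨_, ?_, arrivesAt_mid _⟩
  have := samePoint_next ((nextPerm D).symm p)
  rwa [← nextPerm_apply, Equiv.apply_symm_apply] at this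

lemma circle_eq {p : D.Passage} {r : D.RegularParam} {a : Fin D.numComponents × ℝ}
    (hp : SamePoint p.param a) (hr : D.ArrivesAt r a) : p.circle = D.seifertCircle r := by
  obtain ⟨a', ha', h⟩ := p.exists_arrivesAt
  exact seifertCircle_eq_of_arrivesAt h hr (ha'.symm.trans hp)

/-- One application of the permutation is a `turn` from the strand arriving at p to the strand
departing from `p.other`, followed up to its end. -/
lemma circle_seifertPerm (p : D.Passage) : (seifertPerm D p).circle = p.circle := by
  obtain ⟨a, ha, h⟩ := p.exists_arrivesAt
  rw [seifertPerm_apply, circle_eq p.other.samePoint_next p.other.arrivesAt_mid]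
  refine (Quot.sound (.turn _ _ a p.other.param (fun h' => ?_) ?_ h p.other.departsFrom_mid)).symm
  · exact p.not_samePoint_other (ha.trans h')
  · exact z_eq_iff.1 ((z_eq_of_samePoint ha).symm.trans p.pt_other.symm)

lemma circle_seifertPerm_zpow (p : D.Passage) (k : ℤ) :
    ((seifertPerm D ^ k) p).circle = p.circle := by
  induction k using Int.induction_on with
  | zero => rfl
  | succ k ih => rw [add_comm, zpow_one_add, Equiv.Perm.mul_apply, circle_seifertPerm, ih]
  | pred k ih =>
    rw [← circle_seifertPerm, ← Equiv.Perm.mul_apply, ← zpow_one_add, add_sub_cancel, ih]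

lemma joins (p : D.Passage) {e : D.Crossing} (he : D.curve p.param.1 p.param.2 = e) :
    D.Joins e p.circle p.other.circle := by
  obtain ⟨a, ha, h⟩ := p.exists_arrivesAt
  obtain ⟨b, hb, h'⟩ := p.other.exists_arrivesAt
  refine ⟨a, b, _, _, fun hab => ?_, ?_, ?_, h, h', rfl, rfl⟩
  · exact p.not_samePoint_other ((ha.trans hab).trans hb.symm)
  · exact (z_eq_iff.1 (z_eq_of_samePoint ha)).symm.trans he
  · exact (z_eq_iff.1 (z_eq_of_samePoint hb)).symm.trans ((z_eq_iff.1 p.pt_other).trans he)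

end Passage

lemma exists_passage_of_crossing (e : D.Crossing) :
    ∃ p : D.Passage, D.curve p.param.1 p.param.2 = e := by
  obtain ⟨a, -, -, ha, -⟩ := e.2
  obtain ⟨p, hp⟩ := exists_passage (a := a) (by unfold IsDouble; rw [ha]; exact e.2)
  exact ⟨p, (z_eq_iff.1 (z_eq_of_samePoint hp)).trans ha⟩

/-! ### Seifert circles as cycles of the permutation -/

lemma arrivesAt_unique {r : D.RegularParam} {a a' : Fin D.numComponents × ℝ}
    (h : D.ArrivesAt r a) (h' : D.ArrivesAt r a') (ha : D.IsDouble a) (ha' : D.IsDouble a') :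
    a = a' := by
  have h1 : a.1 = a'.1 := h.1.symm.trans h'.1
  refine Prod.ext h1 (le_antisymm ?_ ?_)
  · by_contra hlt
    exact h.2.2 a'.2 ⟨h'.2.1.le, not_le.1 hlt⟩ (by rw [h1]; exact ha')
  · by_contra hlt
    exact h'.2.2 a.2 ⟨h.2.1.le, not_le.1 hlt⟩ (by rw [← h1]; exact ha)

lemma arrivesAt_add_int {r s : D.RegularParam} {a : Fin D.numComponents × ℝ}
    (hrs : SamePoint r.1 s.1) (h : D.ArrivesAt r a) : ∃ a', SamePoint a a' ∧ D.ArrivesAt s a' := by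
  obtain ⟨h1, k, hk⟩ := hrs
  refine ⟨(a.1, a.2 + k), ⟨rfl, k, rfl⟩, h1.symm.trans h.1, by rw [hk]; linarith [h.2.1], ?_⟩
  intro t ht
  have := h.2.2 (t - k) ⟨by linarith [ht.1], by linarith [ht.2]⟩
  rw [← curve_add_int a.1 (t - k) k, sub_add_cancel] at this
  exact this

variable (D) in
/-- The passages at which the Seifert circle through a point arrives. -/
def arrivals (r : D.RegularParam) : Set D.Passage :=
  {q | ∃ (p : D.Passage) (a : Fin D.numComponents × ℝ), SamePoint p.param a ∧ D.ArrivesAt r a ∧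
    (Passage.seifertPerm D).SameCycle p q}

lemma arrivals_eq {r : D.RegularParam} {p : D.Passage} {a : Fin D.numComponents × ℝ}
    (hp : SamePoint p.param a) (h : D.ArrivesAt r a) :
    D.arrivals r = {q | (Passage.seifertPerm D).SameCycle p q} := by
  ext q
  constructor
  · rintro ⟨p', a', hp', h', hq⟩
    have haa := arrivesAt_unique h h' ((isDouble_congr_samePoint hp).1 p.isDouble)
      ((isDouble_congr_samePoint hp').1 p'.isDouble)
    rwa [Passage.ext_samePoint (hp.trans (haa ▸ hp'.symm))]
  · exact fun hq => ⟨p, a, hp, h, hq⟩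

/-- This makes `arrivals` an invariant of Seifert circles. In a turn, r arrives at p and s departs
from `p.other`, so s arrives at the image of p under `seifertPerm`, in the same cycle. -/
lemma arrivals_eq_of_smoothedStep {r s : D.RegularParam} (h : D.SmoothedStep r s) :
    D.arrivals r = D.arrivals s := by
  cases h with
  | same h =>
    ext q
    constructor
    · rintro ⟨p, a, hp, ha, hq⟩
      obtain ⟨a', haa', ha'⟩ := arrivesAt_add_int h ha
      exact ⟨p, a', hp.trans haa', ha', hq⟩
    · rintro ⟨p, a, hp, ha, hq⟩
      obtain ⟨a', haa', ha'⟩ := arrivesAt_add_int h.symm ha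
      exact ⟨p, a', hp.trans haa', ha', hq⟩
  | along h hle hreg =>
    ext q
    constructor
    · rintro ⟨p, a, hp, ha, hq⟩
      refine ⟨p, a, hp, ⟨h.symm.trans ha.1, ?_, fun t ht => ha.2.2 t ⟨hle.trans ht.1, ht.2⟩⟩, hq⟩
      by_contra hlt
      refine hreg a.2 ⟨ha.2.1.le, not_lt.1 hlt⟩ ?_
      rw [ha.1]
      exact (isDouble_congr_samePoint hp).1 p.isDouble
    · rintro ⟨p, a, hp, ha, hq⟩
      refine ⟨p, a, hp, ⟨h.trans ha.1, hle.trans_lt ha.2.1, fun t ht => ?_⟩, hq⟩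
      rcases le_total s.1.2 t with hst | hst
      · exact ha.2.2 t ⟨hst, ht.2⟩
      · have := hreg t ⟨ht.1, hst⟩
        rwa [h, ha.1] at this
  | turn a b hab hcross hr hs =>
    have hz : D.z a.1 a.2 = D.z b.1 b.2 := z_eq_iff.2 hcross
    have ha : D.IsDouble a := isDouble_iff.2 ⟨b, hab, hz⟩
    obtain ⟨p, hp⟩ := exists_passage ha
    obtain ⟨q, hq⟩ := exists_passage ((isDouble_congr hz).1 ha)
    have hqp : q = p.other := by
      refine (Passage.eq_or_eq_other ?_).resolve_left fun h => hab (hp.symm.trans (h ▸ hq))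
      exact (z_eq_of_samePoint hq).trans (hz.symm.trans (z_eq_of_samePoint hp).symm)
    obtain ⟨hq1, k, hk⟩ := hq
    have hnd : ∀ y ∈ Ioo 0 q.len, ¬ D.IsDouble (b.1, b.2 + y) := fun y hy hd =>
      q.not_isDouble_add hy.1 hy.2 ((isDouble_congr_samePoint
        (a := (q.param.1, q.param.2 + y)) (b := (b.1, b.2 + y)) ⟨hq1, k, by dsimp only; rw [hk]; ring⟩).2 hd)
    have hdl : SamePoint q.next.param (b.1, b.2 + q.len) :=
      q.samePoint_next.trans ⟨hq1, k, by dsimp only; rw [hk]; ring⟩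
    have harr : D.ArrivesAt s (b.1, b.2 + q.len) := by
      refine ⟨hs.1, ?_, fun t ht => ?_⟩
      · by_contra hlt
        exact hs.2.2 (b.2 + q.len) ⟨by linarith [q.len_pos], not_lt.1 hlt⟩
          ((isDouble_congr_samePoint hdl).1 q.next.isDouble)
      · have := hnd (t - b.2) ⟨by linarith [ht.1, hs.2.1], by linarith [ht.2]⟩
        rwa [add_sub_cancel] at this
    rw [arrivals_eq hp hr, arrivals_eq hdl harr, hqp]
    ext q'
    exact (Equiv.Perm.sameCycle_apply_left (f := Passage.seifertPerm D)).symm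

/-- The invariant `arrivals` descends to the quotient and recovers the cycle of a passage from its
circle. -/
lemma Passage.sameCycle_of_circle_eq {p q : D.Passage} (h : p.circle = q.circle) :
    (seifertPerm D).SameCycle p q := by
  obtain ⟨a, ha, hr⟩ := p.exists_arrivesAt
  obtain ⟨b, hb, hs⟩ := q.exists_arrivesAt
  have h1 := congrArg (Quot.lift D.arrivals fun _ _ h => arrivals_eq_of_smoothedStep h) h
  change D.arrivals _ = D.arrivals _ at h1
  rw [arrivals_eq ha hr, arrivals_eq hb hs] at h1
  have : q ∈ {q' | (seifertPerm D).SameCycle p q'} := by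
    rw [h1]
    exact Equiv.Perm.SameCycle.refl _ _
  exact this

instance : Finite D.SeifertCircle := by
  classical
  -- A point on a component with a crossing flows forward to a passage; a component without
  -- crossings is represented by its parameter 0.
  have hcov : (univ : Set D.SeifertCircle) ⊆ range (Passage.circle : D.Passage → _) ∪
      range fun i : {i : Fin D.numComponents // ∀ t, ¬ D.IsDouble (i, t)} =>
        D.seifertCircle ⟨(i.1, 0), i.2 0⟩ := by
    rintro x -
    induction x using Quot.ind with
    | mk r =>
      by_cases h : ∃ t', D.IsDouble (r.1.1, t')
      · left
        obtain ⟨x, hx, -, hd, hreg⟩ := exists_first_double r.1.1 r.1.2 h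
        obtain ⟨p, hp⟩ := exists_passage hd
        refine ⟨p, Passage.circle_eq hp ⟨rfl, by simpa using hx, fun t ht => ?_⟩⟩
        rcases ht.1.eq_or_lt with h0 | h0
        · rw [← h0]
          exact r.2
        · have := hreg (t - r.1.2) ⟨by linarith, by linarith [ht.2]⟩
          rwa [add_sub_cancel] at this
      · right
        have h' : ∀ t', ¬ D.IsDouble (r.1.1, t') := fun t' ht' => h ⟨t', ht'⟩
        refine ⟨⟨r.1.1, h'⟩, ?_⟩
        rcases le_total 0 r.1.2 with h0 | h0
        · exact Quot.sound (.along _ _ rfl h0 fun t _ => h' t)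
        · exact (Quot.sound (.along _ _ rfl h0 fun t _ => h' t)).symm
  exact finite_univ_iff.1 (((finite_range _).union (finite_range _)).subset hcov)

end GeneralizedLinkDiagram

/-! ### Transverse fields and tubular coordinates -/

/-- Along a regular curve there is a transverse field with prescribed constant values near the two
ends of the parameter interval. -/
lemma exists_transverse_field {d : ℝ → ℂ} (hd : ContDiff ℝ 1 d) (hne : ∀ τ, d τ ≠ 0) {n₀ n₁ : ℂ}
    (h₀ : 0 < cross (d 0) n₀) (h₁ : 0 < cross (d 1) n₁) :
    ∃ N : ℝ → ℂ, ContDiff ℝ 1 N ∧ (∀ᶠ τ in 𝓝 0, N τ = n₀) ∧ (∀ᶠ τ in 𝓝 1, N τ = n₁) ∧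
      ∀ τ, 0 < cross (d τ) (N τ) := by
  have e : ∀ (t : ℝ) (n : ℂ), 0 < cross (d t) n → ∀ᶠ τ in 𝓝 t, 0 < cross (d τ) n := fun t n h =>
    (continuous_cross.comp (hd.continuous.prodMk continuous_const)).continuousAt.eventually
      (lt_mem_nhds h)
  obtain ⟨δ₀, hδ₀, b₀⟩ := Metric.eventually_nhds_iff.1 (e 0 n₀ h₀)
  obtain ⟨δ₁, hδ₁, b₁⟩ := Metric.eventually_nhds_iff.1 (e 1 n₁ h₁)
  obtain ⟨δ, hδ, hd₀, hd₁, hd₂⟩ : ∃ δ > 0, δ ≤ δ₀ ∧ δ ≤ δ₁ ∧ δ ≤ 1 / 2 :=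
    ⟨min (min δ₀ δ₁) (1 / 2), by positivity, (min_le_left _ _).trans (min_le_left _ _),
      (min_le_left _ _).trans (min_le_right _ _), min_le_right _ _⟩
  let φ : ContDiffBump (0 : ℝ) := ⟨δ / 2, δ, by linarith, by linarith⟩
  let ψ : ContDiffBump (1 : ℝ) := ⟨δ / 2, δ, by linarith, by linarith⟩
  have hφ0 : ∀ τ, δ ≤ dist τ 0 → φ τ = 0 := fun τ h => φ.zero_of_le_dist h
  have hψ0 : ∀ τ, δ ≤ dist τ 1 → ψ τ = 0 := fun τ h => ψ.zero_of_le_dist h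
  have hfar : ∀ τ : ℝ, dist τ 0 < δ → δ ≤ dist τ 1 := fun τ h => by
    have := dist_triangle_left (0 : ℝ) 1 τ
    have h01 : dist (0 : ℝ) 1 = 1 := by simp
    linarith
  -- A convex combination of `n₀`, `n₁` and the rotated velocity. Each has positive determinant with
  -- d τ wherever its weight is nonzero, and the supports of φ and ψ are kept apart by δ ≤ 1/2.
  refine ⟨fun τ => φ τ • n₀ + ψ τ • n₁ + (1 - φ τ - ψ τ) • (Complex.I * d τ), ?_, ?_, ?_, ?_⟩
  · have h1 : ContDiff ℝ 1 φ := φ.contDiff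
    have h2 : ContDiff ℝ 1 ψ := ψ.contDiff
    fun_prop
  · filter_upwards [φ.eventuallyEq_one, Metric.ball_mem_nhds (0 : ℝ) hδ] with τ h1 h2
    rw [h1, hψ0 τ (hfar τ h2)]
    simp
  · filter_upwards [ψ.eventuallyEq_one, Metric.ball_mem_nhds (1 : ℝ) hδ] with τ h1 h2
    rw [h1, hφ0 τ (by by_contra hcon; exact absurd (hfar τ (not_le.1 hcon)) (not_le.2 h2))]
    simp
  · intro τ
    have hI : 0 < cross (d τ) (Complex.I * d τ) := by
      rw [GeneralizedLinkDiagram.cross_I_mul]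
      have := hne τ
      positivity
    rw [← crossL_apply, map_add, map_add, map_smul, map_smul, map_smul]
    simp only [crossL_apply, smul_eq_mul]
    rcases lt_or_ge (dist τ 0) δ with h | h
    · have hp := b₀ (h.trans_le hd₀)
      rw [hψ0 τ (hfar τ h)]
      rcases (φ.le_one (x := τ)).eq_or_lt with h1 | h1
      · rw [h1]; linarith
      · have := mul_nonneg (φ.nonneg (x := τ)) hp.le
        have := mul_pos (sub_pos.2 h1) hI
        linarith
    · rw [hφ0 τ h]
      rcases lt_or_ge (dist τ 1) δ with h' | h'
      · have hp := b₁ (h'.trans_le hd₁)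
        rcases (ψ.le_one (x := τ)).eq_or_lt with h1 | h1
        · rw [h1]; linarith
        · have := mul_nonneg (ψ.nonneg (x := τ)) hp.le
          have := mul_pos (sub_pos.2 h1) hI
          linarith
      · rw [hψ0 τ h']
        linarith

/-- Tubular coordinates along a curve are locally injective. -/
lemma eventually_tube_injective {f f' N : ℝ → ℂ} (hf : ContDiff ℝ 1 f)
    (hf' : ∀ t, HasDerivAt f (f' t) t) (hN : ContDiff ℝ 1 N) {t : ℝ} (h : cross (f' t) (N t) ≠ 0) :
    ∃ g : ℂ → ℝ × ℝ, ∀ᶠ x : ℝ × ℝ in 𝓝 (t, 0), g (f x.1 + x.2 • N x.1) = x := by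
  have hc : ContDiff ℝ 1 fun x : ℝ × ℝ => f x.1 + x.2 • N x.1 := by fun_prop
  have hs := hc.contDiffAt.hasStrictFDerivAt one_ne_zero (x := (t, (0 : ℝ)))
  have hN' : HasFDerivAt (fun x : ℝ × ℝ => N x.1) _ (t, (0 : ℝ)) :=
    ((hN.differentiable one_ne_zero t).hasDerivAt.hasFDerivAt).comp (t, (0 : ℝ)) hasFDerivAt_fst
  have hff : HasFDerivAt (fun x : ℝ × ℝ => f x.1) _ (t, (0 : ℝ)) :=
    ((hf' t).hasFDerivAt).comp (t, (0 : ℝ)) hasFDerivAt_fst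
  have hd := hff.add (hasFDerivAt_snd.smul hN')
  have hfd := hs.hasFDerivAt.unique hd
  set A := fderiv ℝ (fun x : ℝ × ℝ => f x.1 + x.2 • N x.1) (t, 0) with hA
  have hAx : ∀ x : ℝ × ℝ, A x = x.1 • f' t + x.2 • N t := fun x => by
    rw [hfd]
    simp
  -- By Cramer's rule the nonzero determinant makes the derivative injective, so the inverse
  -- function theorem applies.
  have hinj : Function.Injective A.toLinearMap := by
    rw [← LinearMap.ker_eq_bot, LinearMap.ker_eq_bot']
    intro x hx
    have hx' : x.1 • f' t + x.2 • N t = 0 := (hAx x).symm.trans hx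
    have h1 := congrArg Complex.re hx'
    have h2 := congrArg Complex.im hx'
    simp only [Complex.add_re, Complex.add_im, Complex.real_smul, Complex.re_ofReal_mul,
      Complex.im_ofReal_mul, Complex.zero_re, Complex.zero_im] at h1 h2
    unfold cross at h
    apply Prod.ext
    · refine (mul_eq_zero.1 ?_).resolve_right h
      linear_combination (N t).im * h1 - (N t).re * h2
    · refine (mul_eq_zero.1 ?_).resolve_right h
      linear_combination (f' t).re * h2 - (f' t).im * h1
  let E : (ℝ × ℝ) ≃L[ℝ] ℂ := (LinearEquiv.ofInjectiveOfFinrankEq A.toLinearMap hinj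
    (by simp [Complex.finrank_real_complex])).toContinuousLinearEquiv
  have hE : (E : (ℝ × ℝ) →L[ℝ] ℂ) = A := by ext <;> rfl
  rw [← hE] at hs
  exact ⟨_, hs.eventually_left_inverse⟩

/-! ### Strips along the Seifert circles -/

namespace GeneralizedLinkDiagram

variable {T : Type*} {D : GeneralizedLinkDiagram T}

namespace Passage

/-- The velocity of the diagram at a passage. -/
noncomputable def velocity (p : D.Passage) : ℂ := D.vel p.param.1 p.param.2

/-- The sign of a passage: whether the oriented smoothing turns to the left or to the right. -/
noncomputable def sgn (p : D.Passage) : ℝ := if 0 < cross p.velocity p.other.velocity then 1 else -1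

/-- The direction in which the two strands of the smoothed crossing are separated. -/
noncomputable def normal (p : D.Passage) : ℂ := p.sgn • (p.other.velocity - p.velocity)

lemma cross_velocity_ne_zero (p : D.Passage) : cross p.velocity p.other.velocity ≠ 0 :=
  cross_vel_ne_zero p.not_samePoint_other p.pt_other.symm

lemma sgn_eq (p : D.Passage) : p.sgn = 1 ∨ p.sgn = -1 := by
  unfold sgn
  split_ifs <;> simp

lemma sgn_mul_self (p : D.Passage) : p.sgn * p.sgn = 1 := by
  rcases p.sgn_eq with h | h <;> rw [h] <;> norm_num

lemma sgn_mul_cross_pos (p : D.Passage) : 0 < p.sgn * cross p.velocity p.other.velocity := by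
  unfold sgn
  split_ifs with h
  · linarith
  · have := lt_of_le_of_ne (not_lt.1 h) p.cross_velocity_ne_zero
    linarith

lemma sgn_other (p : D.Passage) : p.other.sgn = -p.sgn := by
  have h := p.cross_velocity_ne_zero
  unfold sgn
  rw [other_other, cross_swap]
  split_ifs with h1 h2 h2
  · linarith
  · norm_num
  · rfl
  · exact absurd (le_antisymm (not_lt.1 h2) (by linarith)) h

lemma normal_other (p : D.Passage) : p.other.normal = p.normal := by
  unfold normal
  rw [sgn_other, other_other, neg_smul, ← smul_neg, neg_sub]

lemma cross_smul_right (w w' : ℂ) (s : ℝ) : cross w (s • w') = s * cross w w' := by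
  rw [← crossL_apply, map_smul, crossL_apply, smul_eq_mul]

lemma cross_smul_left (w w' : ℂ) (s : ℝ) : cross (s • w) w' = s * cross w w' := by
  simp [cross]; ring

lemma cross_velocity_normal_pos (p : D.Passage) : 0 < cross p.velocity p.normal := by
  have h := p.sgn_mul_cross_pos
  unfold normal
  rw [cross_smul_right]
  convert h using 2
  simp [cross]; ring

/-- The strand that departs from a passage, parametrized by `[0, 1]`. -/
noncomputable def strand (p : D.Passage) (τ : ℝ) : ℂ := D.z p.param.1 (p.param.2 + p.len * τ)

/-- The velocity of the strand that departs from a passage. -/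
noncomputable def strandVel (p : D.Passage) (τ : ℝ) : ℂ :=
  p.len • D.vel p.param.1 (p.param.2 + p.len * τ)

lemma hasDerivAt_strand (p : D.Passage) (τ : ℝ) : HasDerivAt p.strand (p.strandVel τ) τ := by
  have h1 : HasDerivAt (fun x => p.param.2 + p.len * x) p.len τ := by
    simpa using ((hasDerivAt_id τ).const_mul p.len).const_add p.param.2
  exact (hasDerivAt_z p.param.1 (p.param.2 + p.len * τ)).scomp τ h1

lemma strand_contDiff (p : D.Passage) : ContDiff ℝ 1 p.strand :=
  (z_contDiff_one p.param.1).comp (by fun_prop)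

lemma continuous_strandVel (p : D.Passage) : Continuous p.strandVel := by
  have := continuous_vel (D := D) p.param.1
  unfold strandVel
  fun_prop

lemma strand_zero (p : D.Passage) : p.strand 0 = p.pt := by simp [strand, pt]

lemma strand_one (p : D.Passage) : p.strand 1 = p.next.pt := by
  rw [strand, mul_one]
  exact (z_eq_of_samePoint p.samePoint_next).symm

lemma strandVel_zero (p : D.Passage) : p.strandVel 0 = p.len • p.velocity := by
  simp [strandVel, velocity]

lemma strandVel_one (p : D.Passage) : p.strandVel 1 = p.len • p.next.velocity := by
  rw [strandVel, mul_one]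
  congr 1
  exact (vel_eq_of_samePoint p.samePoint_next).symm

lemma exists_strandNormal (p : D.Passage) : ∃ N : ℝ → ℂ, ContDiff ℝ 1 N ∧
    (∀ᶠ τ in 𝓝 0, N τ = p.normal) ∧ (∀ᶠ τ in 𝓝 1, N τ = p.next.normal) ∧
      ∀ τ, 0 < cross (p.strandVel τ) (N τ) := by
  refine exists_transverse_field ?_ ?_ ?_ ?_
  · have h : ContDiff ℝ 1 (D.vel p.param.1) :=
      (vel_contDiff p.param.1).of_le (by exact_mod_cast le_top)
    unfold strandVel
    fun_prop
  · exact fun τ => smul_ne_zero p.len_pos.ne' (vel_ne_zero _ _)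
  · rw [strandVel_zero, cross_smul_left]
    exact mul_pos p.len_pos p.cross_velocity_normal_pos
  · rw [strandVel_one, cross_smul_left]
    exact mul_pos p.len_pos p.next.cross_velocity_normal_pos

/-- A transverse field along the strand that departs from a passage. -/
noncomputable def strandNormal (p : D.Passage) : ℝ → ℂ := p.exists_strandNormal.choose

lemma strandNormal_contDiff (p : D.Passage) : ContDiff ℝ 1 p.strandNormal :=
  p.exists_strandNormal.choose_spec.1

lemma eventually_strandNormal_zero (p : D.Passage) : ∀ᶠ τ in 𝓝 0, p.strandNormal τ = p.normal :=
  p.exists_strandNormal.choose_spec.2.1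

lemma eventually_strandNormal_one (p : D.Passage) :
    ∀ᶠ τ in 𝓝 1, p.strandNormal τ = p.next.normal := p.exists_strandNormal.choose_spec.2.2.1

lemma cross_strandNormal_pos (p : D.Passage) (τ : ℝ) :
    0 < cross (p.strandVel τ) (p.strandNormal τ) := p.exists_strandNormal.choose_spec.2.2.2 τ

/-- The offset of the middle of the strip along a strand: it interpolates between the sides to
which the smoothing turns at the two ends. -/
noncomputable def strandOffset (p : D.Passage) (τ : ℝ) : ℝ :=
  (1 - τ) * p.other.sgn + τ * p.next.sgn

/-- Concatenation of functions on the strands of a Seifert circle: the interval `[k, k + 1]`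
corresponds to the `k`-th strand after the passage `p`. -/
noncomputable def along {X : Type*} (f : D.Passage → ℝ → X) (p : D.Passage) (x : ℝ) : X :=
  f ((seifertPerm D ^ ⌊x⌋) p).other (Int.fract x)

lemma seifertPerm_zpow_add (p : D.Passage) (j k : ℤ) :
    (seifertPerm D ^ (j + k)) p = (seifertPerm D ^ j) ((seifertPerm D ^ k) p) := by
  rw [zpow_add, Equiv.Perm.mul_apply]

lemma along_add_int {X : Type*} (f : D.Passage → ℝ → X) (p : D.Passage) (x : ℝ) (k : ℤ) :
    along f p (x + k) = along f ((seifertPerm D ^ k) p) x := by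
  unfold along
  rw [Int.floor_add_intCast, Int.fract_add_intCast, seifertPerm_zpow_add]

section along

variable {X : Type*} {f : D.Passage → ℝ → X}

lemma along_of_mem_Ico {p : D.Passage} {x : ℝ} (hx : x ∈ Ico (0 : ℝ) 1) :
    along f p x = f p.other x := by
  have h : ⌊x⌋ = 0 := Int.floor_eq_zero_iff.2 hx
  unfold along
  rw [h, Int.fract_eq_self.2 ⟨hx.1, hx.2⟩]
  rfl

lemma along_of_mem_Icc (hf : ∀ q : D.Passage, f q 1 = f q.next.other 0) {p : D.Passage} {x : ℝ}
    (hx : x ∈ Icc (0 : ℝ) 1) : along f p x = f p.other x := by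
  rcases hx.2.eq_or_lt with rfl | h
  · have := along_add_int f p 0 1
    simp only [Int.cast_one, zero_add, zpow_one] at this
    rw [this, along_of_mem_Ico ⟨le_rfl, one_pos⟩, hf]
    rfl
  · exact along_of_mem_Ico ⟨hx.1, h⟩

/-- The strand that arrives at a passage departs from this one. -/
noncomputable def prev (p : D.Passage) : D.Passage := (nextPerm D).symm p

@[simp] lemma next_prev (p : D.Passage) : p.prev.next = p := (nextPerm D).apply_symm_apply p

lemma seifertPerm_zpow_neg_one (p : D.Passage) : (seifertPerm D ^ (-1 : ℤ)) p = p.prev.other := by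
  rw [zpow_neg_one, Equiv.Perm.inv_eq_iff_eq]
  simp

lemma along_of_mem_Icc_neg (hf : ∀ q : D.Passage, f q 1 = f q.next.other 0) {p : D.Passage} {x : ℝ}
    (hx : x ∈ Icc (-1 : ℝ) 0) : along f p x = f p.prev (x + 1) := by
  have := along_add_int f p (x + 1) (-1)
  rw [seifertPerm_zpow_neg_one, along_of_mem_Icc hf (x := x + 1) ⟨by linarith [hx.1], by linarith [hx.2]⟩,
    other_other] at this
  rw [← this]
  congr 1
  push_cast
  ring

lemma continuous_along [TopologicalSpace X] (hf : ∀ q : D.Passage, f q 1 = f q.next.other 0)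
    (hc : ∀ q : D.Passage, Continuous (f q)) (p : D.Passage) : Continuous (along f p) := by
  have key : ∀ (p : D.Passage), ContinuousOn (along f p) (Icc (-1) 0 ∪ Icc 0 1) := fun p =>
    ContinuousOn.union_of_isClosed
      (((hc p.prev).comp (continuous_id.add continuous_const)).continuousOn.congr
        fun x hx => along_of_mem_Icc_neg hf hx)
      ((hc p.other).continuousOn.congr fun x hx => along_of_mem_Icc hf hx)
      isClosed_Icc isClosed_Icc
  refine continuous_iff_continuousAt.2 fun x => ?_
  have h1 : along f p = along f ((seifertPerm D ^ ⌊x⌋) p) ∘ fun y => y - ⌊x⌋ := by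
    ext y
    have := along_add_int f p (y - ⌊x⌋) ⌊x⌋
    rwa [sub_add_cancel] at this
  rw [h1]
  refine ContinuousAt.comp ?_ (by fun_prop)
  rw [Icc_union_Icc_eq_Icc (by norm_num) (by norm_num)] at key
  refine (key _).continuousAt (Icc_mem_nhds ?_ ?_)
  · linarith [Int.floor_le x]
  · linarith [Int.lt_floor_add_one x]

end along

/-- The Seifert circle through a passage, with a corner at each integer. -/
noncomputable def path (p : D.Passage) : ℝ → ℂ := along strand p

/-- The transverse field along a Seifert circle. -/
noncomputable def pathNormal (p : D.Passage) : ℝ → ℂ := along strandNormal p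

/-- The offset along a Seifert circle. -/
noncomputable def pathOffset (p : D.Passage) : ℝ → ℝ := along strandOffset p

lemma strand_glue (q : D.Passage) : q.strand 1 = q.next.other.strand 0 := by
  rw [strand_one, strand_zero, pt_other]

lemma strandNormal_glue (q : D.Passage) : q.strandNormal 1 = q.next.other.strandNormal 0 := by
  rw [q.eventually_strandNormal_one.self_of_nhds,
    q.next.other.eventually_strandNormal_zero.self_of_nhds, normal_other]

lemma strandOffset_glue (q : D.Passage) : q.strandOffset 1 = q.next.other.strandOffset 0 := by
  simp [strandOffset]

lemma continuous_path (p : D.Passage) : Continuous p.path :=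
  continuous_along strand_glue (fun q => q.strand_contDiff.continuous) p

lemma continuous_pathNormal (p : D.Passage) : Continuous p.pathNormal :=
  continuous_along strandNormal_glue (fun q => q.strandNormal_contDiff.continuous) p

lemma continuous_pathOffset (p : D.Passage) : Continuous p.pathOffset :=
  continuous_along strandOffset_glue (fun q => by unfold strandOffset; fun_prop) p

/-- A strip of width `ε` along a Seifert circle; it touches the crossings. -/
noncomputable def strip (ε : ℝ) (p : D.Passage) (x s : ℝ) : ℂ :=
  p.path x + (ε * (p.pathOffset x + s)) • p.pathNormal x

lemma strip_add_int (ε : ℝ) (p : D.Passage) (x s : ℝ) (k : ℤ) :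
    strip ε p (x + k) s = strip ε ((seifertPerm D ^ k) p) x s := by
  simp only [strip, path, pathOffset, pathNormal, along_add_int]

lemma strip_eq_sub (ε : ℝ) (p : D.Passage) (x s : ℝ) (k : ℤ) :
    strip ε p x s = strip ε ((seifertPerm D ^ k) p) (x - k) s := by
  rw [← strip_add_int, sub_add_cancel]

lemma continuous_strip (p : D.Passage) :
    Continuous fun y : ℝ × ℝ × ℝ => strip y.1 p y.2.1 y.2.2 := by
  have := p.continuous_path
  have := p.continuous_pathNormal
  have := p.continuous_pathOffset
  unfold strip
  fun_prop

lemma path_zero (p : D.Passage) : p.path 0 = p.pt := by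
  rw [path, along_of_mem_Ico ⟨le_rfl, one_pos⟩, strand_zero, pt_other]

lemma pathOffset_zero (p : D.Passage) : p.pathOffset 0 = p.sgn := by
  rw [pathOffset, along_of_mem_Ico ⟨le_rfl, one_pos⟩]
  simp [strandOffset]

/-- A strand over [0, 1) meets a crossing only at its start. So strands can meet either there, as
the two passages of a crossing, or at a regular point, which determines the strand and the
parameter. -/
lemma strand_eq_strand {q q' : D.Passage} {τ τ' : ℝ} (hτ : τ ∈ Ico (0 : ℝ) 1)
    (hτ' : τ' ∈ Ico (0 : ℝ) 1) (h : q.strand τ = q'.strand τ') :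
    (q = q' ∧ τ = τ') ∨ (τ = 0 ∧ τ' = 0 ∧ q' = q.other) := by
  have hreg : ∀ {q : D.Passage} {τ : ℝ}, τ ∈ Ico (0 : ℝ) 1 → 0 < τ →
      ¬ D.IsDouble (q.param.1, q.param.2 + q.len * τ) := fun {q τ} hτ h0 =>
    q.not_isDouble_add (mul_pos q.len_pos h0) (by nlinarith [q.len_pos, hτ.2])
  have hlt : ∀ {q : D.Passage} {τ : ℝ}, τ ∈ Ico (0 : ℝ) 1 → q.len * τ < q.len := fun {q τ} hτ => by
    nlinarith [q.len_pos, hτ.2]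
  have hz : D.z q.param.1 (q.param.2 + q.len * τ) = D.z q'.param.1 (q'.param.2 + q'.len * τ') := h
  by_cases hd : D.IsDouble (q.param.1, q.param.2 + q.len * τ)
  · have hd' : D.IsDouble (q'.param.1, q'.param.2 + q'.len * τ') :=
      (isDouble_congr (a := (q.param.1, q.param.2 + q.len * τ))
        (b := (q'.param.1, q'.param.2 + q'.len * τ')) hz).1 hd
    have h0 : τ = 0 := by
      by_contra hne
      exact hreg hτ (lt_of_le_of_ne hτ.1 (Ne.symm hne)) hd
    have h0' : τ' = 0 := by
      by_contra hne
      exact hreg hτ' (lt_of_le_of_ne hτ'.1 (Ne.symm hne)) hd'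
    subst h0 h0'
    rw [strand_zero, strand_zero] at h
    rcases eq_or_eq_other h.symm with h | h
    · exact Or.inl ⟨h.symm, rfl⟩
    · exact Or.inr ⟨rfl, rfl, h⟩
  · have hs := samePoint_of_not_isDouble (b := (q'.param.1, q'.param.2 + q'.len * τ')) hd hz
    obtain ⟨rfl, h2⟩ := eq_of_samePoint_add (mul_nonneg q.len_pos.le hτ.1)
      (mul_nonneg q'.len_pos.le hτ'.1) (Or.inl ⟨hlt hτ, hlt hτ'⟩) hs
    exact Or.inl ⟨rfl, mul_left_cancel₀ q.len_pos.ne' h2⟩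

lemma path_eq_path {p p' : D.Passage} {x x' : ℝ} (h : p.path x = p'.path x') :
    ((seifertPerm D ^ ⌊x⌋) p = (seifertPerm D ^ ⌊x'⌋) p' ∧ x - ⌊x⌋ = x' - ⌊x'⌋) ∨
      (x = ⌊x⌋ ∧ x' = ⌊x'⌋ ∧
        (seifertPerm D ^ ⌊x'⌋) p' = ((seifertPerm D ^ ⌊x⌋) p).other) := by
  rcases strand_eq_strand ⟨Int.fract_nonneg x, Int.fract_lt_one x⟩
    ⟨Int.fract_nonneg x', Int.fract_lt_one x'⟩ h with ⟨h1, h2⟩ | ⟨h1, h2, h3⟩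
  · left
    refine ⟨?_, h2⟩
    rw [← other_other ((seifertPerm D ^ ⌊x⌋) p), h1, other_other]
  · right
    refine ⟨sub_eq_zero.1 h1, sub_eq_zero.1 h2, ?_⟩
    rw [← other_other ((seifertPerm D ^ ⌊x'⌋) p'), h3, other_other]

lemma path_of_nonneg (p : D.Passage) {y : ℝ} (h : y ∈ Icc (0 : ℝ) 1) :
    p.path y = p.other.strand y := along_of_mem_Icc strand_glue h

lemma path_of_nonpos (p : D.Passage) {y : ℝ} (h : y ∈ Icc (-1 : ℝ) 0) :
    p.path y = p.prev.strand (y + 1) := along_of_mem_Icc_neg strand_glue h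

/-! ### The strips near a corner and near a regular point -/

lemma eventually_pathNormal_eq (p : D.Passage) : ∀ᶠ y in 𝓝 (0 : ℝ), p.pathNormal y = p.normal := by
  have t : Tendsto (fun y : ℝ => y + 1) (𝓝 0) (𝓝 1) := by
    simpa using (continuous_add_const (1 : ℝ)).tendsto 0
  filter_upwards [p.other.eventually_strandNormal_zero,
    t.eventually p.prev.eventually_strandNormal_one,
    Icc_mem_nhds (show (-1 : ℝ) < 0 by norm_num) one_pos] with y h1 h2 h3
  rcases le_total 0 y with h | h
  · rw [pathNormal, along_of_mem_Icc strandNormal_glue ⟨h, h3.2⟩, h1, normal_other]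
  · rw [pathNormal, along_of_mem_Icc_neg strandNormal_glue ⟨h3.1, h⟩, h2, next_prev]

/-- Both legs of the corner have positive determinant with `p.normal`, so the functional is strictly
increasing through the corner although the path is not smooth there. It replaces tubular coordinates
at corners. -/
lemma exists_injOn_cross_path (p : D.Passage) :
    ∃ δ > 0, InjOn (fun y => cross (p.path y) p.normal) (Icc (-δ) δ) := by
  have e : ∀ (q : D.Passage) (t : ℝ), 0 < cross (q.strandVel t) p.normal →
      ∀ᶠ τ in 𝓝 t, 0 < cross (q.strandVel τ) p.normal := fun q t h =>
    (continuous_cross.comp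
      (q.continuous_strandVel.prodMk continuous_const)).continuousAt.eventually (lt_mem_nhds h)
  have h0 := e p.other 0 (by
    rw [strandVel_zero, cross_smul_left, ← normal_other]
    exact mul_pos p.other.len_pos p.other.cross_velocity_normal_pos)
  have h1 := e p.prev 1 (by
    rw [strandVel_one, cross_smul_left, next_prev]
    exact mul_pos p.prev.len_pos p.cross_velocity_normal_pos)
  obtain ⟨δ₀, hδ₀, b₀⟩ := Metric.eventually_nhds_iff.1 h0
  obtain ⟨δ₁, hδ₁, b₁⟩ := Metric.eventually_nhds_iff.1 h1
  obtain ⟨δ, hδ, hd₀, hd₁, hd₂⟩ : ∃ δ > 0, δ < δ₀ ∧ δ < δ₁ ∧ δ ≤ 1 := by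
    refine ⟨min (min (δ₀ / 2) (δ₁ / 2)) 1, by positivity, ?_, ?_, min_le_right _ _⟩
    · exact ((min_le_left _ _).trans (min_le_left _ _)).trans_lt (by linarith)
    · exact ((min_le_left _ _).trans (min_le_right _ _)).trans_lt (by linarith)
  have m0 := strictMonoOn_crossL p.other.hasDerivAt_strand (convex_Icc 0 δ) (n := p.normal)
    (fun t ht => b₀ (by
      rw [Real.dist_eq, sub_zero, abs_of_nonneg ht.1]; linarith [ht.2]))
  have m1 := strictMonoOn_crossL p.prev.hasDerivAt_strand (convex_Icc (1 - δ) 1) (n := p.normal)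
    (fun t ht => b₁ (by
      rw [Real.dist_eq, abs_of_nonpos (by linarith [ht.2])]; linarith [ht.1]))
  refine ⟨δ, hδ, ?_⟩
  have s0 : StrictMonoOn (fun y => cross (p.path y) p.normal) (Icc 0 δ) := by
    intro x hx y hy hxy
    simp only
    rw [p.path_of_nonneg ⟨hx.1, hx.2.trans hd₂⟩, p.path_of_nonneg ⟨hy.1, hy.2.trans hd₂⟩]
    exact m0 hx hy hxy
  have s1 : StrictMonoOn (fun y => cross (p.path y) p.normal) (Icc (-δ) 0) := by
    intro x hx y hy hxy
    simp only
    rw [p.path_of_nonpos ⟨by linarith [hx.1], hx.2⟩, p.path_of_nonpos ⟨by linarith [hy.1], hy.2⟩]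
    exact m1 ⟨by linarith [hx.1], by linarith [hx.2]⟩ ⟨by linarith [hy.1], by linarith [hy.2]⟩
      (by linarith)
  have := s1.union s0 ⟨⟨by linarith, le_rfl⟩, fun x hx => hx.2⟩ ⟨⟨le_rfl, hδ.le⟩, fun x hx => hx.1⟩
  rw [Icc_union_Icc_eq_Icc (by linarith) hδ.le] at this
  exact this.injOn

/-- Near a corner, the strip along a Seifert circle is injective. -/
lemma eventually_strip_injective_corner (p : D.Passage) (s₀ s₀' : ℝ) :
    ∀ᶠ w : ℝ × ℝ × ℝ × ℝ × ℝ in 𝓝 (0, 0, 0, s₀, s₀'), 0 < w.1 →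
      strip w.1 p w.2.1 w.2.2.2.1 = strip w.1 p w.2.2.1 w.2.2.2.2 →
      w.2.1 = w.2.2.1 ∧ w.2.2.2.1 = w.2.2.2.2 := by
  obtain ⟨δ, hδ, hinj⟩ := p.exists_injOn_cross_path
  have hn := p.eventually_pathNormal_eq.and
    (Icc_mem_nhds (neg_neg_of_pos hδ) hδ : ∀ᶠ y in 𝓝 (0 : ℝ), y ∈ Icc (-δ) δ)
  have t1 : Tendsto (fun w : ℝ × ℝ × ℝ × ℝ × ℝ => w.2.1) (𝓝 (0, 0, 0, s₀, s₀')) (𝓝 0) :=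
    Continuous.tendsto (by fun_prop) _
  have t2 : Tendsto (fun w : ℝ × ℝ × ℝ × ℝ × ℝ => w.2.2.1) (𝓝 (0, 0, 0, s₀, s₀')) (𝓝 0) :=
    Continuous.tendsto (by fun_prop) _
  filter_upwards [t1.eventually hn, t2.eventually hn]
  rintro ⟨ε, y, y', s, s'⟩ ⟨hn1, hy⟩ ⟨hn2, hy'⟩ hε heq
  dsimp only at hn1 hn2 hy hy' hε heq ⊢
  unfold strip at heq
  rw [hn1, hn2] at heq
  have hpar : ∀ (w : ℂ) (r : ℝ), cross (w + r • p.normal) p.normal = cross w p.normal :=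
    fun w r => by simp [cross]; ring
  have h1 : y = y' := hinj hy hy' (by
    simp only
    rw [← hpar (p.path y), heq, hpar])
  subst h1
  have hne : p.normal ≠ 0 := fun h => by
    have := p.cross_velocity_normal_pos
    rw [h] at this
    simp [cross] at this
  have h2 := smul_left_injective ℝ hne (add_left_cancel heq)
  have h3 := mul_left_cancel₀ hε.ne' h2
  exact ⟨rfl, add_left_cancel h3⟩

/-- Away from the corners, the strip along a Seifert circle is locally injective. -/
lemma eventually_strip_injective_regular (p : D.Passage) {y₀ : ℝ} (hy₀ : y₀ ∈ Ioo (0 : ℝ) 1)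
    (s₀ s₀' : ℝ) :
    ∀ᶠ w : ℝ × ℝ × ℝ × ℝ × ℝ in 𝓝 (0, y₀, y₀, s₀, s₀'), 0 < w.1 →
      strip w.1 p w.2.1 w.2.2.2.1 = strip w.1 p w.2.2.1 w.2.2.2.2 →
      w.2.1 = w.2.2.1 ∧ w.2.2.2.1 = w.2.2.2.2 := by
  obtain ⟨g, hg⟩ := eventually_tube_injective p.other.strand_contDiff p.other.hasDerivAt_strand
    p.other.strandNormal_contDiff (p.other.cross_strandNormal_pos y₀).ne'
  have hrep : ∀ y ∈ Ioo (0 : ℝ) 1, ∀ ε s : ℝ, strip ε p y s = p.other.strand y +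
      (ε * (p.pathOffset y + s)) • p.other.strandNormal y := fun y hy ε s => by
    rw [strip, path, pathNormal, along_of_mem_Ico ⟨hy.1.le, hy.2⟩,
      along_of_mem_Ico ⟨hy.1.le, hy.2⟩]
  have hI : ∀ᶠ y in 𝓝 y₀, y ∈ Ioo (0 : ℝ) 1 := Ioo_mem_nhds hy₀.1 hy₀.2
  have hoff := p.continuous_pathOffset
  have t1 : Tendsto (fun w : ℝ × ℝ × ℝ × ℝ × ℝ => w.2.1) (𝓝 (0, y₀, y₀, s₀, s₀')) (𝓝 y₀) :=
    Continuous.tendsto (by fun_prop) _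
  have t2 : Tendsto (fun w : ℝ × ℝ × ℝ × ℝ × ℝ => w.2.2.1) (𝓝 (0, y₀, y₀, s₀, s₀')) (𝓝 y₀) :=
    Continuous.tendsto (by fun_prop) _
  have u1 : Tendsto (fun w : ℝ × ℝ × ℝ × ℝ × ℝ => (w.2.1, w.1 * (p.pathOffset w.2.1 + w.2.2.2.1)))
      (𝓝 (0, y₀, y₀, s₀, s₀')) (𝓝 (y₀, 0)) :=
    Continuous.tendsto' (by fun_prop) _ _ (by simp)
  have u2 : Tendsto (fun w : ℝ × ℝ × ℝ × ℝ × ℝ =>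
      (w.2.2.1, w.1 * (p.pathOffset w.2.2.1 + w.2.2.2.2)))
      (𝓝 (0, y₀, y₀, s₀, s₀')) (𝓝 (y₀, 0)) :=
    Continuous.tendsto' (by fun_prop) _ _ (by simp)
  filter_upwards [t1.eventually hI, t2.eventually hI, u1.eventually hg, u2.eventually hg]
  rintro ⟨ε, y, y', s, s'⟩ hy hy' h1 h2 hε heq
  dsimp only at hy hy' h1 h2 hε heq ⊢
  rw [hrep y hy, hrep y' hy'] at heq
  rw [heq, h2, Prod.mk.injEq] at h1
  obtain ⟨rfl, h3⟩ := h1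
  exact ⟨rfl, (add_left_cancel (mul_left_cancel₀ hε.ne' h3)).symm⟩

lemma abs_sgn (p : D.Passage) : |p.sgn| = 1 := by
  rcases p.sgn_eq with h | h <;> simp [h]

/-- On each strand the offset is affine between two signs, which differ by at most 2. -/
lemma abs_pathOffset_sub_sgn_le (p : D.Passage) {y : ℝ} (hy : y ∈ Icc (-1 : ℝ) 1) :
    |p.pathOffset y - p.sgn| ≤ 2 * |y| := by
  have hb : ∀ q : D.Passage, |q.sgn - p.sgn| ≤ 2 := fun q => by
    have := abs_sub q.sgn p.sgn
    rw [abs_sgn, abs_sgn] at this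
    linarith
  rcases le_total 0 y with h | h
  · rw [pathOffset, along_of_mem_Icc strandOffset_glue ⟨h, hy.2⟩]
    have : p.other.strandOffset y - p.sgn = (p.other.next.sgn - p.sgn) * y := by
      simp only [strandOffset, other_other]; ring
    rw [this, abs_mul]
    exact mul_le_mul_of_nonneg_right (hb _) (abs_nonneg y)
  · rw [pathOffset, along_of_mem_Icc_neg strandOffset_glue ⟨hy.1, h⟩]
    have : p.prev.strandOffset (y + 1) - p.sgn = (p.prev.other.sgn - p.sgn) * (-y) := by
      simp only [strandOffset, next_prev]; ring
    rw [this, abs_mul, abs_neg]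
    exact mul_le_mul_of_nonneg_right (hb _) (abs_nonneg y)

/-- The height of a point over a crossing, positive on the side of the corner at `p`. -/
noncomputable def height (p : D.Passage) (w : ℂ) : ℝ :=
  p.sgn * cross (p.velocity + p.other.velocity) (w - p.pt)

lemma height_other (p : D.Passage) (w : ℂ) : p.other.height w = -p.height w := by
  unfold height
  rw [sgn_other, other_other, pt_other, add_comm p.other.velocity]
  ring

/-- Write u and v for the velocities of p and `p.other`. Then cross (u + v) v = cross u v and cross
(u + v) u = -cross u v. After multiplication by the sign, the arriving leg descends to the crossing
and the departing leg rises from it, both at a positive rate. -/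
lemma exists_height_path (p : D.Passage) :
    ∃ κ > 0, ∀ᶠ y in 𝓝 (0 : ℝ), κ * |y| ≤ p.height (p.path y) := by
  set m : ℂ := p.sgn • (p.velocity + p.other.velocity) with hm
  have hc := p.sgn_mul_cross_pos
  have hmv : 0 < cross m (p.other.strandVel 0) := by
    rw [strandVel_zero, cross_smul_right]
    have e : cross (p.velocity + p.other.velocity) p.other.velocity =
        cross p.velocity p.other.velocity := by simp [cross]; ring
    rw [hm, cross_smul_left, e]
    exact mul_pos p.other.len_pos hc
  have hmu : 0 < cross (-m) (p.prev.strandVel 1) := by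
    rw [strandVel_one, cross_smul_right, next_prev]
    have e : cross (-(p.velocity + p.other.velocity)) p.velocity =
        cross p.velocity p.other.velocity := by simp [cross]; ring
    rw [hm, ← smul_neg, cross_smul_left, e]
    exact mul_pos p.prev.len_pos hc
  have g0 := eventually_cross_growth (p.other.hasDerivAt_strand 0) hmv
  have g1 := eventually_cross_growth (p.prev.hasDerivAt_strand 1) hmu
  have t : Tendsto (fun y : ℝ => y + 1) (𝓝 0) (𝓝 1) := by
    simpa using (continuous_add_const (1 : ℝ)).tendsto 0
  set κ₀ := cross m (p.other.strandVel 0) / 2 with hκ₀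
  set κ₁ := cross (-m) (p.prev.strandVel 1) / 2 with hκ₁
  refine ⟨min κ₀ κ₁, lt_min (by linarith) (by linarith), ?_⟩
  have hh : ∀ w, p.height w = cross m (w - p.pt) := fun w => by
    rw [height, hm, cross_smul_left]
  filter_upwards [g0, t.eventually g1, Icc_mem_nhds (show (-1 : ℝ) < 0 by norm_num) one_pos]
    with y h0 h1 hy
  rw [hh]
  rcases le_total 0 y with h | h
  · rw [p.path_of_nonneg ⟨h, hy.2⟩, abs_of_nonneg h]
    have := h0.1 h
    rw [strand_zero, pt_other, sub_zero] at this
    exact (mul_le_mul_of_nonneg_right (min_le_left _ _) h).trans this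
  · rw [p.path_of_nonpos ⟨hy.1, h⟩, abs_of_nonpos h]
    have := h1.2 (by linarith)
    rw [strand_one, next_prev] at this
    have hneg : ∀ w, cross (-m) w = -cross m w := fun w => by simp [cross]; ring
    rw [hneg (_ - _)] at this
    have h3 := mul_le_mul_of_nonneg_right (min_le_right κ₀ κ₁) (neg_nonneg.2 h)
    linarith

/-- The strip near a corner lies on one side of the crossing, and only touches it. -/
lemma exists_height_strip (p : D.Passage) (s₀ : ℝ) :
    ∃ κ > 0, ∃ h > 0, ∀ᶠ w : ℝ × ℝ × ℝ in 𝓝 (0, 0, s₀), 0 < w.1 →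
      κ * |w.2.1| + w.1 * (1 + p.sgn * w.2.2) * h ≤ p.height (strip w.1 p w.2.1 w.2.2) := by
  obtain ⟨κ, hκ, hpath⟩ := p.exists_height_path
  have hc := p.sgn_mul_cross_pos
  set h := 2 * (p.sgn * cross p.velocity p.other.velocity) with hh
  have hpos : 0 < h := by linarith
  have hn : cross (p.velocity + p.other.velocity) p.normal = h := by
    rw [normal, cross_smul_right, hh, ← mul_assoc, mul_comm 2, mul_assoc]
    congr 1
    simp [cross]; ring
  have t1 : Tendsto (fun w : ℝ × ℝ × ℝ => w.2.1) (𝓝 (0, 0, s₀)) (𝓝 0) :=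
    Continuous.tendsto (by fun_prop) _
  have t0 : Tendsto (fun w : ℝ × ℝ × ℝ => w.1) (𝓝 (0, 0, s₀)) (𝓝 0) :=
    Continuous.tendsto (by fun_prop) _
  refine ⟨κ / 2, by linarith, h, hpos, ?_⟩
  filter_upwards [t1.eventually hpath, t1.eventually p.eventually_pathNormal_eq,
    t1.eventually (Icc_mem_nhds (show (-1 : ℝ) < 0 by norm_num) one_pos),
    t0.eventually (gt_mem_nhds (show 0 < κ / (4 * h) by positivity))]
  rintro ⟨ε, y, s⟩ h1 h2 h3 h4 hε
  dsimp only at h1 h2 h3 h4 hε ⊢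
  have e1 : p.height (strip ε p y s) = p.height (p.path y) +
      ε * (p.sgn * p.pathOffset y + p.sgn * s) * h := by
    rw [height, height, strip, h2, add_sub_right_comm, ← crossL_apply, map_add, crossL_apply,
      crossL_apply, cross_smul_right, hn]
    ring
  have e2 : 1 - 2 * |y| ≤ p.sgn * p.pathOffset y := by
    have h5 := p.abs_pathOffset_sub_sgn_le h3
    have h6 : |p.sgn * (p.pathOffset y - p.sgn)| ≤ 2 * |y| := by
      rw [abs_mul, abs_sgn, one_mul]; exact h5
    have h7 := (abs_le.1 h6).1
    rw [mul_sub, sgn_mul_self] at h7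
    linarith
  -- The offset may fall short of the sign by 2|y|. For small ε this loss is absorbed by half of the
  -- growth of the path.
  have e3 : ε * h * (2 * |y|) ≤ κ / 2 * |y| := by
    rw [lt_div_iff₀ (by positivity)] at h4
    have := mul_le_mul_of_nonneg_right h4.le (abs_nonneg y)
    linarith
  have e4 := mul_le_mul_of_nonneg_left e2 (mul_pos hε hpos).le
  rw [e1]
  linarith

/-- The strips along the two Seifert circles at a crossing touch only in the crossing. -/
lemma eventually_strip_opposite (p : D.Passage) (s₀ s₀' : ℝ) :
    ∀ᶠ w : ℝ × ℝ × ℝ × ℝ × ℝ in 𝓝 (0, 0, 0, s₀, s₀'), 0 < w.1 →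
      |w.2.2.2.1| ≤ 1 → |w.2.2.2.2| ≤ 1 →
      strip w.1 p w.2.1 w.2.2.2.1 = strip w.1 p.other w.2.2.1 w.2.2.2.2 →
      w.2.1 = 0 ∧ w.2.2.1 = 0 ∧ w.2.2.2.1 = -p.sgn ∧ w.2.2.2.2 = p.sgn := by
  obtain ⟨κ, hκ, h, hh, e⟩ := p.exists_height_strip s₀
  obtain ⟨κ', hκ', h', hh', e'⟩ := p.other.exists_height_strip s₀'
  have t : Tendsto (fun w : ℝ × ℝ × ℝ × ℝ × ℝ => (w.1, w.2.1, w.2.2.2.1))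
      (𝓝 (0, 0, 0, s₀, s₀')) (𝓝 (0, 0, s₀)) := Continuous.tendsto (by fun_prop) _
  have t' : Tendsto (fun w : ℝ × ℝ × ℝ × ℝ × ℝ => (w.1, w.2.2.1, w.2.2.2.2))
      (𝓝 (0, 0, 0, s₀, s₀')) (𝓝 (0, 0, s₀')) := Continuous.tendsto (by fun_prop) _
  filter_upwards [t.eventually e, t'.eventually e']
  rintro ⟨ε, y, y', s, s'⟩ h1 h2 hε hs hs' heq
  dsimp only at h1 h2 hε hs hs' heq ⊢
  have h1 := h1 hε
  have h2 := h2 hε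
  -- The two corners bound the height of the common point from below and from above by zero, so
  -- every nonnegative term in both bounds vanishes.
  rw [← heq, height_other, sgn_other] at h2
  have hsg : ∀ r : ℝ, |r| ≤ 1 → 0 ≤ 1 + p.sgn * r ∧ 0 ≤ 1 + -p.sgn * r := by
    intro r hr
    obtain ⟨ha, hb⟩ := abs_le.1 hr
    rcases p.sgn_eq with h | h <;> rw [h] <;> constructor <;> linarith
  have q1 := mul_nonneg (mul_nonneg hε.le (hsg s hs).1) hh.le
  have q2 := mul_nonneg (mul_nonneg hε.le (hsg s' hs').2) hh'.le
  have q3 := mul_nonneg hκ.le (abs_nonneg y)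
  have q4 := mul_nonneg hκ'.le (abs_nonneg y')
  have r1 : κ * |y| = 0 := by linarith
  have r2 : κ' * |y'| = 0 := by linarith
  have r3 : ε * (1 + p.sgn * s) * h = 0 := by linarith
  have r4 : ε * (1 + -p.sgn * s') * h' = 0 := by linarith
  have s3 : 1 + p.sgn * s = 0 :=
    (mul_eq_zero.1 ((mul_eq_zero.1 r3).resolve_right hh.ne')).resolve_left hε.ne'
  have s4 : 1 + -p.sgn * s' = 0 :=
    (mul_eq_zero.1 ((mul_eq_zero.1 r4).resolve_right hh'.ne')).resolve_left hε.ne'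
  have hsq := p.sgn_mul_self
  refine ⟨abs_eq_zero.1 ((mul_eq_zero.1 r1).resolve_left hκ.ne'),
    abs_eq_zero.1 ((mul_eq_zero.1 r2).resolve_left hκ'.ne'), ?_, ?_⟩
  · linear_combination p.sgn * s3 - s * hsq
  · linear_combination (-p.sgn) * s4 - s' * hsq

/-! ### Embeddedness of thin strips -/

/-- The coincidences between points of the strips along Seifert circles: a point is given by two
names that differ by a shift, or two corners touch in a crossing. -/
def StripRel (p p' : D.Passage) (x x' s s' : ℝ) : Prop :=
  (∃ j j' : ℤ, (seifertPerm D ^ j) p = (seifertPerm D ^ j') p' ∧ x - j = x' - j' ∧ s = s') ∨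
  ∃ j j' : ℤ, x = j ∧ x' = j' ∧ (seifertPerm D ^ j') p' = ((seifertPerm D ^ j) p).other ∧
    s = -((seifertPerm D ^ j) p).sgn ∧ s' = ((seifertPerm D ^ j) p).sgn

/-- At ε = 0 the strips collapse onto the paths. If the two path points differ, nearby strip points
differ. Otherwise they are one point under two names, where the strip is locally injective, or two
corners at one crossing, where heights separate the strips. -/
lemma eventually_stripRel (p p' : D.Passage) (x₀ x₀' s₀ s₀' : ℝ) :
    ∀ᶠ w : ℝ × ℝ × ℝ × ℝ × ℝ in 𝓝 (0, x₀, x₀', s₀, s₀'), 0 < w.1 →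
      |w.2.2.2.1| ≤ 1 → |w.2.2.2.2| ≤ 1 →
      strip w.1 p w.2.1 w.2.2.2.1 = strip w.1 p' w.2.2.1 w.2.2.2.2 →
      StripRel p p' w.2.1 w.2.2.1 w.2.2.2.1 w.2.2.2.2 := by
  have hshift : ∀ (j j' : ℤ) (y₀ y₀' : ℝ), x₀ - j = y₀ → x₀' - j' = y₀' →
      Tendsto (fun w : ℝ × ℝ × ℝ × ℝ × ℝ =>
        (w.1, w.2.1 - j, w.2.2.1 - j', w.2.2.2.1, w.2.2.2.2))
        (𝓝 (0, x₀, x₀', s₀, s₀')) (𝓝 (0, y₀, y₀', s₀, s₀')) := by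
    rintro j j' y₀ y₀' rfl rfl
    exact Continuous.tendsto (by fun_prop) _
  by_cases hpath : p.path x₀ = p'.path x₀'
  · rcases path_eq_path hpath with ⟨hpp, hxx⟩ | ⟨hx, hx', hpp⟩
    · have hinj : ∀ᶠ w : ℝ × ℝ × ℝ × ℝ × ℝ in 𝓝 (0, x₀ - ⌊x₀⌋, x₀ - ⌊x₀⌋, s₀, s₀'), 0 < w.1 →
          strip w.1 ((seifertPerm D ^ ⌊x₀⌋) p) w.2.1 w.2.2.2.1 =
            strip w.1 ((seifertPerm D ^ ⌊x₀⌋) p) w.2.2.1 w.2.2.2.2 →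
          w.2.1 = w.2.2.1 ∧ w.2.2.2.1 = w.2.2.2.2 := by
        rcases (Int.fract_nonneg x₀).eq_or_lt with h0 | h0
        · rw [show x₀ - ⌊x₀⌋ = 0 from h0.symm]
          exact eventually_strip_injective_corner _ _ _
        · exact eventually_strip_injective_regular _ ⟨h0, Int.fract_lt_one x₀⟩ _ _
      filter_upwards [(hshift ⌊x₀⌋ ⌊x₀'⌋ _ _ rfl hxx.symm).eventually hinj]
      rintro ⟨ε, x, x', s, s'⟩ h hε hs hs' heq
      dsimp only at h hε heq ⊢
      rw [strip_eq_sub ε p x s ⌊x₀⌋, strip_eq_sub ε p' x' s' ⌊x₀'⌋, ← hpp] at heq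
      have := h hε heq
      exact Or.inl ⟨_, _, hpp, this.1, this.2⟩
    · filter_upwards [(hshift ⌊x₀⌋ ⌊x₀'⌋ 0 0 (sub_eq_zero.2 hx) (sub_eq_zero.2 hx')).eventually
        (eventually_strip_opposite ((seifertPerm D ^ ⌊x₀⌋) p) s₀ s₀')]
      rintro ⟨ε, x, x', s, s'⟩ h hε hs hs' heq
      dsimp only at h hε hs hs' heq ⊢
      rw [strip_eq_sub ε p x s ⌊x₀⌋, strip_eq_sub ε p' x' s' ⌊x₀'⌋, hpp] at heq
      obtain ⟨h1, h2, h3, h4⟩ := h hε hs hs' heq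
      exact Or.inr ⟨_, _, sub_eq_zero.1 h1, sub_eq_zero.1 h2, hpp, h3, h4⟩
  · have c1 : Continuous fun w : ℝ × ℝ × ℝ × ℝ × ℝ => strip w.1 p w.2.1 w.2.2.2.1 :=
      p.continuous_strip.comp (g := fun y : ℝ × ℝ × ℝ => strip y.1 p y.2.1 y.2.2)
        (f := fun w : ℝ × ℝ × ℝ × ℝ × ℝ => (w.1, w.2.1, w.2.2.2.1)) (by fun_prop)
    have c2 : Continuous fun w : ℝ × ℝ × ℝ × ℝ × ℝ => strip w.1 p' w.2.2.1 w.2.2.2.2 :=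
      p'.continuous_strip.comp (g := fun y : ℝ × ℝ × ℝ => strip y.1 p' y.2.1 y.2.2)
        (f := fun w : ℝ × ℝ × ℝ × ℝ × ℝ => (w.1, w.2.2.1, w.2.2.2.2)) (by fun_prop)
    have hne : ∀ᶠ w in 𝓝 ((0, x₀, x₀', s₀, s₀') : ℝ × ℝ × ℝ × ℝ × ℝ),
        strip w.1 p w.2.1 w.2.2.2.1 - strip w.1 p' w.2.2.1 w.2.2.2.2 ≠ 0 :=
      (c1.sub c2).continuousAt.eventually_ne (by simpa [strip, sub_eq_zero] using hpath)
    filter_upwards [hne] with w hw _ _ _ heq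
    exact absurd (sub_eq_zero.2 heq) hw

variable (D) in
/-- For a small width, the strips along the Seifert circles are embedded and disjoint, except that
they touch in the crossings. -/
lemma exists_strip_width : ∃ ε > 0, ∀ (p p' : D.Passage) (x x' s s' : ℝ), |s| ≤ 1 → |s'| ≤ 1 →
    strip ε p x s = strip ε p' x' s' → StripRel p p' x x' s s' := by
  -- The local statements at ε = 0 give one width by compactness of a fundamental domain; finitely
  -- many pairs of passages remain.
  have key : ∀ p p' : D.Passage, ∀ᶠ ε in 𝓝 (0 : ℝ), ∀ y ∈ Icc (0 : ℝ) 1 ×ˢ Icc (0 : ℝ) 1 ×ˢ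
      Icc (-1 : ℝ) 1 ×ˢ Icc (-1 : ℝ) 1, 0 < ε → |y.2.2.1| ≤ 1 → |y.2.2.2| ≤ 1 →
      strip ε p y.1 y.2.2.1 = strip ε p' y.2.1 y.2.2.2 →
      StripRel p p' y.1 y.2.1 y.2.2.1 y.2.2.2 := fun p p' =>
    (isCompact_Icc.prod (isCompact_Icc.prod
      (isCompact_Icc.prod isCompact_Icc))).eventually_forall_of_forall_eventually
      fun y _ => eventually_stripRel p p' y.1 y.2.1 y.2.2.1 y.2.2.2
  have h2 : ∀ᶠ ε in 𝓝[>] (0 : ℝ), _ :=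
    nhdsWithin_le_nhds (eventually_all.2 fun p => eventually_all.2 fun p' => key p p')
  obtain ⟨ε, h3, hε⟩ := (h2.and self_mem_nhdsWithin).exists
  refine ⟨ε, hε, fun p p' x x' s s' hs hs' heq => ?_⟩
  rw [strip_eq_sub ε p x s ⌊x⌋, strip_eq_sub ε p' x' s' ⌊x'⌋] at heq
  have := h3 _ _ (x - ⌊x⌋, x' - ⌊x'⌋, s, s')
    ⟨⟨Int.fract_nonneg x, (Int.fract_lt_one x).le⟩,
      ⟨Int.fract_nonneg x', (Int.fract_lt_one x').le⟩, abs_le.1 hs, abs_le.1 hs'⟩ hε hs hs' heq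
  dsimp only at this
  rcases this with ⟨j, j', h1, h2, h4⟩ | ⟨j, j', h1, h2, h4, h5, h6⟩
  · refine Or.inl ⟨j + ⌊x⌋, j' + ⌊x'⌋, ?_, ?_, h4⟩
    · rw [seifertPerm_zpow_add, seifertPerm_zpow_add, h1]
    · push_cast
      linarith
  · refine Or.inr ⟨j + ⌊x⌋, j' + ⌊x'⌋, ?_, ?_, ?_⟩
    · push_cast
      linarith
    · push_cast
      linarith
    · simp only [seifertPerm_zpow_add]
      exact ⟨h4, h5, h6⟩

/-! ### Arcs inside the strips -/

/-- A base passage on a Seifert circle. -/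
noncomputable def circleBase (C : D.SeifertCircle) (h : ∃ p : D.Passage, p.circle = C) :
    D.Passage := h.choose

/-- The base passage of the Seifert circle through a passage. -/
noncomputable def base (p : D.Passage) : D.Passage := circleBase p.circle ⟨p, rfl⟩

lemma circle_base (p : D.Passage) : p.base.circle = p.circle :=
  (⟨p, rfl⟩ : ∃ q : D.Passage, q.circle = p.circle).choose_spec

lemma base_eq_of_circle_eq {p q : D.Passage} (h : p.circle = q.circle) : p.base = q.base := by
  unfold base
  congr 1

lemma exists_pow_base_eq (p : D.Passage) : ∃ k : ℕ, (seifertPerm D ^ (k : ℤ)) p.base = p := by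
  obtain ⟨k, hk⟩ := (sameCycle_of_circle_eq p.circle_base).exists_nat_pow_eq
  exact ⟨k, by rwa [zpow_natCast]⟩

open Classical in
/-- The number of steps along the Seifert circle from the base passage. -/
noncomputable def steps (p : D.Passage) : ℕ := Nat.find p.exists_pow_base_eq

open Classical in
lemma pow_steps (p : D.Passage) : (seifertPerm D ^ (p.steps : ℤ)) p.base = p :=
  Nat.find_spec p.exists_pow_base_eq

-- If d did not exceed the number of steps, subtracting it would give a smaller number that still
-- reaches p, against minimality.
open Classical in
lemma steps_lt (p : D.Passage) {d : ℤ} (hd : 0 < d) (h : (seifertPerm D ^ d) p.base = p.base) :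
    (p.steps : ℤ) < d := by
  by_contra hle
  have h1 : (seifertPerm D ^ ((p.steps : ℤ) - d)) p.base = p := by
    conv_lhs => rw [← h]
    rw [← seifertPerm_zpow_add, sub_add_cancel, pow_steps]
  obtain ⟨k, hk⟩ := Int.eq_ofNat_of_zero_le (sub_nonneg.2 (not_lt.1 hle))
  rw [hk] at h1
  have h2 := Nat.find_min' p.exists_pow_base_eq h1
  change p.steps ≤ k at h2
  omega

variable (D) in
/-- A width for which the strips along the Seifert circles are embedded. -/
noncomputable def width : ℝ := (exists_strip_width D).choose

lemma stripRel_of_eq {p p' : D.Passage} {x x' s s' : ℝ} (hs : |s| ≤ 1) (hs' : |s'| ≤ 1)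
    (h : strip (width D) p x s = strip (width D) p' x' s') : StripRel p p' x x' s s' :=
  (exists_strip_width D).choose_spec.2 p p' x x' s s' hs hs' h

/-- An arc in the strip along the Seifert circle from the base point to a crossing. -/
noncomputable def halfArc (p : D.Passage) (τ : ℝ) : ℂ :=
  strip (width D) p.base (τ * p.steps) (-(τ * p.sgn))

lemma continuous_halfArc (p : D.Passage) : Continuous p.halfArc :=
  p.base.continuous_strip.comp (g := fun y : ℝ × ℝ × ℝ => strip y.1 p.base y.2.1 y.2.2)
    (f := fun τ : ℝ => (width D, τ * p.steps, -(τ * p.sgn))) (by fun_prop)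

lemma halfArc_zero (p : D.Passage) : p.halfArc 0 = strip (width D) p.base 0 0 := by
  simp [halfArc]

lemma halfArc_one (p : D.Passage) : p.halfArc 1 = p.pt := by
  have h := strip_add_int (width D) p.base 0 (-p.sgn) p.steps
  rw [pow_steps, zero_add] at h
  rw [halfArc, one_mul, one_mul]
  refine h.trans ?_
  simp [strip, path_zero, pathOffset_zero]

/-- On every half arc |s| equals τ, so points that agree in the strip have the same τ. For τ > 0 on
one circle the arcs can then differ only by their number of steps, which is less than a period. The
remaining coincidences are the base point and the touching points at τ = 1. -/
lemma halfArc_eq_halfArc {p p' : D.Passage} {τ τ' : ℝ} (hτ : τ ∈ Icc (0 : ℝ) 1)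
    (hτ' : τ' ∈ Icc (0 : ℝ) 1) (h : p.halfArc τ = p'.halfArc τ') :
    (p = p' ∧ τ = τ') ∨ (τ = 0 ∧ τ' = 0 ∧ p.circle = p'.circle) ∨
      (τ = 1 ∧ τ' = 1 ∧ p' = p.other) := by
  have habs : ∀ (q : D.Passage) {ρ : ℝ}, ρ ∈ Icc (0 : ℝ) 1 → |-(ρ * q.sgn)| = ρ := fun q ρ hρ => by
    rw [abs_neg, abs_mul, abs_sgn, mul_one, abs_of_nonneg hρ.1]
  rcases stripRel_of_eq ((habs p hτ).trans_le hτ.2) ((habs p' hτ').trans_le hτ'.2) h with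
    ⟨j, j', hj, hx, hs⟩ | ⟨j, j', hx, hx', hj, hs, hs'⟩
  · have hττ' : τ = τ' := by rw [← habs p hτ, hs, habs p' hτ']
    subst hττ'
    have hc : p.circle = p'.circle := by
      have := congrArg circle hj
      rwa [circle_seifertPerm_zpow, circle_seifertPerm_zpow, circle_base, circle_base] at this
    rcases hτ.1.eq_or_lt with h0 | h0
    · exact Or.inr (Or.inl ⟨h0.symm, h0.symm, hc⟩)
    · left
      refine ⟨?_, rfl⟩
      rw [← base_eq_of_circle_eq hc] at hj
      have hd : ∀ {i i' : ℤ}, (seifertPerm D ^ i) p.base = (seifertPerm D ^ i') p.base →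
          (seifertPerm D ^ (i - i')) p.base = p.base := fun {i i'} h => by
        rw [sub_eq_neg_add, seifertPerm_zpow_add, h, ← seifertPerm_zpow_add, neg_add_cancel]
        rfl
      have hpn : (0 : ℝ) ≤ p.steps := Nat.cast_nonneg _
      have hpn' : (0 : ℝ) ≤ p'.steps := Nat.cast_nonneg _
      -- The difference of j and j' is a period and equals τ times the difference of the step
      -- numbers; by `steps_lt` that is too small unless it is zero.
      have hjj : j = j' := by
        rcases lt_trichotomy j j' with hlt | heq | hlt
        · exfalso
          have h1 := p'.steps_lt (sub_pos.2 hlt)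
            (by rw [← base_eq_of_circle_eq hc]; exact hd hj.symm)
          have h2 : (p'.steps : ℝ) < j' - j := by exact_mod_cast h1
          nlinarith [hτ.2]
        · exact heq
        · exfalso
          have h1 := p.steps_lt (sub_pos.2 hlt) (hd hj)
          have h2 : (p.steps : ℝ) < j - j' := by exact_mod_cast h1
          nlinarith [hτ.2]
      rw [hjj] at hx
      have hk : (p.steps : ℝ) = p'.steps := mul_left_cancel₀ h0.ne' (sub_left_injective hx)
      have hk' : p.steps = p'.steps := by exact_mod_cast hk
      rw [← p.pow_steps, ← p'.pow_steps, hk', base_eq_of_circle_eq hc]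
  · right; right
    have h1 : τ = 1 := by rw [← habs p hτ, hs, abs_neg, abs_sgn]
    have h1' : τ' = 1 := by rw [← habs p' hτ', hs', abs_sgn]
    subst h1 h1'
    rw [one_mul] at hx hx'
    have hkj : (p.steps : ℤ) = j := by exact_mod_cast hx
    have hkj' : (p'.steps : ℤ) = j' := by exact_mod_cast hx'
    rw [← hkj, ← hkj', pow_steps, pow_steps] at hj
    exact ⟨rfl, rfl, hj⟩

variable (D) in
lemma exists_norm_halfArc_le : ∃ R : ℝ, ∀ (p : D.Passage), ∀ τ ∈ Icc (0 : ℝ) 1,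
    ‖p.halfArc τ‖ ≤ R := by
  have h : ∀ p : D.Passage, ∃ R : ℝ, ∀ τ ∈ Icc (0 : ℝ) 1, ‖p.halfArc τ‖ ≤ R := fun p =>
    isCompact_Icc.exists_bound_of_continuousOn p.continuous_halfArc.continuousOn
  choose R hR using h
  obtain ⟨M, hM⟩ := (Set.finite_range R).bddAbove
  exact ⟨M, fun p τ hτ => (hR p τ hτ).trans (hM ⟨p, rfl⟩)⟩

end Passage

/-! ### The plane drawing -/

open Classical in
variable (D) in
/-- The position of a vertex of the Seifert graph. Circles without crossings are put far away. -/
noncomputable def vertexPoint (C : D.SeifertCircle) : ℂ :=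
  if h : ∃ p : D.Passage, p.circle = C then
    Passage.strip (Passage.width D) (Passage.circleBase C h) 0 0
  else (((Passage.exists_norm_halfArc_le D).choose + 1 +
    ((Finite.equivFin D.SeifertCircle C : ℕ) : ℝ) : ℝ) : ℂ)

lemma vertexPoint_circle (p : D.Passage) : D.vertexPoint p.circle = p.halfArc 0 := by
  rw [vertexPoint, dif_pos ⟨p, rfl⟩, Passage.halfArc_zero]
  rfl

/-- All half arcs lie in a disc of radius R, while such a vertex sits on the real axis at R + 1 or
beyond. -/
lemma vertexPoint_ne_halfArc {C : D.SeifertCircle} (hC : ¬ ∃ p : D.Passage, p.circle = C)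
    (p : D.Passage) {τ : ℝ} (hτ : τ ∈ Icc (0 : ℝ) 1) : D.vertexPoint C ≠ p.halfArc τ := by
  intro h
  have hR := (Passage.exists_norm_halfArc_le D).choose_spec p τ hτ
  rw [← h, vertexPoint, dif_neg hC, Complex.norm_real] at hR
  have h1 := (le_abs_self _).trans hR
  have h2 : (0 : ℝ) ≤ ((Finite.equivFin D.SeifertCircle C : ℕ) : ℝ) := Nat.cast_nonneg _
  linarith

lemma vertexPoint_injective : Function.Injective D.vertexPoint := by
  have hz : (0 : ℝ) ∈ Icc (0 : ℝ) 1 := ⟨le_rfl, zero_le_one⟩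
  intro C C' h
  by_cases hC : ∃ p : D.Passage, p.circle = C
  · obtain ⟨p, rfl⟩ := hC
    by_cases hC' : ∃ p : D.Passage, p.circle = C'
    · obtain ⟨p', rfl⟩ := hC'
      rw [vertexPoint_circle, vertexPoint_circle] at h
      rcases Passage.halfArc_eq_halfArc hz hz h with ⟨h, -⟩ | ⟨-, -, h⟩ | ⟨h, -⟩
      · rw [h]
      · exact h
      · norm_num at h
    · rw [vertexPoint_circle] at h
      exact absurd h.symm (vertexPoint_ne_halfArc hC' p hz)
  · by_cases hC' : ∃ p : D.Passage, p.circle = C'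
    · obtain ⟨p', rfl⟩ := hC'
      rw [vertexPoint_circle] at h
      exact absurd h (vertexPoint_ne_halfArc hC p' hz)
    · rw [vertexPoint, vertexPoint, dif_neg hC, dif_neg hC'] at h
      have h1 := add_left_cancel (Complex.ofReal_injective h)
      simpa [Fin.val_inj] using h1

variable (D) in
/-- A passage through a crossing. -/
noncomputable def crossingPassage (e : D.Crossing) : D.Passage :=
  (exists_passage_of_crossing e).choose

lemma curve_crossingPassage (e : D.Crossing) :
    D.curve (D.crossingPassage e).param.1 (D.crossingPassage e).param.2 = e :=
  (exists_passage_of_crossing e).choose_spec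

lemma crossing_eq_of_pt_eq {e f : D.Crossing}
    (h : (D.crossingPassage e).pt = (D.crossingPassage f).pt) : e = f :=
  Subtype.ext ((curve_crossingPassage e).symm.trans
    ((z_eq_iff.1 h).trans (curve_crossingPassage f)))

variable (D) in
/-- The arc of an edge of the Seifert graph, composed of two half arcs that meet in the crossing. -/
noncomputable def edgeArc (e : D.Crossing) (t : ℝ) : ℂ :=
  if t ≤ 1 / 2 then (D.crossingPassage e).halfArc (2 * t)
  else (D.crossingPassage e).other.halfArc (2 - 2 * t)

lemma continuous_edgeArc (e : D.Crossing) : Continuous (D.edgeArc e) := by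
  refine Continuous.if_le ?_ ?_ continuous_id continuous_const ?_
  · exact (Passage.continuous_halfArc _).comp (by fun_prop)
  · exact (Passage.continuous_halfArc _).comp (by fun_prop)
  · rintro t ht
    have h1 : 2 * t = 1 := by rw [show t = 1 / 2 from ht]; norm_num
    have h2 : 2 - 2 * t = 1 := by rw [h1]; norm_num
    rw [h2, h1, Passage.halfArc_one, Passage.halfArc_one, Passage.pt_other]

lemma edgeArc_zero (e : D.Crossing) : D.edgeArc e 0 = D.vertexPoint (D.crossingPassage e).circle := by
  simp [edgeArc, vertexPoint_circle]

lemma edgeArc_one (e : D.Crossing) :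
    D.edgeArc e 1 = D.vertexPoint (D.crossingPassage e).other.circle := by
  rw [edgeArc, if_neg (by norm_num), vertexPoint_circle]
  norm_num

/-- Points in the interior of edge arcs lie on half arcs, away from the vertices. -/
lemma exists_edgeArc_eq_halfArc (e : D.Crossing) {t : ℝ} (ht : t ∈ Ioo (0 : ℝ) 1) :
    ∃ p : D.Passage, ∃ τ ∈ Ioc (0 : ℝ) 1, D.edgeArc e t = p.halfArc τ ∧
      ((p = D.crossingPassage e ∧ τ = 2 * t) ∨
        (p = (D.crossingPassage e).other ∧ τ = 2 - 2 * t ∧ τ < 1)) := by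
  by_cases h : t ≤ 1 / 2
  · exact ⟨_, 2 * t, ⟨by linarith [ht.1], by linarith⟩, if_pos h, Or.inl ⟨rfl, rfl⟩⟩
  · exact ⟨_, 2 - 2 * t, ⟨by linarith [ht.2], by linarith [not_le.1 h]⟩, if_neg h,
      Or.inr ⟨rfl, rfl, by linarith [not_le.1 h]⟩⟩

lemma edgeArc_ne_vertexPoint (e : D.Crossing) {t : ℝ} (ht : t ∈ Ioo (0 : ℝ) 1)
    (C : D.SeifertCircle) : D.edgeArc e t ≠ D.vertexPoint C := by
  obtain ⟨p, τ, hτ, hp, -⟩ := exists_edgeArc_eq_halfArc e ht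
  rw [hp]
  intro h
  by_cases hC : ∃ p : D.Passage, p.circle = C
  · obtain ⟨q, rfl⟩ := hC
    rw [vertexPoint_circle] at h
    rcases Passage.halfArc_eq_halfArc (Ioc_subset_Icc_self hτ) ⟨le_rfl, zero_le_one⟩ h with
      ⟨-, h⟩ | ⟨h, -⟩ | ⟨-, h, -⟩
    · exact hτ.1.ne' h
    · exact hτ.1.ne' h
    · norm_num at h
  · exact vertexPoint_ne_halfArc hC p (Ioc_subset_Icc_self hτ) h.symm

lemma edgeArc_eq_edgeArc {e f : D.Crossing} {s t : ℝ} (hs : s ∈ Ioo (0 : ℝ) 1)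
    (ht : t ∈ Ioo (0 : ℝ) 1) (h : D.edgeArc e s = D.edgeArc f t) : e = f ∧ s = t := by
  obtain ⟨p, σ, hσ, hp, hpe⟩ := exists_edgeArc_eq_halfArc e hs
  obtain ⟨q, τ, hτ, hq, hqf⟩ := exists_edgeArc_eq_halfArc f ht
  rw [hp, hq] at h
  have hpt : ∀ {e : D.Crossing} {p : D.Passage} {σ s : ℝ}, ((p = D.crossingPassage e ∧ σ = 2 * s) ∨
      (p = (D.crossingPassage e).other ∧ σ = 2 - 2 * s ∧ σ < 1)) →
      p.pt = (D.crossingPassage e).pt := by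
    rintro e p σ s (⟨rfl, -⟩ | ⟨rfl, -⟩)
    · rfl
    · exact Passage.pt_other _
  rcases Passage.halfArc_eq_halfArc (Ioc_subset_Icc_self hσ) (Ioc_subset_Icc_self hτ) h with
    ⟨h1, h2⟩ | ⟨h1, -⟩ | ⟨h1, h2, h3⟩
  · have hef : e = f := crossing_eq_of_pt_eq ((hpt hpe).symm.trans (h1 ▸ hpt hqf))
    subst hef h1 h2
    refine ⟨rfl, ?_⟩
    rcases hpe with ⟨a1, a2⟩ | ⟨a1, a2, -⟩ <;> rcases hqf with ⟨b1, b2⟩ | ⟨b1, b2, -⟩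
    · linarith
    · exact absurd (b1.symm.trans a1) (Passage.other_ne _)
    · exact absurd (a1.symm.trans b1) (Passage.other_ne _)
    · linarith
  · exact absurd h1 hσ.1.ne'
  · have hef : e = f := crossing_eq_of_pt_eq ((hpt hpe).symm.trans
      ((Passage.pt_other p).symm.trans (h3 ▸ hpt hqf)))
    subst hef
    refine ⟨rfl, ?_⟩
    -- Both half arcs are at their end 1. The second half of an edge excludes that value, so only s
    -- = t = 1/2 is left.
    rcases hpe with ⟨-, a2⟩ | ⟨-, -, a3⟩ <;> rcases hqf with ⟨-, b2⟩ | ⟨-, -, b3⟩ <;> linarith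

variable (D) in
theorem isPlanarGraph_seifertGraph : IsPlanarGraph D.seifertGraph :=
  ⟨{ point := fun C => planeEquivComplex.symm (D.vertexPoint C)
     arc := fun e t => planeEquivComplex.symm (D.edgeArc e t)
     point_injOn := fun _ _ _ _ h => vertexPoint_injective (planeEquivComplex.symm.injective h)
     arc_continuousOn := fun e _ =>
       (planeEquivComplex.symm.continuous.comp (continuous_edgeArc e)).continuousOn
     arc_ends := fun e _ => ⟨_, _, (D.crossingPassage e).joins (curve_crossingPassage e),
       congrArg planeEquivComplex.symm (edgeArc_zero e),
       congrArg planeEquivComplex.symm (edgeArc_one e)⟩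
     arc_injOn := fun _ _ _ hs _ ht h =>
       (edgeArc_eq_edgeArc hs ht (planeEquivComplex.symm.injective h)).2
     arc_ne_point := fun e _ _ ht x _ h =>
       edgeArc_ne_vertexPoint e ht x (planeEquivComplex.symm.injective h)
     arc_ne_arc := fun _ _ _ _ hef _ hs _ ht h =>
       hef (edgeArc_eq_edgeArc hs ht (planeEquivComplex.symm.injective h)).1 }⟩

lemma edgeSet_seifertGraph : D.seifertGraph.edgeSet = univ :=
  eq_univ_of_forall fun e => (D.seifertGraph.edge_mem_iff_exists_isLink e).2
    ⟨_, _, (D.crossingPassage e).joins (curve_crossingPassage e)⟩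

end GeneralizedLinkDiagram

theorem theorem3p4 {T : Type*} (D : GeneralizedLinkDiagram T) :
    IsPlanarGraph D.seifertGraph ∧ IsBipartiteGraph D.seifertGraph ∧
      D.seifertGraph.edgeSet.encard = D.crossingNumber ∧
      D.seifertGraph.vertexSet.encard = D.numSeifertCircles := by
  -- Finiteness makes `Nat.card` the true cardinality; on an infinite type it would be 0.
  have : Finite D.Crossing := D.finite_doublePoints.to_subtype
  refine ⟨D.isPlanarGraph_seifertGraph, D.isBipartiteGraph_seifertGraph, ?_, ?_⟩
  · rw [GeneralizedLinkDiagram.edgeSet_seifertGraph, encard_univ, ENat.card_eq_coe_natCard]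
    rfl
  · rw [show D.seifertGraph.vertexSet = univ from rfl, encard_univ, ENat.card_eq_coe_natCard]
    rfl
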